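/- For real parameters let $$H^L=\tfrac{b_L}{2}y^2-\tfrac{c_L}{2}x^2+a_Lxy+a_Ly-\beta_Lx,\qquad H^C=\tfrac12x^2+\tfrac12y^2,\qquad H^R=\tfrac{b_R}{2}y^2-\tfrac{c_R}{2}x^2+a_Rxy-a_Ry-\beta_Rx,$$ and, for $i\in\{L,C,R\}$, $f_i=p_ix+q_iy+r_i$ and $g_i=s_ix+u_iy+v_i$. Consider the piecewise linear system with three zones $$\dot x=H_y+\epsilon f,\qquad \dot y=-H_x+\epsilon g,\qquad (\ast)$$ where $(H,f,g)$ equals $(H^L,f_L,g_L)$ for $x<-1$, $(H^C,f_C,g_C)$ for $-1<x<1$, and $(H^R,f_R,g_R)$ for $x>1$; solutions are understood in the sense of Filippov. A periodic orbit is the image of a nonconstant periodic solution. A crossing periodic orbit is a periodic orbit that visits all three zones and meets the lines $x=\pm1$ only at points where the $\dot x$-components of the two adjacent fields are nonzero and of the same sign. A limit cycle is a crossing periodic orbit $\Gamma$ that has an open neighbourhood containing no periodic orbit other than $\Gamma$. Let $a_L=\beta_L=b_R=c_R=1$, $b_L=2$, $c_L=-1$, $a_R=0$, $\beta_R=-2$.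 Then for $\epsilon=0$ the left subsystem has a virtual center (not in $x<-1$), the central subsystem a real center (in $-1<x<1$) and the right subsystem a real saddle (in $x>1$), and for every $h\in(0,1)$ there is a crossing periodic orbit $L_h$ meeting the lines $x=\pm1$ exactly at $(1,h),(1,-h),(-1,-h),(-1,h)$. Moreover, at least three limit cycles bifurcate from the periodic annulus $\{L_h\}_{0<h<1}$: there are perturbation coefficients $p_i,q_i,r_i,s_i,u_i,v_i$ ($i=L,C,R$), values $0<h_1<h_2<h_3<1$ and $\epsilon_0>0$ such that for every $\epsilon\in(0,\epsilon_0)$ the system $(\ast)$ has three pairwise distinct limit cycles $\Gamma_1(\epsilon),\Gamma_2(\epsilon),\Gamma_3(\epsilon)$, and $\Gamma_j(\epsilon)\to L_{h_j}$ in the Hausdorff distance as $\epsilon\to0^+$ for $j=1,2,3$. -/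

import Mathlib

/-! Planar piecewise linear near-Hamiltonian systems with three zones `x < -1`, `-1 < x < 1`,
`1 < x`, their Filippov solutions, periodic orbits and limit cycles. -/

namespace ThreeZone

/-- Coefficients of a quadratic Hamiltonian
`(b/2) y² - (c/2) x² + a x y + α y - β x`. -/
structure HamCoeff where
  a : ℝ
  b : ℝ
  c : ℝ
  α : ℝ
  β : ℝ

/-- The quadratic Hamiltonian with the given coefficients. -/
noncomputable def HamCoeff.H (K : HamCoeff) (x y : ℝ) : ℝ :=
  K.b / 2 * y ^ 2 - K.c / 2 * x ^ 2 + K.a * x * y + K.α * y - K.β * x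

/-- The Hamiltonian vector field `(∂H/∂y, -∂H/∂x)`, which is affine. -/
def HamCoeff.field (K : HamCoeff) (z : ℝ × ℝ) : ℝ × ℝ :=
  (K.a * z.1 + K.b * z.2 + K.α, K.c * z.1 - K.a * z.2 + K.β)

theorem HamCoeff.hasDerivAt_H_snd (K : HamCoeff) (z : ℝ × ℝ) :
    HasDerivAt (fun y => K.H z.1 y) (K.field z).1 z.2 := by
  have h1 := ((hasDerivAt_id z.2).pow 2).const_mul (K.b / 2)
  have h2 := (hasDerivAt_id z.2).const_mul (K.a * z.1)
  have h3 := (hasDerivAt_id z.2).const_mul K.α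
  have h := ((((h1.sub_const (K.c / 2 * z.1 ^ 2)).add h2).add h3).sub_const (K.β * z.1))
  refine h.congr_deriv ?_
  simp [HamCoeff.field]
  ring

theorem HamCoeff.hasDerivAt_H_fst (K : HamCoeff) (z : ℝ × ℝ) :
    HasDerivAt (fun x => K.H x z.2) (-(K.field z).2) z.1 := by
  have h1 := ((hasDerivAt_id z.1).pow 2).const_mul (K.c / 2)
  have h2 := ((hasDerivAt_id z.1).const_mul K.a).mul_const z.2
  have h3 := (hasDerivAt_id z.1).const_mul K.β
  have h := ((((h1.const_sub (K.b / 2 * z.2 ^ 2)).add h2).add_const (K.α * z.2)).sub h3)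
  refine h.congr_deriv ?_
  simp [HamCoeff.field]
  ring

/-- The matrix of the linear part of the Hamiltonian field. It has trace zero, so its eigenvalues
are the two square roots of `-det`. -/
def HamCoeff.linearPart (K : HamCoeff) : Matrix (Fin 2) (Fin 2) ℝ :=
  !![K.a, K.b; K.c, -K.a]

/-- `p` is an equilibrium with eigenvalues `±iω`, `ω > 0`. -/
def HamCoeff.IsCenter (K : HamCoeff) (p : ℝ × ℝ) : Prop :=
  K.field p = 0 ∧ 0 < K.linearPart.det

/-- `p` is an equilibrium with eigenvalues `±ω`, `ω > 0`. -/
def HamCoeff.IsSaddle (K : HamCoeff) (p : ℝ × ℝ) : Prop :=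
  K.field p = 0 ∧ K.linearPart.det < 0

/-- Coefficients of an affine perturbation `(p x + q y + r, s x + u y + v)`. -/
structure PertCoeff where
  p : ℝ
  q : ℝ
  r : ℝ
  s : ℝ
  u : ℝ
  v : ℝ

/-- The perturbing field `(f, g)`. -/
def PertCoeff.field (P : PertCoeff) (z : ℝ × ℝ) : ℝ × ℝ :=
  (P.p * z.1 + P.q * z.2 + P.r, P.s * z.1 + P.u * z.2 + P.v)

/-- One object for each of the left, central and right zones. -/
structure Zones (A : Type) where
  L : A
  C : A
  R : A

/-- The open left zone. -/
def zoneL : Set (ℝ × ℝ) := {z | z.1 < -1}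

/-- The open central zone. -/
def zoneC : Set (ℝ × ℝ) := {z | -1 < z.1 ∧ z.1 < 1}

/-- The open right zone. -/
def zoneR : Set (ℝ × ℝ) := {z | 1 < z.1}

/-- The three affine fields `(H_y + ε f, -H_x + ε g)`. -/
def perturbedFields (K : Zones HamCoeff) (P : Zones PertCoeff) (ε : ℝ) :
    Zones (ℝ × ℝ → ℝ × ℝ) where
  L z := K.L.field z + ε • P.L.field z
  C z := K.C.field z + ε • P.C.field z
  R z := K.R.field z + ε • P.R.field z

/-- The three unperturbed fields. -/
def unperturbedFields (K : Zones HamCoeff) : Zones (ℝ × ℝ → ℝ × ℝ) where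
  L := K.L.field
  C := K.C.field
  R := K.R.field

/-- Filippov's set-valued field: on a switching line the convex hull of the two adjacent
field values, off the switching lines the value of the field of the zone. -/
noncomputable def filippov (X : Zones (ℝ × ℝ → ℝ × ℝ)) (z : ℝ × ℝ) : Set (ℝ × ℝ) :=
  if z.1 < -1 then {X.L z}
  else if z.1 = -1 then segment ℝ (X.L z) (X.C z)
  else if z.1 < 1 then {X.C z}
  else if z.1 = 1 then segment ℝ (X.C z) (X.R z)
  else {X.R z}

/-- Filippov solutions defined for all times. -/
def IsSolution (X : Zones (ℝ × ℝ → ℝ × ℝ)) (γ : ℝ → ℝ × ℝ) : Prop :=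
  (∀ s t : ℝ, AbsolutelyContinuousOnInterval γ s t) ∧
    ∀ᵐ t : ℝ, ∃ v ∈ filippov X (γ t), HasDerivAt γ v t

/-- `Γ` is the orbit of a nonconstant periodic Filippov solution. -/
def IsPeriodicOrbit (X : Zones (ℝ × ℝ → ℝ × ℝ)) (Γ : Set (ℝ × ℝ)) : Prop :=
  ∃ γ : ℝ → ℝ × ℝ, IsSolution X γ ∧ (∃ T > 0, Function.Periodic γ T) ∧
    (∃ s t, γ s ≠ γ t) ∧ Set.range γ = Γ

/-- Crossing points of the two switching lines: the normal components of the two adjacent fields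
are nonzero and have the same sign. -/
def crossingSet (X : Zones (ℝ × ℝ → ℝ × ℝ)) : Set (ℝ × ℝ) :=
  {z | (z.1 = -1 ∧ 0 < (X.L z).1 * (X.C z).1) ∨ (z.1 = 1 ∧ 0 < (X.R z).1 * (X.C z).1)}

/-- A periodic orbit that visits all three zones and meets the switching lines only at
crossing points. -/
def IsCrossingPeriodicOrbit (X : Zones (ℝ × ℝ → ℝ × ℝ)) (Γ : Set (ℝ × ℝ)) : Prop :=
  IsPeriodicOrbit X Γ ∧
    (Γ ∩ zoneL).Nonempty ∧ (Γ ∩ zoneC).Nonempty ∧ (Γ ∩ zoneR).Nonempty ∧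
    ∀ z ∈ Γ, z.1 = -1 ∨ z.1 = 1 → z ∈ crossingSet X

/-- A crossing limit cycle visiting the three zones: a crossing periodic orbit that is isolated
among all periodic orbits (crossing or not). -/
def IsCrossingLimitCycle (X : Zones (ℝ × ℝ → ℝ × ℝ)) (Γ : Set (ℝ × ℝ)) : Prop :=
  IsCrossingPeriodicOrbit X Γ ∧
    ∃ U : Set (ℝ × ℝ), IsOpen U ∧ Γ ⊆ U ∧ ∀ Γ', IsPeriodicOrbit X Γ' → Γ' ⊆ U → Γ' = Γ

/-- The normal form: `H^C = x²/2 + y²/2`, and linear `y`-coefficients `a_L` and `-a_R` of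
`H^L` and `H^R`. -/
def normalForm (aL bL cL βL aR bR cR βR : ℝ) : Zones HamCoeff where
  L := { a := aL, b := bL, c := cL, α := aL, β := βL }
  C := { a := 0, b := 1, c := -1, α := 0, β := 0 }
  R := { a := aR, b := bR, c := cR, α := -aR, β := βR }

/-- The normal form with `a_L = β_L = b_R = c_R = 1`, `b_L = 2`, `c_L = -1`, `a_R = 0`,
`β_R = -2`. -/
def ccsSystem : Zones HamCoeff :=
  normalForm (aL := 1) (bL := 2) (cL := -1) (βL := 1) (aR := 0) (bR := 1) (cR := 1) (βR := -2)

end ThreeZone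

/-! Three crossing limit cycles bifurcating from a periodic annulus of a planar piecewise linear
system with three zones.

The perturbation is chosen so that each zone keeps an explicit flow: in the left and central zones
the perturbing field is radial about the center (`Params.flowL`, `Params.flowC`), in the right zone
it keeps the eigendirections of the saddle (`Params.flowR`). The passage through a zone between two
points of the switching lines then amounts to one scalar relation between the heights
(`Params.RelR`, `Params.RelC`, `Params.RelL`), in which the time of passage is an explicit function
of the heights. A closed orbit with four heights `y₁, y₂, y₃, y₄` is a solution of four such
relations (`Params.IsCycle`).

For `ε = 0` every passage preserves the square of the height. The sum of the four relations is
therefore divisible by `ε`, and the quotient at `ε = 0` and equal heights is the displacement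
function `Params.melnikov`. The inverse function theorem continues each simple zero `h` of it to a
locally unique branch of closed orbits (`Params.exists_branch`), and these converge to the annulus
orbit of height `h` since the trajectories depend continuously on `ε` (`Params.tendsto_loop`).

A closed orbit on such a branch is isolated among all periodic Filippov orbits
(`Params.IsCycle.isCrossingLimitCycle`). A periodic orbit in a small neighbourhood can meet the
switching lines only transversally, so it follows the same cyclic order of passages. The
half-return maps are increasing, hence the highest point of the orbit on the upper half of `x = 1`
is a fixed point of the return map, and local uniqueness identifies the two orbits.

Finally, `b` enters the quotient `melnikov y / y` only through the additive constant `-2 b`. With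
small `kC > 0`, `kL = 3` and `kR = -1` the displacement function takes alternating signs at `0`,
`1/3`, `7/9` and `1` for every `b` in an interval, and for almost all of these `b` its zeros are
simple, by Sard's lemma for the quotient (`exists_simple_zeros`). -/

namespace ThreeZone

open Set Filter Topology MeasureTheory

/-! ### Filippov solutions -/

theorem IsSolution.continuous {X : Zones (ℝ × ℝ → ℝ × ℝ)} {γ : ℝ → ℝ × ℝ}
    (h : IsSolution X γ) : Continuous γ := by
  rw [continuous_iff_continuousAt]
  intro t
  refine (h.1 (t - 1) (t + 1)).continuousOn.continuousAt ?_
  rw [uIcc_of_le (by linarith)]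
  exact Icc_mem_nhds (by linarith) (by linarith)

/-- A convex constraint satisfied by the fields of the adjacent zones is inherited by Filippov's
set. -/
theorem filippov_subset_of_convex {X : Zones (ℝ × ℝ → ℝ × ℝ)} {z : ℝ × ℝ} {S : Set (ℝ × ℝ)}
    (hS : Convex ℝ S) (hL : z.1 ≤ -1 → X.L z ∈ S) (hC : -1 ≤ z.1 → z.1 ≤ 1 → X.C z ∈ S)
    (hR : 1 ≤ z.1 → X.R z ∈ S) : filippov X z ⊆ S := by
  unfold filippov
  split_ifs with h1 h2 h3 h4
  · exact singleton_subset_iff.2 (hL h1.le)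
  · exact hS.segment_subset (hL h2.le) (hC h2.ge (by linarith))
  · exact singleton_subset_iff.2 (hC (by linarith) h3.le)
  · exact hS.segment_subset (hC (by linarith) h4.le) (hR h4.ge)
  · exact singleton_subset_iff.2 (hR (by linarith))

theorem filippov_of_mem_zoneL {X : Zones (ℝ × ℝ → ℝ × ℝ)} {z : ℝ × ℝ} (h : z ∈ zoneL) :
    filippov X z = {X.L z} := by
  have h : z.1 < -1 := h
  simp [filippov, h]

theorem filippov_of_mem_zoneC {X : Zones (ℝ × ℝ → ℝ × ℝ)} {z : ℝ × ℝ} (h : z ∈ zoneC) :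
    filippov X z = {X.C z} := by
  have h : -1 < z.1 ∧ z.1 < 1 := h
  simp [filippov, h.2, h.1.ne', h.1.le]

theorem filippov_of_mem_zoneR {X : Zones (ℝ × ℝ → ℝ × ℝ)} {z : ℝ × ℝ} (h : z ∈ zoneR) :
    filippov X z = {X.R z} := by
  have h : 1 < z.1 := h
  simp [filippov, h.ne', not_lt.2 h.le, not_lt.2 (show (-1 : ℝ) ≤ z.1 by linarith),
    (show z.1 ≠ -1 by linarith)]

/-- An absolutely continuous curve with a continuous velocity almost everywhere is the integral of
that velocity, hence continuously differentiable. -/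
theorem eq_add_integral_of_ae_hasDerivAt {γ v : ℝ → ℝ × ℝ}
    (hac : ∀ s t, AbsolutelyContinuousOnInterval γ s t) (hv : Continuous v) {a b : ℝ}
    (hd : ∀ᵐ t : ℝ, t ∈ Ioo a b → HasDerivAt γ (v t) t) :
    ∀ t ∈ Icc a b, γ t = γ a + ∫ s in a..t, v s := by
  intro t ht
  have hab : a ≤ b := ht.1.trans ht.2
  have hg : ∀ x, HasDerivAt (fun x => ∫ s in a..x, v s) (v x) x := fun x =>
    intervalIntegral.integral_hasDerivAt_right (hv.intervalIntegrable _ _)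
      hv.aestronglyMeasurable.stronglyMeasurableAtFilter hv.continuousAt
  have hgac : AbsolutelyContinuousOnInterval (fun x => ∫ s in a..x, v s) a b := by
    refine ContDiffOn.absolutelyContinuousOnInterval (ContDiff.contDiffOn ?_)
    rw [contDiff_one_iff_deriv]
    refine ⟨fun x => (hg x).differentiableAt, ?_⟩
    rwa [show deriv (fun x => ∫ s in a..x, v s) = v from funext fun x => (hg x).deriv]
  obtain ⟨C, hC⟩ := ((hac a b).sub hgac).const_of_ae_hasDerivAt_zero (by
    have ha : ∀ᵐ t : ℝ, t ≠ a := by simp [ae_iff, measure_singleton]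
    have hb : ∀ᵐ t : ℝ, t ≠ b := by simp [ae_iff, measure_singleton]
    filter_upwards [hd, ha, hb] with x hx hxa hxb hxI
    rw [uIcc_of_le hab] at hxI
    have := (hx ⟨lt_of_le_of_ne hxI.1 hxa.symm, lt_of_le_of_ne hxI.2 hxb⟩).sub (hg x)
    simpa using this)
  have h1 := hC t (by rwa [uIcc_of_le hab])
  have h2 := hC a (by rw [uIcc_of_le hab]; exact ⟨le_rfl, hab⟩)
  simp only [Pi.sub_apply, intervalIntegral.integral_same, sub_zero] at h1 h2
  rw [h2, ← h1]; abel

/-- An absolutely continuous curve that satisfies an autonomous Lipschitz equation almost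
everywhere agrees with the classical solution. -/
theorem eqOn_of_ae_hasDerivAt {γ φ : ℝ → ℝ × ℝ} {F : ℝ × ℝ → ℝ × ℝ} {K : NNReal}
    (hac : ∀ s t, AbsolutelyContinuousOnInterval γ s t) (hγ : Continuous γ)
    (hF : LipschitzWith K F) {a b : ℝ}
    (hd : ∀ᵐ t : ℝ, t ∈ Ioo a b → HasDerivAt γ (F (γ t)) t)
    (hφ : ∀ t, HasDerivAt φ (F (φ t)) t) (h0 : γ a = φ a) : EqOn γ φ (Icc a b) := by
  have hv : Continuous fun t => F (γ t) := hF.continuous.comp hγ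
  have hint := eq_add_integral_of_ae_hasDerivAt hac hv hd
  refine ODE_solution_unique_of_mem_Icc_right (v := fun _ => F) (s := fun _ => univ)
    (fun t _ => hF.lipschitzOnWith) hγ.continuousOn ?_ (fun _ _ => mem_univ _)
    (fun t _ => (hφ t).continuousAt.continuousWithinAt)
    (fun t _ => (hφ t).hasDerivWithinAt) (fun _ _ => mem_univ _) h0
  intro t ht
  have hg : HasDerivAt (fun x => γ a + ∫ s in a..x, F (γ s)) (F (γ t)) t :=
    (intervalIntegral.integral_hasDerivAt_right (hv.intervalIntegrable _ _)
      hv.aestronglyMeasurable.stronglyMeasurableAtFilter hv.continuousAt).const_add _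
  refine (hg.hasDerivWithinAt (s := Ici t)).congr_of_eventuallyEq ?_
    (hint t ⟨ht.1, ht.2.le⟩)
  filter_upwards [Icc_mem_nhdsGE ht.2] with x hx
  exact hint x ⟨ht.1.trans hx.1, hx.2⟩

/-- A Filippov solution whose velocities satisfy `c < σ ẋ` moves in the direction `σ`. -/
theorem IsSolution.lt_of_forall_filippov {X : Zones (ℝ × ℝ → ℝ × ℝ)} {γ : ℝ → ℝ × ℝ}
    (h : IsSolution X γ) {σ c a b : ℝ} (hc : 0 < c) (hab : a < b)
    (hf : ∀ t ∈ Icc a b, ∀ v ∈ filippov X (γ t), c < σ * v.1) :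
    σ * (γ a).1 < σ * (γ b).1 := by
  have hac : AbsolutelyContinuousOnInterval (fun t => σ * (γ t).1) a b := by
    refine AbsolutelyContinuousOnInterval.const_mul σ ?_
    have := h.1 a b
    rw [absolutelyContinuousOnInterval_iff] at this ⊢
    intro ε hε
    obtain ⟨δ, hδ, H⟩ := this ε hε
    refine ⟨δ, hδ, fun E hE hE' => lt_of_le_of_lt (Finset.sum_le_sum fun i _ => ?_) (H E hE hE')⟩
    rw [Prod.dist_eq]
    exact le_max_left _ _
  have hint := hac.integral_deriv_eq_sub
  have hmono : ∫ _ in a..b, c ≤ ∫ t in a..b, deriv (fun t => σ * (γ t).1) t := by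
    refine intervalIntegral.integral_mono_ae_restrict hab.le intervalIntegrable_const
      hac.intervalIntegrable_deriv ?_
    rw [EventuallyLE, ae_restrict_iff' measurableSet_Icc]
    filter_upwards [h.2] with t ht htI
    obtain ⟨v, hv, hd⟩ := ht
    have h1 : HasDerivAt (fun t => σ * (γ t).1) (σ * v.1) t :=
      ((ContinuousLinearMap.fst ℝ ℝ ℝ).hasFDerivAt.comp_hasDerivAt t hd).const_mul σ
    rw [h1.deriv]
    exact (hf t htI v hv).le
  rw [hint, intervalIntegral.integral_const, smul_eq_mul] at hmono
  nlinarith [mul_pos (sub_pos.2 hab) hc]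

/-- Near a crossing point a Filippov solution passes from one side of the switching line to the
other, in the direction `σ` common to the two adjacent fields. -/
theorem IsSolution.crossing {X : Zones (ℝ × ℝ → ℝ × ℝ)} (cL : Continuous X.L)
    (cC : Continuous X.C) (cR : Continuous X.R) {γ : ℝ → ℝ × ℝ} (h : IsSolution X γ)
    {t₀ σ e : ℝ} (hx : (γ t₀).1 = e) (he : e = -1 ∨ e = 1)
    (hC : 0 < σ * (X.C (γ t₀)).1)
    (hL : e = -1 → 0 < σ * (X.L (γ t₀)).1) (hR : e = 1 → 0 < σ * (X.R (γ t₀)).1) :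
    ∃ δ > 0, (∀ t ∈ Ioo t₀ (t₀ + δ), 0 < σ * ((γ t).1 - e)) ∧
      ∀ t ∈ Ioo (t₀ - δ) t₀, σ * ((γ t).1 - e) < 0 := by
  have hγ := h.continuous
  have key : ∃ c > 0, ∀ᶠ t in 𝓝 t₀, ∀ v ∈ filippov X (γ t), c < σ * v.1 := by
    have hcont : ∀ F : ℝ × ℝ → ℝ × ℝ, Continuous F → ∀ c, c < σ * (F (γ t₀)).1 →
        ∀ᶠ t in 𝓝 t₀, c < σ * (F (γ t)).1 := fun F hF c hc =>
      (show Continuous fun t => σ * (F (γ t)).1 by fun_prop).continuousAt.eventually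
        (lt_mem_nhds hc)
    have hconv : ∀ c, Convex ℝ {v : ℝ × ℝ | c < σ * v.1} := fun c =>
      convex_halfSpace_gt (f := fun v : ℝ × ℝ => σ * v.1)
        ⟨fun x y => by simp; ring, fun a x => by simp; ring⟩ c
    rcases he with he | he
    · obtain ⟨c, hc0, hc⟩ := exists_between (lt_min hC (hL he))
      rw [lt_min_iff] at hc
      refine ⟨c, hc0, ?_⟩
      have hz : ∀ᶠ t in 𝓝 t₀, (γ t).1 < 1 :=
        (show Continuous fun t => (γ t).1 by fun_prop).continuousAt.eventually
          (gt_mem_nhds (by show (γ t₀).1 < 1; rw [hx, he]; norm_num))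
      filter_upwards [hcont _ cC c hc.1, hcont _ cL c hc.2, hz] with t h1 h2 h3
      exact filippov_subset_of_convex (hconv c) (fun _ => h2) (fun _ _ => h1)
        (fun h4 => absurd h4 (not_le.2 h3))
    · obtain ⟨c, hc0, hc⟩ := exists_between (lt_min hC (hR he))
      rw [lt_min_iff] at hc
      refine ⟨c, hc0, ?_⟩
      have hz : ∀ᶠ t in 𝓝 t₀, -1 < (γ t).1 :=
        (show Continuous fun t => (γ t).1 by fun_prop).continuousAt.eventually
          (lt_mem_nhds (by show -1 < (γ t₀).1; rw [hx, he]; norm_num))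
      filter_upwards [hcont _ cC c hc.1, hcont _ cR c hc.2, hz] with t h1 h2 h3
      exact filippov_subset_of_convex (hconv c) (fun h4 => absurd h4 (not_le.2 h3))
        (fun _ _ => h1) (fun _ => h2)
  obtain ⟨c, hc, hev⟩ := key
  obtain ⟨δ, hδ, hball⟩ := Metric.eventually_nhds_iff.1 hev
  refine ⟨δ, hδ, fun t ht => ?_, fun t ht => ?_⟩
  · have := h.lt_of_forall_filippov (σ := σ) hc ht.1 fun s hs => hball (by
      rw [Real.dist_eq, abs_lt]; constructor <;> linarith [ht.1, ht.2, hs.1, hs.2])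
    rw [hx] at this; linarith
  · have := h.lt_of_forall_filippov (σ := σ) hc ht.2 fun s hs => hball (by
      rw [Real.dist_eq, abs_lt]; constructor <;> linarith [ht.1, ht.2, hs.1, hs.2])
    rw [hx] at this; linarith

/-- The first return of a curve to a closed set, when it leaves the set at once and comes back
later. -/
theorem exists_next_mem {γ : ℝ → ℝ × ℝ} (hγ : Continuous γ) {B : Set (ℝ × ℝ)} (hB : IsClosed B)
    {t₀ δ t' : ℝ} (hδ : 0 < δ) (hout : ∀ t ∈ Ioo t₀ (t₀ + δ), γ t ∉ B) (ht' : t₀ < t')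
    (hin : γ t' ∈ B) : ∃ t₁ > t₀, γ t₁ ∈ B ∧ ∀ t ∈ Ioo t₀ t₁, γ t ∉ B := by
  set S := Ici (t₀ + δ) ∩ γ ⁻¹' B
  have hS : IsClosed S := isClosed_Ici.inter (hB.preimage hγ)
  have hne : S.Nonempty := by
    refine ⟨t', ?_, hin⟩
    by_contra hlt
    exact hout t' ⟨ht', not_le.1 hlt⟩ hin
  have hbdd : BddBelow S := ⟨t₀ + δ, fun _ h => h.1⟩
  have hmem := hS.csInf_mem hne hbdd
  have h1 : t₀ + δ ≤ sInf S := hmem.1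
  refine ⟨sInf S, by linarith, hmem.2, fun t ht htB => ?_⟩
  by_cases h2 : t < t₀ + δ
  · exact hout t ⟨ht.1, h2⟩ htB
  · exact absurd (csInf_le hbdd ⟨not_lt.1 h2, htB⟩) (not_le.2 ht.2)

/-- A curve that avoids both switching lines on an interval stays in one zone. -/
theorem forall_mem_zone_of_avoids {γ : ℝ → ℝ × ℝ} (hγ : Continuous γ) {I : Set ℝ}
    (hI : IsPreconnected I) (hav : ∀ t ∈ I, (γ t).1 ≠ -1 ∧ (γ t).1 ≠ 1) :
    (∀ t ∈ I, γ t ∈ zoneL) ∨ (∀ t ∈ I, γ t ∈ zoneC) ∨ ∀ t ∈ I, γ t ∈ zoneR := by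
  have hpre : IsPreconnected ((fun t => (γ t).1) '' I) :=
    hI.image _ (by fun_prop)
  have hord := hpre.ordConnected
  rcases I.eq_empty_or_nonempty with rfl | ⟨s, hs⟩
  · left; simp
  have key : ∀ t ∈ I, ∀ e : ℝ, (e = -1 ∨ e = 1) → ¬ ((γ s).1 ≤ e ∧ e ≤ (γ t).1) ∧
      ¬ ((γ t).1 ≤ e ∧ e ≤ (γ s).1) := by
    intro t ht e he
    have : ∀ r ∈ I, (γ r).1 ≠ e := by
      intro r hr
      rcases he with rfl | rfl
      exacts [(hav r hr).1, (hav r hr).2]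
    constructor
    · intro hh
      obtain ⟨r, hr, hre⟩ := hord.out (mem_image_of_mem _ hs) (mem_image_of_mem _ ht) hh
      exact this r hr hre
    · intro hh
      obtain ⟨r, hr, hre⟩ := hord.out (mem_image_of_mem _ ht) (mem_image_of_mem _ hs) hh
      exact this r hr hre
  rcases lt_or_gt_of_ne (hav s hs).1 with h1 | h1
  · left
    intro t ht
    by_contra hc
    exact (key t ht (-1) (Or.inl rfl)).1 ⟨h1.le, not_lt.1 hc⟩
  rcases lt_or_gt_of_ne (hav s hs).2 with h2 | h2
  · right; left
    intro t ht
    refine ⟨?_, ?_⟩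
    · by_contra hc
      exact (key t ht (-1) (Or.inl rfl)).2 ⟨not_lt.1 hc, h1.le⟩
    · by_contra hc
      exact (key t ht 1 (Or.inr rfl)).1 ⟨h2.le, not_lt.1 hc⟩
  · right; right
    intro t ht
    by_contra hc
    exact (key t ht 1 (Or.inr rfl)).2 ⟨not_lt.1 hc, h2.le⟩

/-! ### The perturbed fields and their flows -/

/-- Parameters of the perturbation: expansion rates `kL`, `kC` about the left and the central
center, a change `2 kR` of the unstable eigenvalue of the saddle, and a displacement `b` of the
saddle along its stable direction. -/
structure Params where
  kL : ℝ
  kC : ℝ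
  kR : ℝ
  b : ℝ

/-- The perturbation coefficients belonging to the parameters. In the left and central zones the
perturbing field is radial about the center. In the right zone, with `P = 2 - x - y` and
`Q = 2 - x + y`, it changes the equations `P' = P`, `Q' = -Q` into `P' = (1 + 2 ε kR) P` and
`Q' = -Q + ε b`. -/
noncomputable def Params.pert (p : Params) : Zones PertCoeff where
  L := { p := p.kL, q := 0, r := -3 * p.kL, s := 0, u := p.kL, v := 2 * p.kL }
  C := { p := p.kC, q := 0, r := 0, s := 0, u := p.kC, v := 0 }
  R := { p := p.kR, q := p.kR, r := -2 * p.kR - p.b / 2,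
         s := p.kR, u := p.kR, v := -2 * p.kR + p.b / 2 }

/-- The perturbed system. -/
noncomputable def Params.X (p : Params) (ε : ℝ) : Zones (ℝ × ℝ → ℝ × ℝ) :=
  perturbedFields ccsSystem p.pert ε

theorem Params.X_L (p : Params) (ε : ℝ) (z : ℝ × ℝ) : (p.X ε).L z =
    (z.1 + 2 * z.2 + 1 + ε * p.kL * (z.1 - 3), -z.1 - z.2 + 1 + ε * p.kL * (z.2 + 2)) := by
  simp only [Params.X, perturbedFields, ccsSystem, normalForm, HamCoeff.field, PertCoeff.field,
    Params.pert, Prod.smul_mk, Prod.mk_add_mk, smul_eq_mul]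
  ext <;> simp only <;> ring

theorem Params.X_C (p : Params) (ε : ℝ) (z : ℝ × ℝ) : (p.X ε).C z =
    (z.2 + ε * p.kC * z.1, -z.1 + ε * p.kC * z.2) := by
  simp only [Params.X, perturbedFields, ccsSystem, normalForm, HamCoeff.field, PertCoeff.field,
    Params.pert, Prod.smul_mk, Prod.mk_add_mk, smul_eq_mul]
  ext <;> simp only <;> ring

theorem Params.X_R (p : Params) (ε : ℝ) (z : ℝ × ℝ) : (p.X ε).R z =
    (z.2 + ε * p.kR * (z.1 + z.2 - 2) - ε * p.b / 2,
      z.1 - 2 + ε * p.kR * (z.1 + z.2 - 2) + ε * p.b / 2) := by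
  simp only [Params.X, perturbedFields, ccsSystem, normalForm, HamCoeff.field, PertCoeff.field,
    Params.pert, Prod.smul_mk, Prod.mk_add_mk, smul_eq_mul]
  ext <;> simp only <;> ring

theorem Params.X_zero (p : Params) : p.X 0 = unperturbedFields ccsSystem := by
  simp [Params.X, perturbedFields, unperturbedFields]

theorem exists_lipschitzWith_affine {F : ℝ × ℝ → ℝ × ℝ} {a b c d e f : ℝ}
    (hF : ∀ z, F z = (a * z.1 + b * z.2 + e, c * z.1 + d * z.2 + f)) :
    ∃ K, LipschitzWith K F := by
  let A : ℝ × ℝ →L[ℝ] ℝ × ℝ :=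
    (a • ContinuousLinearMap.fst ℝ ℝ ℝ + b • ContinuousLinearMap.snd ℝ ℝ ℝ).prod
      (c • ContinuousLinearMap.fst ℝ ℝ ℝ + d • ContinuousLinearMap.snd ℝ ℝ ℝ)
  have hA : F = fun z => A z + (e, f) := by
    funext z
    simp [hF, A]
  refine ⟨‖A‖₊, ?_⟩
  rw [hA]
  exact LipschitzWith.of_dist_le_mul fun x y => by
    rw [dist_add_right]; exact A.lipschitz.dist_le_mul x y

theorem Params.exists_lipschitzWith (p : Params) (ε : ℝ) :
    ∃ K, LipschitzWith K (p.X ε).L ∧ LipschitzWith K (p.X ε).C ∧ LipschitzWith K (p.X ε).R := by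
  obtain ⟨K₁, h₁⟩ := exists_lipschitzWith_affine (F := (p.X ε).L)
    (a := 1 + ε * p.kL) (b := 2) (e := 1 - 3 * ε * p.kL) (c := -1) (d := -1 + ε * p.kL)
    (f := 1 + 2 * ε * p.kL) (fun z => by rw [p.X_L]; ext <;> simp only <;> ring)
  obtain ⟨K₂, h₂⟩ := exists_lipschitzWith_affine (F := (p.X ε).C)
    (a := ε * p.kC) (b := 1) (e := 0) (c := -1) (d := ε * p.kC)
    (f := 0) (fun z => by rw [p.X_C]; ext <;> simp only <;> ring)
  obtain ⟨K₃, h₃⟩ := exists_lipschitzWith_affine (F := (p.X ε).R)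
    (a := ε * p.kR) (b := 1 + ε * p.kR) (e := -2 * ε * p.kR - ε * p.b / 2) (c := 1 + ε * p.kR)
    (d := ε * p.kR) (f := -2 - 2 * ε * p.kR + ε * p.b / 2)
    (fun z => by rw [p.X_R]; ext <;> simp only <;> ring)
  refine ⟨max K₁ (max K₂ K₃), h₁.weaken (le_max_left _ _),
    h₂.weaken ((le_max_left _ _).trans (le_max_right _ _)),
    h₃.weaken ((le_max_right _ _).trans (le_max_right _ _))⟩

theorem Params.continuous_L (p : Params) (ε : ℝ) : Continuous (p.X ε).L :=
  (p.exists_lipschitzWith ε).choose_spec.1.continuous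

theorem Params.continuous_C (p : Params) (ε : ℝ) : Continuous (p.X ε).C :=
  (p.exists_lipschitzWith ε).choose_spec.2.1.continuous

theorem Params.continuous_R (p : Params) (ε : ℝ) : Continuous (p.X ε).R :=
  (p.exists_lipschitzWith ε).choose_spec.2.2.continuous

/-- The flow of the left field. In the coordinates `X = (3 - x) / 2`, `Y = y + (x + 1) / 2` it is
a rotation times `exp (ε kL t)`. -/
noncomputable def Params.flowL (p : Params) (ε : ℝ) (z : ℝ × ℝ) (t : ℝ) : ℝ × ℝ :=
  (3 - 2 * (Real.exp (ε * p.kL * t) *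
      ((3 - z.1) / 2 * Real.cos t - (z.2 + (z.1 + 1) / 2) * Real.sin t)),
    Real.exp (ε * p.kL * t) *
      ((z.2 + (z.1 + 1) / 2) * Real.cos t + (3 - z.1) / 2 * Real.sin t) - 2 +
    Real.exp (ε * p.kL * t) *
      ((3 - z.1) / 2 * Real.cos t - (z.2 + (z.1 + 1) / 2) * Real.sin t))

/-- The flow of the central field, a rotation times `exp (ε kC t)`. -/
noncomputable def Params.flowC (p : Params) (ε : ℝ) (z : ℝ × ℝ) (t : ℝ) : ℝ × ℝ :=
  (Real.exp (ε * p.kC * t) * (z.1 * Real.cos t + z.2 * Real.sin t),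
    Real.exp (ε * p.kC * t) * (z.2 * Real.cos t - z.1 * Real.sin t))

/-- The flow of the right field, diagonal in the coordinates `P = 2 - x - y`, `Q = 2 - x + y`. -/
noncomputable def Params.flowR (p : Params) (ε : ℝ) (z : ℝ × ℝ) (t : ℝ) : ℝ × ℝ :=
  (2 - ((2 - z.1 - z.2) * Real.exp ((1 + 2 * ε * p.kR) * t) +
      (ε * p.b + (2 - z.1 + z.2 - ε * p.b) * Real.exp (-t))) / 2,
    ((ε * p.b + (2 - z.1 + z.2 - ε * p.b) * Real.exp (-t)) -
      (2 - z.1 - z.2) * Real.exp ((1 + 2 * ε * p.kR) * t)) / 2)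

theorem hasDerivAt_exp_mul (k t : ℝ) :
    HasDerivAt (fun t => Real.exp (k * t)) (k * Real.exp (k * t)) t := by
  have := ((hasDerivAt_id t).const_mul k).exp
  simpa [mul_comm] using this

theorem hasDerivAt_exp_mul_rotation (k a b t : ℝ) :
    HasDerivAt (fun t => Real.exp (k * t) * (a * Real.cos t + b * Real.sin t))
      (k * (Real.exp (k * t) * (a * Real.cos t + b * Real.sin t)) +
        Real.exp (k * t) * (b * Real.cos t - a * Real.sin t)) t := by
  have := (hasDerivAt_exp_mul k t).mul
    (((Real.hasDerivAt_cos t).const_mul a).add ((Real.hasDerivAt_sin t).const_mul b))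
  refine this.congr_deriv ?_
  simp only [Pi.add_apply]
  ring

theorem Params.hasDerivAt_flowL (p : Params) (ε : ℝ) (z : ℝ × ℝ) (t : ℝ) :
    HasDerivAt (p.flowL ε z) ((p.X ε).L (p.flowL ε z t)) t := by
  have h₁ := hasDerivAt_exp_mul_rotation (ε * p.kL) ((3 - z.1) / 2) (-(z.2 + (z.1 + 1) / 2)) t
  have h₂ := hasDerivAt_exp_mul_rotation (ε * p.kL) (z.2 + (z.1 + 1) / 2) ((3 - z.1) / 2) t
  have h := ((h₁.const_mul 2).const_sub 3).prodMk ((h₂.sub_const 2).add h₁)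
  refine (h.congr_deriv ?_).congr_of_eventuallyEq (Eventually.of_forall fun s => ?_)
  · rw [p.X_L]
    ext
    · simp only [Params.flowL]; ring
    · simp only [Params.flowL]; ring
  · ext
    · simp only [Params.flowL]; ring
    · simp only [Params.flowL, Pi.add_apply]; ring

theorem Params.hasDerivAt_flowC (p : Params) (ε : ℝ) (z : ℝ × ℝ) (t : ℝ) :
    HasDerivAt (p.flowC ε z) ((p.X ε).C (p.flowC ε z t)) t := by
  have h₁ := hasDerivAt_exp_mul_rotation (ε * p.kC) z.1 z.2 t
  have h₂ := hasDerivAt_exp_mul_rotation (ε * p.kC) z.2 (-z.1) t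
  refine ((h₁.prodMk h₂).congr_deriv ?_).congr_of_eventuallyEq (Eventually.of_forall fun s => ?_)
  · rw [p.X_C]
    ext
    · simp only [Params.flowC]; ring
    · simp only [Params.flowC]; ring
  · ext
    · rfl
    · simp only [Params.flowC]; ring

theorem Params.hasDerivAt_flowR (p : Params) (ε : ℝ) (z : ℝ × ℝ) (t : ℝ) :
    HasDerivAt (p.flowR ε z) ((p.X ε).R (p.flowR ε z t)) t := by
  have h₁ := (hasDerivAt_exp_mul (1 + 2 * ε * p.kR) t).const_mul (2 - z.1 - z.2)
  have h₂ := ((hasDerivAt_exp_mul (-1) t).const_mul (2 - z.1 + z.2 - ε * p.b)).const_add (ε * p.b)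
  have h := (((h₁.add h₂).div_const 2).const_sub 2).prodMk ((h₂.sub h₁).div_const 2)
  refine (h.congr_deriv ?_).congr_of_eventuallyEq (Eventually.of_forall fun s => ?_)
  · rw [p.X_R]
    ext <;> simp only [Params.flowR, neg_mul, one_mul] <;> ring
  · ext <;> simp only [Params.flowR, Pi.add_apply, Pi.sub_apply, neg_mul, one_mul]

@[simp] theorem Params.flowL_zero (p : Params) (ε : ℝ) (z : ℝ × ℝ) : p.flowL ε z 0 = z := by
  ext
  · simp [Params.flowL]; ring
  · simp [Params.flowL]; ring

@[simp] theorem Params.flowC_zero (p : Params) (ε : ℝ) (z : ℝ × ℝ) : p.flowC ε z 0 = z := by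
  ext <;> simp [Params.flowC]

@[simp] theorem Params.flowR_zero (p : Params) (ε : ℝ) (z : ℝ × ℝ) : p.flowR ε z 0 = z := by
  ext
  · simp [Params.flowR]
  · simp [Params.flowR]

/-- A Filippov solution follows the flow of a zone as long as it stays there. -/
theorem IsSolution.eqOn_flow {X : Zones (ℝ × ℝ → ℝ × ℝ)} {γ : ℝ → ℝ × ℝ} (h : IsSolution X γ)
    {Z : Set (ℝ × ℝ)} {F : ℝ × ℝ → ℝ × ℝ} {K : NNReal} (hF : LipschitzWith K F)
    (hZ : ∀ z ∈ Z, filippov X z = {F z}) {a b : ℝ} (hin : ∀ t ∈ Ioo a b, γ t ∈ Z)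
    {φ : ℝ → ℝ × ℝ} (hφ : ∀ t, HasDerivAt φ (F (φ t)) t) (h0 : γ a = φ 0) :
    ∀ t ∈ Icc 0 (b - a), γ (a + t) = φ t := by
  have key := eqOn_of_ae_hasDerivAt (φ := fun t => φ (t - a)) (a := a) (b := b) h.1 h.continuous hF
    (by
      filter_upwards [h.2] with t ht htI
      obtain ⟨v, hv, hd⟩ := ht
      rw [hZ _ (hin t htI), mem_singleton_iff] at hv
      rwa [← hv])
    (fun t => (hφ (t - a)).comp_sub_const t a) (by simpa using h0)
  intro t ht
  have := key (x := a + t) ⟨by linarith [ht.1], by linarith [ht.2]⟩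
  simpa using this

/-! ### Passages between the switching lines -/

/-- Time of the passage through the right zone from `(1, y)` to `(1, -y')`. -/
noncomputable def Params.timeR (p : Params) (ε y y' : ℝ) : ℝ :=
  Real.log (1 + y - ε * p.b) - Real.log (1 - y' - ε * p.b)

/-- Time of the passage through the central zone from `±(1, -y)` to `±(-1, -y')`. -/
noncomputable def timeC (y y' : ℝ) : ℝ := Real.pi - Real.arctan y - Real.arctan y'

/-- Time of the passage through the left zone from `(-1, -y)` to `(-1, y')`. -/
noncomputable def timeL (y y' : ℝ) : ℝ := Real.arctan (y / 2) + Real.arctan (y' / 2)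

/-- The half-return relation of the right zone: the orbit of `(1, y)` reaches `(1, -y')`. -/
def Params.RelR (p : Params) (ε y y' : ℝ) : Prop :=
  (1 + y') * (1 - y' - ε * p.b) =
    (1 - y) * (1 + y - ε * p.b) * Real.exp (2 * (ε * p.kR) * p.timeR ε y y')

/-- The half-return relation of the central zone: the orbit of `±(1, -y)` reaches
`±(-1, -y')`. -/
def Params.RelC (p : Params) (ε y y' : ℝ) : Prop :=
  1 + y' ^ 2 = (1 + y ^ 2) * Real.exp (2 * (ε * p.kC) * timeC y y')

/-- The half-return relation of the left zone: the orbit of `(-1, -y)` reaches `(-1, y')`. -/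
def Params.RelL (p : Params) (ε y y' : ℝ) : Prop :=
  4 + y' ^ 2 = (4 + y ^ 2) * Real.exp (2 * (ε * p.kL) * timeL y y')

theorem exp_mul_le_affine {s : ℝ} (h0 : 0 ≤ s) (h1 : s ≤ 1) (x : ℝ) :
    Real.exp (s * x) ≤ 1 - s + s * Real.exp x := by
  have := convexOn_exp.2 (mem_univ x) (mem_univ 0) h0 (sub_nonneg.2 h1) (by ring)
  simp only [smul_eq_mul, mul_zero, add_zero, Real.exp_zero, mul_one] at this
  linarith

theorem exp_mul_lt_affine {s x : ℝ} (h0 : 0 < s) (h1 : s < 1) (hx : x ≠ 0) :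
    Real.exp (s * x) < 1 - s + s * Real.exp x := by
  have := strictConvexOn_exp.2 (mem_univ x) (mem_univ 0) hx h0 (sub_pos.2 h1) (by ring)
  simp only [smul_eq_mul, mul_zero, add_zero, Real.exp_zero, mul_one] at this
  linarith

/-- The passage through the right zone. The orbit stays in the zone because `2 - x` is a convex
combination of exponentials, equal to `1` at both ends. -/
theorem Params.flowR_passage (p : Params) {ε y y' : ℝ} (hy : y < 1) (hyy : 0 < y + y')
    (h₂ : 0 < 1 - y' - ε * p.b) (hrel : p.RelR ε y y') :
    0 < p.timeR ε y y' ∧ p.flowR ε (1, y) (p.timeR ε y y') = (1, -y') ∧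
      ∀ t ∈ Ioo 0 (p.timeR ε y y'), p.flowR ε (1, y) t ∈ zoneR := by
  have h₁ : 0 < 1 + y - ε * p.b := by linarith
  unfold Params.RelR at hrel
  have hT : 0 < p.timeR ε y y' := sub_pos.2 (Real.log_lt_log h₂ (by linarith))
  have hneg : Real.exp (-p.timeR ε y y') = (1 - y' - ε * p.b) / (1 + y - ε * p.b) := by
    rw [Params.timeR, neg_sub, Real.exp_sub, Real.exp_log h₁, Real.exp_log h₂]
  have hpos : Real.exp (p.timeR ε y y') = (1 + y - ε * p.b) / (1 - y' - ε * p.b) := by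
    rw [Params.timeR, Real.exp_sub, Real.exp_log h₁, Real.exp_log h₂]
  set T := p.timeR ε y y'
  have hQ : (1 + y - ε * p.b) * Real.exp (-T) = 1 - y' - ε * p.b := by
    rw [hneg]; field_simp
  have hP : (1 - y) * Real.exp ((1 + 2 * ε * p.kR) * T) = 1 + y' := by
    have : (1 + 2 * ε * p.kR) * T = T + 2 * (ε * p.kR) * T := by ring
    rw [this, Real.exp_add, hpos]
    set w := Real.exp (2 * (ε * p.kR) * T)
    field_simp
    linarith
  refine ⟨hT, ?_, fun t ht => ?_⟩
  · ext
    · simp only [Params.flowR]; linarith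
    · simp only [Params.flowR]; linarith
  · have hs0 : 0 < t / T := div_pos ht.1 hT
    have hs1 : t / T < 1 := (div_lt_one hT).2 ht.2
    have e₁ := exp_mul_le_affine hs0.le hs1.le ((1 + 2 * ε * p.kR) * T)
    have e₂ := exp_mul_lt_affine hs0 hs1 (neg_ne_zero.2 hT.ne')
    have r₁ : t / T * ((1 + 2 * ε * p.kR) * T) = (1 + 2 * ε * p.kR) * t := by field_simp
    have r₂ : t / T * -T = -t := by field_simp
    rw [r₁] at e₁
    rw [r₂] at e₂
    set s := t / T
    have f₁ := mul_le_mul_of_nonneg_left e₁ (sub_pos.2 hy).le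
    have f₂ := mul_lt_mul_of_pos_left e₂ h₁
    have g₁ : (1 - y) * (1 - s + s * Real.exp ((1 + 2 * ε * p.kR) * T)) =
        (1 - y) * (1 - s) + s * (1 + y') := by rw [← hP]; ring
    have g₂ : (1 + y - ε * p.b) * (1 - s + s * Real.exp (-T)) =
        (1 + y - ε * p.b) * (1 - s) + s * (1 - y' - ε * p.b) := by rw [← hQ]; ring
    show 1 < (p.flowR ε (1, y) t).1
    simp only [Params.flowR]
    have a₁ : (2 : ℝ) - 1 - y = 1 - y := by ring
    have a₂ : (2 : ℝ) - 1 + y = 1 + y := by ring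
    rw [a₁, a₂]
    nlinarith

/-- An orbit that returns to the line `x = 1` satisfies the half-return relation; `Q = 2 - x + y`
determines the time. -/
theorem Params.relR_of_flowR (p : Params) {ε y y' T : ℝ} (h₁ : 0 < 1 + y - ε * p.b)
    (hend : p.flowR ε (1, y) T = (1, -y')) : T = p.timeR ε y y' ∧ p.RelR ε y y' := by
  have hx := congrArg Prod.fst hend
  have hy := congrArg Prod.snd hend
  simp only [Params.flowR] at hx hy
  have hQ : (1 + y - ε * p.b) * Real.exp (-T) = 1 - y' - ε * p.b := by linarith
  have hP : (1 - y) * Real.exp ((1 + 2 * ε * p.kR) * T) = 1 + y' := by linarith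
  have h₂ : 0 < 1 - y' - ε * p.b := hQ ▸ mul_pos h₁ (Real.exp_pos _)
  have hT : T = p.timeR ε y y' := by
    rw [Params.timeR, ← hQ, Real.log_mul h₁.ne' (Real.exp_pos _).ne', Real.log_exp]; ring
  refine ⟨hT, ?_⟩
  unfold Params.RelR
  rw [← hT, ← hP, ← hQ]
  have : Real.exp ((1 + 2 * ε * p.kR) * T) * Real.exp (-T) = Real.exp (2 * (ε * p.kR) * T) := by
    rw [← Real.exp_add]; congr 1; ring
  rw [← this]; ring

theorem sin_arctan_eq (y : ℝ) : Real.sin (Real.arctan y) = y * Real.cos (Real.arctan y) := by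
  rw [Real.sin_arctan, Real.cos_arctan]; ring

theorem timeC_mem {y y' : ℝ} (hy : 0 < y) (hy' : 0 < y') :
    0 < timeC y y' ∧ timeC y y' < Real.pi := by
  have h₁ := Real.arctan_lt_pi_div_two y
  have h₂ := Real.arctan_lt_pi_div_two y'
  have h₃ := Real.arctan_pos.2 hy
  have h₄ := Real.arctan_pos.2 hy'
  unfold timeC
  constructor <;> linarith

/-- The passage through the central zone, from right to left below the center for `σ = 1` and
from left to right above it for `σ = -1`. The coordinate `x` is monotone along it. -/
theorem Params.flowC_passage (p : Params) {ε y y' σ : ℝ} (hσ : σ = 1 ∨ σ = -1) (hy : 0 < y)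
    (hy' : 0 < y') (hk : 0 ≤ ε * p.kC) (hky : ε * p.kC < y) (hrel : p.RelC ε y y') :
    p.flowC ε (σ, -σ * y) (timeC y y') = (-σ, -σ * y') ∧
      ∀ t ∈ Ioo 0 (timeC y y'), p.flowC ε (σ, -σ * y) t ∈ zoneC := by
  unfold Params.RelC at hrel
  obtain ⟨hT, hTpi⟩ := timeC_mem hy hy'
  have hTdef : timeC y y' + Real.arctan y = Real.pi - Real.arctan y' := by unfold timeC; ring
  set T := timeC y y'
  set κ := ε * p.kC
  have hc := Real.cos_arctan_pos y
  have hc' := Real.cos_arctan_pos y'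
  have hsq := Real.cos_sq_arctan y
  have hsq' := Real.cos_sq_arctan y'
  have hsin := sin_arctan_eq y
  have hsin' := sin_arctan_eq y'
  have hα := Real.arctan_pos.2 hy
  have hα' := Real.arctan_pos.2 hy'
  set α := Real.arctan y
  set α' := Real.arctan y'
  set c := Real.cos α
  set c' := Real.cos α'
  have hE : Real.exp (κ * T) * c' = c := by
    have h2 : Real.exp (2 * κ * T) = Real.exp (κ * T) ^ 2 := by
      rw [← Real.exp_nat_mul]; congr 1; push_cast; ring
    rw [h2] at hrel
    have : (Real.exp (κ * T) * c') ^ 2 = c ^ 2 := by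
      rw [mul_pow, hsq, hsq', hrel]
      field_simp
    exact (pow_left_inj₀ (by positivity) hc.le two_ne_zero).1 this
  have hcos : ∀ t, c * (Real.cos t - y * Real.sin t) = Real.cos (t + α) := fun t => by
    rw [Real.cos_add, hsin]; ring
  have hsn : ∀ t, c * (y * Real.cos t + Real.sin t) = Real.sin (t + α) := fun t => by
    rw [Real.sin_add, hsin]; ring
  have hend₁ : Real.exp (κ * T) * (Real.cos T - y * Real.sin T) = -1 := by
    have h1 := hcos T
    rw [hTdef, Real.cos_pi_sub] at h1
    refine mul_left_cancel₀ hc.ne' ?_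
    calc c * (Real.exp (κ * T) * (Real.cos T - y * Real.sin T))
        = Real.exp (κ * T) * (c * (Real.cos T - y * Real.sin T)) := by ring
      _ = -(Real.exp (κ * T) * c') := by rw [h1]; ring
      _ = c * -1 := by rw [hE]; ring
  have hend₂ : Real.exp (κ * T) * (y * Real.cos T + Real.sin T) = y' := by
    have h1 := hsn T
    rw [hTdef, Real.sin_pi_sub, hsin'] at h1
    refine mul_left_cancel₀ hc.ne' ?_
    calc c * (Real.exp (κ * T) * (y * Real.cos T + Real.sin T))
        = Real.exp (κ * T) * (c * (y * Real.cos T + Real.sin T)) := by ring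
      _ = (Real.exp (κ * T) * c') * y' := by rw [h1]; ring
      _ = c * y' := by rw [hE]
  refine ⟨?_, fun t ht => ?_⟩
  · ext
    · simp only [Params.flowC]
      linear_combination σ * hend₁
    · simp only [Params.flowC]
      linear_combination -σ * hend₂
  · set f : ℝ → ℝ := fun t => Real.exp (κ * t) * (1 * Real.cos t + (-y) * Real.sin t)
    have hf : ∀ t, HasDerivAt f _ t := hasDerivAt_exp_mul_rotation κ 1 (-y)
    have hanti : StrictAntiOn f (Icc 0 T) := by
      refine strictAntiOn_of_deriv_neg (convex_Icc _ _)
        (fun t _ => (hf t).continuousAt.continuousWithinAt) fun s hs => ?_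
      rw [interior_Icc] at hs
      rw [(hf s).deriv]
      -- The angle `arctan κ` measures by how much the expansion tilts the velocity.
      have hφ : Real.arctan κ < α := Real.arctan_lt_arctan_iff.2 hky
      have hφ0 : 0 ≤ Real.arctan κ := Real.arctan_nonneg.2 hk
      have hpos : 0 < Real.sin (s + α - Real.arctan κ) :=
        Real.sin_pos_of_pos_of_lt_pi (by linarith [hs.1]) (by linarith [hs.2])
      rw [Real.sin_sub, sin_arctan_eq κ, ← hcos, ← hsn] at hpos
      have hcc : 0 < Real.cos (Real.arctan κ) * c := mul_pos (Real.cos_arctan_pos κ) hc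
      have : 0 < Real.cos (Real.arctan κ) * c *
          ((y * Real.cos s + Real.sin s) - κ * (Real.cos s - y * Real.sin s)) := by
        convert hpos using 1; ring
      have := (mul_pos_iff_of_pos_left hcc).1 this
      have := mul_pos (Real.exp_pos (κ * s)) this
      linarith
    have h0 : f 0 = 1 := by simp [f]
    have h1 : f T = -1 := by simp only [f]; linarith
    have hlt := hanti ⟨le_rfl, hT.le⟩ ⟨ht.1.le, ht.2.le⟩ ht.1
    have hgt := hanti ⟨ht.1.le, ht.2.le⟩ ⟨hT.le, le_rfl⟩ ht.2
    rw [h0] at hlt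
    rw [h1] at hgt
    have hx : (p.flowC ε (σ, -σ * y) t).1 = σ * f t := by
      simp only [Params.flowC, f]; ring
    show -1 < (p.flowC ε (σ, -σ * y) t).1 ∧ (p.flowC ε (σ, -σ * y) t).1 < 1
    rw [hx]
    rcases hσ with rfl | rfl <;> constructor <;> linarith

/-- After half a rotation the orbit is beyond the opposite switching line. -/
theorem Params.le_pi_of_flowC_mem (p : Params) {ε y σ T : ℝ} (hσ : σ = 1 ∨ σ = -1)
    (hk : 0 ≤ ε * p.kC) (hin : ∀ t ∈ Ioo 0 T, p.flowC ε (σ, -σ * y) t ∈ zoneC) :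
    T ≤ Real.pi := by
  by_contra hlt
  have h : -1 < (p.flowC ε (σ, -σ * y) Real.pi).1 ∧ (p.flowC ε (σ, -σ * y) Real.pi).1 < 1 :=
    hin Real.pi ⟨Real.pi_pos, not_le.1 hlt⟩
  have h1 : 1 ≤ Real.exp (ε * p.kC * Real.pi) := Real.one_le_exp (mul_nonneg hk Real.pi_pos.le)
  simp only [Params.flowC, Real.cos_pi, Real.sin_pi] at h
  rcases hσ with rfl | rfl
  · linarith [h.1]
  · linarith [h.2]

/-- An orbit that crosses the central zone satisfies the half-return relation. The time is
determined by the angle because it is at most `π`. -/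
theorem Params.relC_of_flowC (p : Params) {ε y y' σ T : ℝ} (hσ : σ = 1 ∨ σ = -1)
    (hy : 0 < y) (hy' : 0 < y') (hk : 0 ≤ ε * p.kC) (hT : 0 < T)
    (hin : ∀ t ∈ Ioo 0 T, p.flowC ε (σ, -σ * y) t ∈ zoneC)
    (hend : p.flowC ε (σ, -σ * y) T = (-σ, -σ * y')) : T = timeC y y' ∧ p.RelC ε y y' := by
  have hTpi := p.le_pi_of_flowC_mem hσ hk hin
  have hx := congrArg Prod.fst hend
  have hz := congrArg Prod.snd hend
  simp only [Params.flowC] at hx hz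
  have hE := Real.exp_pos (ε * p.kC * T)
  have h2 : Real.exp (2 * (ε * p.kC) * T) = Real.exp (ε * p.kC * T) ^ 2 := by
    rw [← Real.exp_nat_mul]; congr 1; push_cast; ring
  set E := Real.exp (ε * p.kC * T)
  have hσ2 : σ * σ = 1 := by rcases hσ with rfl | rfl <;> norm_num
  have hend₁ : E * (Real.cos T - y * Real.sin T) = -1 := by
    linear_combination σ * hx + (-E * Real.cos T + E * y * Real.sin T - 1) * hσ2
  have hend₂ : E * (y * Real.cos T + Real.sin T) = y' := by
    linear_combination -σ * hz + (-E * y * Real.cos T - E * Real.sin T + y') * hσ2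
  have hT' : T = timeC y y' := by
    have h₁ := Real.arctan_lt_pi_div_two y
    have h₂ := Real.arctan_lt_pi_div_two y'
    have h₃ := Real.arctan_pos.2 hy
    have h₄ := Real.arctan_pos.2 hy'
    have hsin : Real.sin (T + Real.arctan y + Real.arctan y' - Real.pi) = 0 := by
      rw [Real.sin_sub_pi, Real.sin_add, Real.sin_add T, Real.cos_add T, sin_arctan_eq y,
        sin_arctan_eq y', neg_eq_zero]
      refine (mul_eq_zero_iff_left hE.ne').1 ?_
      linear_combination (Real.cos (Real.arctan y) * Real.cos (Real.arctan y')) * hend₂ +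
        (y' * Real.cos (Real.arctan y) * Real.cos (Real.arctan y')) * hend₁
    have := (Real.sin_eq_zero_iff_of_lt_of_lt (by linarith) (by linarith)).1 hsin
    unfold timeC; linarith
  refine ⟨hT', ?_⟩
  unfold Params.RelC
  rw [← hT', h2]
  have hcs := Real.sin_sq_add_cos_sq T
  linear_combination (-(E * (Real.cos T - y * Real.sin T)) + 1) * hend₁ -
    (E * (y * Real.cos T + Real.sin T) + y') * hend₂ + E ^ 2 * (1 + y ^ 2) * hcs

/-- An orbit that enters the central zone on one switching line does not leave it through the
outgoing part of the same line. -/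
theorem Params.flowC_ne_same_side (p : Params) {ε y w σ T : ℝ} (hσ : σ = 1 ∨ σ = -1)
    (hy : 0 < y) (hw : 0 < w) (hk : 0 ≤ ε * p.kC) (hT : 0 < T)
    (hin : ∀ t ∈ Ioo 0 T, p.flowC ε (σ, -σ * y) t ∈ zoneC) :
    p.flowC ε (σ, -σ * y) T ≠ (σ, σ * w) := by
  intro hend
  have hTpi := p.le_pi_of_flowC_mem hσ hk hin
  have hx := congrArg Prod.fst hend
  have hz := congrArg Prod.snd hend
  simp only [Params.flowC] at hx hz
  have hE := Real.exp_pos (ε * p.kC * T)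
  set E := Real.exp (ε * p.kC * T)
  have hσ2 : σ * σ = 1 := by rcases hσ with rfl | rfl <;> norm_num
  have hend₁ : E * (Real.cos T - y * Real.sin T) = 1 := by
    linear_combination σ * hx + (-E * Real.cos T + E * y * Real.sin T + 1) * hσ2
  have hend₂ : E * (y * Real.cos T + Real.sin T) = -w := by
    linear_combination -σ * hz + (-E * y * Real.cos T - E * Real.sin T - w) * hσ2
  have hs : 0 ≤ Real.sin T := Real.sin_nonneg_of_nonneg_of_le_pi hT.le hTpi
  have h1 : 0 < Real.cos T - y * Real.sin T :=
    (mul_pos_iff_of_pos_left hE).1 (by rw [hend₁]; norm_num)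
  have h2 : 0 < Real.cos T := by nlinarith [mul_nonneg hy.le hs]
  have : 0 < E * (y * Real.cos T + Real.sin T) := by positivity
  linarith

/-- The passage through the left zone. In the rotating coordinates the orbit stays beyond the
switching line because the cosine is concave and the exponential convex. -/
theorem Params.flowL_passage (p : Params) {ε y y' : ℝ} (hy : 0 < y) (hy' : 0 < y')
    (hrel : p.RelL ε y y') :
    p.flowL ε (-1, -y) (timeL y y') = (-1, y') ∧
      ∀ t ∈ Ioo 0 (timeL y y'), p.flowL ε (-1, -y) t ∈ zoneL := by
  unfold Params.RelL at hrel
  have hα := Real.arctan_pos.2 (half_pos hy)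
  have hα' := Real.arctan_pos.2 (half_pos hy')
  have hαpi := Real.arctan_lt_pi_div_two (y / 2)
  have hαpi' := Real.arctan_lt_pi_div_two (y' / 2)
  have hTdef : timeL y y' - Real.arctan (y / 2) = Real.arctan (y' / 2) := by unfold timeL; ring
  set T := timeL y y'
  set κ := ε * p.kL
  have hc := Real.cos_arctan_pos (y / 2)
  have hc' := Real.cos_arctan_pos (y' / 2)
  have hsq := Real.cos_sq_arctan (y / 2)
  have hsq' := Real.cos_sq_arctan (y' / 2)
  have hsin := sin_arctan_eq (y / 2)
  have hsin' := sin_arctan_eq (y' / 2)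
  set α := Real.arctan (y / 2)
  set α' := Real.arctan (y' / 2)
  set c := Real.cos α
  set c' := Real.cos α'
  have hT : 0 < T := by linarith
  have hE : Real.exp (κ * T) * c' = c := by
    have h2 : Real.exp (2 * κ * T) = Real.exp (κ * T) ^ 2 := by
      rw [← Real.exp_nat_mul]; congr 1; push_cast; ring
    rw [h2] at hrel
    have : (Real.exp (κ * T) * c') ^ 2 = c ^ 2 := by
      have e₁ : 1 + (y' / 2) ^ 2 = (1 + (y / 2) ^ 2) * Real.exp (κ * T) ^ 2 := by
        linear_combination hrel / 4
      rw [mul_pow, hsq, hsq', e₁]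
      field_simp
    exact (pow_left_inj₀ (by positivity) hc.le two_ne_zero).1 this
  have hcos : ∀ t, c * (2 * Real.cos t + y * Real.sin t) = 2 * Real.cos (t - α) := fun t => by
    rw [Real.cos_sub, hsin]; ring
  have hsn : ∀ t, c * (2 * Real.sin t - y * Real.cos t) = 2 * Real.sin (t - α) := fun t => by
    rw [Real.sin_sub, hsin]; ring
  have hend₁ : Real.exp (κ * T) * (2 * Real.cos T + y * Real.sin T) = 2 := by
    have h1 := hcos T
    rw [hTdef] at h1
    refine mul_left_cancel₀ hc.ne' ?_
    calc c * (Real.exp (κ * T) * (2 * Real.cos T + y * Real.sin T))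
        = Real.exp (κ * T) * (c * (2 * Real.cos T + y * Real.sin T)) := by ring
      _ = 2 * (Real.exp (κ * T) * c') := by rw [h1]; ring
      _ = c * 2 := by rw [hE]; ring
  have hend₂ : Real.exp (κ * T) * (2 * Real.sin T - y * Real.cos T) = y' := by
    have h1 := hsn T
    rw [hTdef, hsin'] at h1
    refine mul_left_cancel₀ hc.ne' ?_
    calc c * (Real.exp (κ * T) * (2 * Real.sin T - y * Real.cos T))
        = Real.exp (κ * T) * (c * (2 * Real.sin T - y * Real.cos T)) := by ring
      _ = (Real.exp (κ * T) * c') * y' := by rw [h1]; ring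
      _ = c * y' := by rw [hE]
  refine ⟨?_, fun t ht => ?_⟩
  · ext
    · simp only [Params.flowL]
      linear_combination -2 * hend₁
    · simp only [Params.flowL]
      linear_combination hend₁ + hend₂
  · have hs0 : 0 < t / T := div_pos ht.1 hT
    have hs1 : t / T < 1 := (div_lt_one hT).2 ht.2
    have e₁ := exp_mul_le_affine hs0.le hs1.le (-(κ * T))
    have e₂ := strictConcaveOn_cos_Icc.2 (x := α') (y := -α) ⟨by linarith, hαpi'.le⟩
      ⟨by linarith, by linarith⟩ (by linarith) hs0 (sub_pos.2 hs1) (by ring)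
    have r₁ : t / T * (-(κ * T)) = -(κ * t) := by field_simp
    have r₂ : t / T * α' + (1 - t / T) * -α = t - α := by
      have : t / T * T = t := by field_simp
      linear_combination this - t / T * hTdef
    have hcE : c * Real.exp (-(κ * T)) = c' := by
      rw [← hE, Real.exp_neg]; field_simp
    simp only [smul_eq_mul, Real.cos_neg] at e₂
    rw [r₁] at e₁
    rw [r₂] at e₂
    have f₁ := mul_le_mul_of_nonneg_left e₁ hc.le
    have g₁ : c * (1 - t / T + t / T * Real.exp (-(κ * T))) = t / T * c' + (1 - t / T) * c := by
      rw [← hcE]; ring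
    have f₂ : c * Real.exp (-(κ * t)) < Real.cos (t - α) := by
      calc c * Real.exp (-(κ * t)) ≤ t / T * c' + (1 - t / T) * c := g₁ ▸ f₁
        _ < _ := e₂
    have f₃ : 2 < Real.exp (κ * t) * (2 * Real.cos t + y * Real.sin t) := by
      have h1 := hcos t
      have h3 := mul_lt_mul_of_pos_left f₂ (Real.exp_pos (κ * t))
      have h4 : Real.exp (κ * t) * (c * Real.exp (-(κ * t))) = c := by
        rw [Real.exp_neg]; field_simp
      rw [h4] at h3
      refine (mul_lt_mul_iff_right₀ hc).1 ?_
      calc c * 2 < 2 * (Real.exp (κ * t) * Real.cos (t - α)) := by linarith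
        _ = Real.exp (κ * t) * (c * (2 * Real.cos t + y * Real.sin t)) := by rw [h1]; ring
        _ = _ := by ring
    show (p.flowL ε (-1, -y) t).1 < -1
    simp only [Params.flowL]
    linarith

/-- An orbit that returns to the line `x = -1` through the left zone satisfies the half-return
relation. -/
theorem Params.relL_of_flowL (p : Params) {ε y y' T : ℝ} (hy : 0 < y) (hy' : 0 < y') (hT : 0 < T)
    (hin : ∀ t ∈ Ioo 0 T, p.flowL ε (-1, -y) t ∈ zoneL)
    (hend : p.flowL ε (-1, -y) T = (-1, y')) : T = timeL y y' ∧ p.RelL ε y y' := by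
  have hTpi : T ≤ Real.pi := by
    by_contra hlt
    have h : (p.flowL ε (-1, -y) Real.pi).1 < -1 := hin Real.pi ⟨Real.pi_pos, not_le.1 hlt⟩
    simp only [Params.flowL, Real.cos_pi, Real.sin_pi] at h
    linarith [Real.exp_pos (ε * p.kL * Real.pi)]
  have hx := congrArg Prod.fst hend
  have hz := congrArg Prod.snd hend
  simp only [Params.flowL] at hx hz
  have hE := Real.exp_pos (ε * p.kL * T)
  have h2 : Real.exp (2 * (ε * p.kL) * T) = Real.exp (ε * p.kL * T) ^ 2 := by
    rw [← Real.exp_nat_mul]; congr 1; push_cast; ring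
  set E := Real.exp (ε * p.kL * T)
  have hend₁ : E * (2 * Real.cos T + y * Real.sin T) = 2 := by linarith
  have hend₂ : E * (2 * Real.sin T - y * Real.cos T) = y' := by linarith
  have hT' : T = timeL y y' := by
    have h₁ := Real.arctan_lt_pi_div_two (y / 2)
    have h₂ := Real.arctan_lt_pi_div_two (y' / 2)
    have h₃ := Real.arctan_pos.2 (half_pos hy)
    have h₄ := Real.arctan_pos.2 (half_pos hy')
    have hsin : Real.sin (T - Real.arctan (y / 2) - Real.arctan (y' / 2)) = 0 := by
      rw [Real.sin_sub, Real.sin_sub T, Real.cos_sub T, sin_arctan_eq (y / 2),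
        sin_arctan_eq (y' / 2)]
      refine (mul_eq_zero_iff_left hE.ne').1 ?_
      linear_combination (Real.cos (Real.arctan (y / 2)) * Real.cos (Real.arctan (y' / 2))) *
        (hend₂ / 2 - y' * hend₁ / 4)
    have := (Real.sin_eq_zero_iff_of_lt_of_lt (by linarith) (by linarith)).1 hsin
    unfold timeL; linarith
  refine ⟨hT', ?_⟩
  unfold Params.RelL
  rw [← hT', h2]
  have hcs := Real.sin_sq_add_cos_sq T
  linear_combination (-(E * (2 * Real.cos T + y * Real.sin T)) - 2) * hend₁ -
    (E * (2 * Real.sin T - y * Real.cos T) + y') * hend₂ + E ^ 2 * (4 + y ^ 2) * hcs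

/-! ### Gluing passages into periodic orbits -/

/-- `A` is the trace of a Lipschitz Filippov solution on `[0, T]` that starts at `z` and ends
at `w`. -/
def IsArc (X : Zones (ℝ × ℝ → ℝ × ℝ)) (T : ℝ) (z w : ℝ × ℝ) (A : Set (ℝ × ℝ)) : Prop :=
  0 < T ∧ ∃ (γ : ℝ → ℝ × ℝ) (K : NNReal) (S : Set ℝ), LipschitzOnWith K γ (Icc 0 T) ∧
    γ 0 = z ∧ γ T = w ∧ γ '' Icc 0 T = A ∧ S.Countable ∧
    ∀ t ∈ Ioo 0 T, t ∉ S → ∃ v ∈ filippov X (γ t), HasDerivAt γ v t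

theorem IsArc.of_flow {X : Zones (ℝ × ℝ → ℝ × ℝ)} {T : ℝ} (hT : 0 < T) {φ : ℝ → ℝ × ℝ}
    {F : ℝ × ℝ → ℝ × ℝ} (hF : Continuous F) (hφ : ∀ t, HasDerivAt φ (F (φ t)) t)
    {Z : Set (ℝ × ℝ)} (hZ : ∀ z ∈ Z, filippov X z = {F z}) (hin : ∀ t ∈ Ioo 0 T, φ t ∈ Z) :
    IsArc X T (φ 0) (φ T) (φ '' Icc 0 T) := by
  have hcont : Continuous φ := continuous_iff_continuousAt.2 fun t => (hφ t).continuousAt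
  have hC1 : ContDiff ℝ 1 φ := by
    rw [contDiff_one_iff_deriv]
    refine ⟨fun t => (hφ t).differentiableAt, ?_⟩
    rw [show deriv φ = fun t => F (φ t) from funext fun t => (hφ t).deriv]
    exact hF.comp hcont
  obtain ⟨K, hK⟩ := (hC1.contDiffOn (s := Icc 0 T)).exists_lipschitzOnWith (by decide)
    (convex_Icc _ _) isCompact_Icc
  refine ⟨hT, φ, K, ∅, hK, rfl, rfl, rfl, countable_empty, fun t ht _ => ⟨F (φ t), ?_, hφ t⟩⟩
  rw [hZ _ (hin t ht)]; exact mem_singleton _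

theorem IsArc.concat {X : Zones (ℝ × ℝ → ℝ × ℝ)} {T₁ T₂ : ℝ} {z w u : ℝ × ℝ}
    {A B : Set (ℝ × ℝ)} (h₁ : IsArc X T₁ z w A) (h₂ : IsArc X T₂ w u B) :
    IsArc X (T₁ + T₂) z u (A ∪ B) := by
  obtain ⟨hT₁, γ₁, K₁, S₁, hl₁, h0₁, h1₁, hi₁, hS₁, hd₁⟩ := h₁
  obtain ⟨hT₂, γ₂, K₂, S₂, hl₂, h0₂, h1₂, hi₂, hS₂, hd₂⟩ := h₂
  set γ : ℝ → ℝ × ℝ := fun t => if t ≤ T₁ then γ₁ t else γ₂ (t - T₁)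
  have e₁ : ∀ t ≤ T₁, γ t = γ₁ t := fun t ht => if_pos ht
  have e₂ : ∀ t, T₁ ≤ t → γ t = γ₂ (t - T₁) := fun t ht => by
    rcases ht.eq_or_lt with rfl | ht
    · rw [e₁ _ le_rfl, sub_self, h1₁, h0₂]
    · exact if_neg (not_le.2 ht)
  have L₁ : LipschitzOnWith (max K₁ K₂) γ (Icc 0 T₁) := by
    refine LipschitzOnWith.of_dist_le_mul fun s hs t ht => ?_
    rw [e₁ s hs.2, e₁ t ht.2]
    exact (hl₁.weaken (le_max_left K₁ K₂)).dist_le_mul s hs t ht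
  have L₂ : ∀ s ∈ Icc T₁ (T₁ + T₂), ∀ t ∈ Icc T₁ (T₁ + T₂),
      dist (γ s) (γ t) ≤ (max K₁ K₂ : NNReal) * dist s t := by
    intro s hs t ht
    have := (hl₂.weaken (le_max_right K₁ K₂)).dist_le_mul (s - T₁)
      ⟨by linarith [hs.1], by linarith [hs.2]⟩ (t - T₁) ⟨by linarith [ht.1], by linarith [ht.2]⟩
    rwa [dist_sub_right, ← e₂ s hs.1, ← e₂ t ht.1] at this
  refine ⟨by linarith, γ, max K₁ K₂, S₁ ∪ {T₁} ∪ (fun t => t + T₁) '' S₂, ?_, ?_, ?_, ?_, ?_, ?_⟩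
  · have key : ∀ s ∈ Icc 0 (T₁ + T₂), ∀ t ∈ Icc 0 (T₁ + T₂), s ≤ t →
        dist (γ s) (γ t) ≤ (max K₁ K₂ : NNReal) * dist s t := by
      intro s hs t ht hst
      rcases le_total t T₁ with h | h
      · exact L₁.dist_le_mul s ⟨hs.1, hst.trans h⟩ t ⟨ht.1, h⟩
      rcases le_total s T₁ with h' | h'
      · have a := L₁.dist_le_mul s ⟨hs.1, h'⟩ T₁ ⟨hT₁.le, le_rfl⟩
        have b := L₂ T₁ ⟨le_rfl, by linarith⟩ t ⟨h, ht.2⟩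
        have c := dist_triangle (γ s) (γ T₁) (γ t)
        rw [Real.dist_eq, abs_of_nonpos (by linarith)] at a b ⊢
        linarith
      · exact L₂ s ⟨h', hs.2⟩ t ⟨h, ht.2⟩
    refine LipschitzOnWith.of_dist_le_mul fun s hs t ht => ?_
    rcases le_total s t with h | h
    · exact key s hs t ht h
    · rw [dist_comm, dist_comm s]; exact key t ht s hs h
  · rw [e₁ 0 hT₁.le, h0₁]
  · rw [e₂ _ (by linarith), add_sub_cancel_left, h1₂]
  · rw [← hi₁, ← hi₂]
    ext x
    constructor
    · rintro ⟨t, ht, rfl⟩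
      rcases le_total t T₁ with h | h
      · exact Or.inl ⟨t, ⟨ht.1, h⟩, (e₁ t h).symm⟩
      · exact Or.inr ⟨t - T₁, ⟨by linarith, by linarith [ht.2]⟩, (e₂ t h).symm⟩
    · rintro (⟨t, ht, rfl⟩ | ⟨t, ht, rfl⟩)
      · exact ⟨t, ⟨ht.1, by linarith [ht.2]⟩, e₁ t ht.2⟩
      · refine ⟨t + T₁, ⟨by linarith [ht.1], by linarith [ht.2]⟩, ?_⟩
        rw [e₂ _ (by linarith [ht.1]), add_sub_cancel_right]
  · exact (hS₁.union (countable_singleton _)).union (hS₂.image _)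
  · intro t ht htS
    simp only [mem_union, mem_singleton_iff, mem_image, not_or, not_exists, not_and] at htS
    obtain ⟨⟨hn₁, hne⟩, hn₂⟩ := htS
    rcases lt_or_gt_of_ne hne with h | h
    · obtain ⟨v, hv, hd⟩ := hd₁ t ⟨ht.1, h⟩ hn₁
      refine ⟨v, by rwa [e₁ t h.le], hd.congr_of_eventuallyEq ?_⟩
      filter_upwards [Iio_mem_nhds h] with s hs
      exact e₁ s hs.le
    · obtain ⟨v, hv, hd⟩ := hd₂ (t - T₁) ⟨by linarith, by linarith [ht.2]⟩
        (fun hmem => hn₂ _ hmem (by ring))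
      refine ⟨v, by rwa [e₂ t h.le], ?_⟩
      refine (hd.comp_sub_const t T₁).congr_of_eventuallyEq ?_
      filter_upwards [Ioi_mem_nhds h] with s hs
      exact e₂ s hs.le

/-- The periodic extension of a closed arc is a periodic solution. -/
theorem IsArc.isPeriodicOrbit {X : Zones (ℝ × ℝ → ℝ × ℝ)} {T : ℝ} {z : ℝ × ℝ}
    {A : Set (ℝ × ℝ)} (h : IsArc X T z z A) {u v : ℝ × ℝ} (hu : u ∈ A) (hv : v ∈ A)
    (huv : u ≠ v) : IsPeriodicOrbit X A := by
  obtain ⟨hT, γ, K, S, hl, h0, h1, hi, hS, hd⟩ := h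
  set r : ℝ → ℝ := toIcoMod hT 0
  set n : ℝ → ℤ := toIcoDiv hT 0
  have hr : ∀ t, r t ∈ Ico 0 T := fun t => by simpa using toIcoMod_mem_Ico hT 0 t
  have hn : ∀ t, r t + n t * T = t := fun t =>
    toIcoMod_add_toIcoDiv_mul hT 0 t
  have hreq : ∀ t, ∀ m : ℤ, t - m * T ∈ Ico 0 T → r t = t - m * T := fun t m hm => by
    refine (toIcoMod_eq_iff hT).2 ⟨by simpa using hm, m, by simp⟩
  have hper : Function.Periodic (fun t => γ (r t)) T := fun t => by
    have : r (t + T) = r t := toIcoMod_add_right hT 0 t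
    simp only [this]
  have hrange : range (fun t => γ (r t)) = A := by
    rw [← hi]
    ext x
    constructor
    · rintro ⟨t, rfl⟩
      exact ⟨r t, ⟨(hr t).1, (hr t).2.le⟩, rfl⟩
    · rintro ⟨t, ht, rfl⟩
      rcases ht.2.eq_or_lt with rfl | hlt
      · refine ⟨0, ?_⟩
        have : r 0 = 0 := by simpa using hreq 0 0 (by simpa using hT)
        simp only [this, h0, h1]
      · refine ⟨t, ?_⟩
        have : r t = t := by simpa using hreq t 0 (by simpa using ⟨ht.1, hlt⟩)
        simp only [this]
  have hlip : LipschitzWith K (fun t => γ (r t)) := by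
    have key : ∀ s t, s ≤ t → dist (γ (r s)) (γ (r t)) ≤ K * dist s t := by
      intro s t hst
      have hs := hn s
      have ht := hn t
      have hs' := hr s
      have ht' := hr t
      rw [Real.dist_eq, abs_of_nonpos (by linarith)]
      rcases lt_trichotomy (n s) (n t) with hlt | heq | hgt
      · have a := hl.dist_le_mul (r s) ⟨hs'.1, hs'.2.le⟩ T ⟨hT.le, le_rfl⟩
        have b := hl.dist_le_mul 0 ⟨le_rfl, hT.le⟩ (r t) ⟨ht'.1, ht'.2.le⟩
        rw [h1, Real.dist_eq, abs_of_nonpos (by linarith [hs'.2])] at a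
        rw [h0, Real.dist_eq, abs_of_nonpos (by linarith [ht'.1])] at b
        have c := dist_triangle (γ (r s)) z (γ (r t))
        have d : (n s : ℝ) + 1 ≤ n t := by exact_mod_cast hlt
        have e := mul_le_mul_of_nonneg_right d hT.le
        have f : (K : ℝ) * (T - r s + r t) ≤ K * (t - s) :=
          mul_le_mul_of_nonneg_left (by nlinarith) K.2
        linarith
      · have a := hl.dist_le_mul (r s) ⟨hs'.1, hs'.2.le⟩ (r t) ⟨ht'.1, ht'.2.le⟩
        rw [heq] at hs
        rw [Real.dist_eq, abs_of_nonpos (by linarith)] at a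
        calc _ ≤ _ := a
          _ = _ := by congr 1; linarith
      · exfalso
        have d : (n t : ℝ) + 1 ≤ n s := by exact_mod_cast hgt
        have e := mul_le_mul_of_nonneg_right d hT.le
        nlinarith [hs'.1, ht'.2]
    refine LipschitzWith.of_dist_le_mul fun s t => ?_
    rcases le_total s t with h | h
    · exact key s t h
    · rw [dist_comm, dist_comm s]; exact key t s h
  refine ⟨fun t => γ (r t), ⟨fun s t => hlip.lipschitzOnWith.absolutelyContinuousOnInterval, ?_⟩,
    ⟨T, hT, hper⟩, ?_, hrange⟩
  · have hcount : (⋃ m : ℤ, (fun t => t + m * T) '' (S ∪ {0})).Countable :=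
      countable_iUnion fun m => (hS.union (countable_singleton _)).image _
    filter_upwards [hcount.ae_notMem volume] with t ht
    simp only [mem_iUnion, not_exists] at ht
    have hnot : r t ∉ S ∪ {0} := fun hmem => ht (n t) ⟨r t, hmem, hn t⟩
    simp only [mem_union, mem_singleton_iff, not_or] at hnot
    have hrt : r t ∈ Ioo 0 T := ⟨lt_of_le_of_ne (hr t).1 (Ne.symm hnot.2), (hr t).2⟩
    obtain ⟨v, hv, hd⟩ := hd (r t) hrt hnot.1
    refine ⟨v, hv, ?_⟩
    have hrt' : t - n t * T = r t := by linarith [hn t]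
    rw [← hrt'] at hd hrt
    refine (hd.comp_sub_const t (n t * T)).congr_of_eventuallyEq ?_
    have hev : ∀ᶠ s in 𝓝 t, s - n t * T ∈ Ioo 0 T :=
      (show Continuous fun s : ℝ => s - n t * T by fun_prop).continuousAt.eventually
        (Ioo_mem_nhds hrt.1 hrt.2)
    filter_upwards [hev] with s hs
    rw [hreq s (n t) (Ioo_subset_Ico_self hs)]
  · rw [← hrange] at hu hv
    obtain ⟨s, rfl⟩ := hu
    obtain ⟨t, rfl⟩ := hv
    exact ⟨s, t, huv⟩

/-! ### Closed crossing orbits -/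

/-- Smallness of `ε` relative to the height `y`: the points `(±1, ±y)` are crossing points with
the same orientation as for `ε = 0`, and the return times are defined. -/
structure Params.Admissible (p : Params) (ε y : ℝ) : Prop where
  pos : 0 < y
  lt_one : y < 1
  sub_pos : 0 < 1 - y - ε * p.b
  kC_nonneg : 0 ≤ ε * p.kC
  kC_lt : ε * p.kC < y
  kL_lt : 2 * (ε * p.kL) < y
  lt_kL : -y < 2 * (ε * p.kL)
  right_up : (1 + 2 * (ε * p.kR)) * (1 - y) < 1 + y - ε * p.b
  right_down : 1 - y - ε * p.b < (1 + 2 * (ε * p.kR)) * (1 + y)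

/-- The union of the four passages with heights `y₁`, `-y₂`, `-y₃`, `y₄` on the switching
lines. -/
noncomputable def Params.loop (p : Params) (ε y₁ y₂ y₃ y₄ : ℝ) : Set (ℝ × ℝ) :=
  p.flowR ε (1, y₁) '' Icc 0 (p.timeR ε y₁ y₂) ∪ p.flowC ε (1, -y₂) '' Icc 0 (timeC y₂ y₃) ∪
    p.flowL ε (-1, -y₃) '' Icc 0 (timeL y₃ y₄) ∪ p.flowC ε (-1, y₄) '' Icc 0 (timeC y₄ y₁)

/-- The heights `y₁`, `-y₂`, `-y₃`, `y₄` belong to a closed orbit. -/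
structure Params.IsCycle (p : Params) (ε y₁ y₂ y₃ y₄ : ℝ) : Prop where
  adm₁ : p.Admissible ε y₁
  adm₂ : p.Admissible ε y₂
  adm₃ : p.Admissible ε y₃
  adm₄ : p.Admissible ε y₄
  relR : p.RelR ε y₁ y₂
  relC : p.RelC ε y₂ y₃
  relL : p.RelL ε y₃ y₄
  relC' : p.RelC ε y₄ y₁

theorem image_Icc_eq_insert_image_Ioo {φ : ℝ → ℝ × ℝ} {T : ℝ} (hT : 0 < T) :
    φ '' Icc 0 T = {φ 0, φ T} ∪ φ '' Ioo 0 T := by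
  rw [← Ioo_union_both hT.le, image_union, image_pair, union_comm]

theorem timeL_pos {y y' : ℝ} (hy : 0 < y) (hy' : 0 < y') : 0 < timeL y y' :=
  add_pos (Real.arctan_pos.2 (half_pos hy)) (Real.arctan_pos.2 (half_pos hy'))

namespace Params.IsCycle

variable {p : Params} {ε y₁ y₂ y₃ y₄ : ℝ}

theorem passageR (h : p.IsCycle ε y₁ y₂ y₃ y₄) :
    0 < p.timeR ε y₁ y₂ ∧ p.flowR ε (1, y₁) (p.timeR ε y₁ y₂) = (1, -y₂) ∧
      ∀ t ∈ Ioo 0 (p.timeR ε y₁ y₂), p.flowR ε (1, y₁) t ∈ zoneR :=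
  p.flowR_passage h.adm₁.lt_one (add_pos h.adm₁.pos h.adm₂.pos) h.adm₂.sub_pos h.relR

theorem passageC (h : p.IsCycle ε y₁ y₂ y₃ y₄) :
    p.flowC ε (1, -y₂) (timeC y₂ y₃) = (-1, -y₃) ∧
      ∀ t ∈ Ioo 0 (timeC y₂ y₃), p.flowC ε (1, -y₂) t ∈ zoneC := by
  simpa using p.flowC_passage (Or.inl rfl) h.adm₂.pos h.adm₃.pos h.adm₂.kC_nonneg h.adm₂.kC_lt
    h.relC

theorem passageL (h : p.IsCycle ε y₁ y₂ y₃ y₄) :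
    p.flowL ε (-1, -y₃) (timeL y₃ y₄) = (-1, y₄) ∧
      ∀ t ∈ Ioo 0 (timeL y₃ y₄), p.flowL ε (-1, -y₃) t ∈ zoneL :=
  p.flowL_passage h.adm₃.pos h.adm₄.pos h.relL

theorem passageC' (h : p.IsCycle ε y₁ y₂ y₃ y₄) :
    p.flowC ε (-1, y₄) (timeC y₄ y₁) = (1, y₁) ∧
      ∀ t ∈ Ioo 0 (timeC y₄ y₁), p.flowC ε (-1, y₄) t ∈ zoneC := by
  simpa using p.flowC_passage (Or.inr rfl) h.adm₄.pos h.adm₁.pos h.adm₄.kC_nonneg h.adm₄.kC_lt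
    h.relC'

theorem loop_eq (h : p.IsCycle ε y₁ y₂ y₃ y₄) : p.loop ε y₁ y₂ y₃ y₄ =
    {(1, y₁), (1, -y₂), (-1, -y₃), (-1, y₄)} ∪
      (p.flowR ε (1, y₁) '' Ioo 0 (p.timeR ε y₁ y₂) ∪
        p.flowC ε (1, -y₂) '' Ioo 0 (timeC y₂ y₃) ∪
        p.flowL ε (-1, -y₃) '' Ioo 0 (timeL y₃ y₄) ∪
        p.flowC ε (-1, y₄) '' Ioo 0 (timeC y₄ y₁)) := by
  unfold Params.loop
  rw [image_Icc_eq_insert_image_Ioo h.passageR.1,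
    image_Icc_eq_insert_image_Ioo (timeC_mem h.adm₂.pos h.adm₃.pos).1,
    image_Icc_eq_insert_image_Ioo (timeL_pos h.adm₃.pos h.adm₄.pos),
    image_Icc_eq_insert_image_Ioo (timeC_mem h.adm₄.pos h.adm₁.pos).1,
    h.passageR.2.1, h.passageC.1, h.passageL.1, h.passageC'.1]
  simp only [Params.flowR_zero, Params.flowC_zero, Params.flowL_zero]
  ext z
  simp only [mem_union, mem_insert_iff, mem_singleton_iff]
  tauto

theorem loop_inter_lines (h : p.IsCycle ε y₁ y₂ y₃ y₄) :
    p.loop ε y₁ y₂ y₃ y₄ ∩ {z | z.1 = -1 ∨ z.1 = 1} =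
      {(1, y₁), (1, -y₂), (-1, -y₃), (-1, y₄)} := by
  rw [h.loop_eq]
  apply Subset.antisymm
  · rintro z ⟨hz | hz, hl⟩
    · exact hz
    · exfalso
      rcases hz with ((⟨t, ht, rfl⟩ | ⟨t, ht, rfl⟩) | ⟨t, ht, rfl⟩) | ⟨t, ht, rfl⟩
      · have : 1 < (p.flowR ε (1, y₁) t).1 := h.passageR.2.2 t ht
        rcases hl with hl | hl <;> linarith
      · have := h.passageC.2 t ht
        rcases hl with hl | hl <;> linarith [this.1, this.2]
      · have : (p.flowL ε (-1, -y₃) t).1 < -1 := h.passageL.2 t ht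
        rcases hl with hl | hl <;> linarith
      · have := h.passageC'.2 t ht
        rcases hl with hl | hl <;> linarith [this.1, this.2]
  · intro z hz
    refine ⟨Or.inl hz, ?_⟩
    rcases hz with rfl | rfl | rfl | rfl <;> simp

theorem isCrossingPeriodicOrbit (h : p.IsCycle ε y₁ y₂ y₃ y₄) :
    IsCrossingPeriodicOrbit (p.X ε) (p.loop ε y₁ y₂ y₃ y₄) := by
  obtain ⟨hTR, heR, hzR⟩ := h.passageR
  obtain ⟨heC, hzC⟩ := h.passageC
  obtain ⟨heL, hzL⟩ := h.passageL
  obtain ⟨heC', hzC'⟩ := h.passageC'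
  have hTC := (timeC_mem h.adm₂.pos h.adm₃.pos).1
  have hTL := timeL_pos h.adm₃.pos h.adm₄.pos
  have hTC' := (timeC_mem h.adm₄.pos h.adm₁.pos).1
  have aR := IsArc.of_flow (X := p.X ε) hTR (p.continuous_R ε) (p.hasDerivAt_flowR ε (1, y₁))
    (fun z hz => filippov_of_mem_zoneR hz) hzR
  have aC := IsArc.of_flow (X := p.X ε) hTC (p.continuous_C ε) (p.hasDerivAt_flowC ε (1, -y₂))
    (fun z hz => filippov_of_mem_zoneC hz) hzC
  have aL := IsArc.of_flow (X := p.X ε) hTL (p.continuous_L ε) (p.hasDerivAt_flowL ε (-1, -y₃))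
    (fun z hz => filippov_of_mem_zoneL hz) hzL
  have aC' := IsArc.of_flow (X := p.X ε) hTC' (p.continuous_C ε) (p.hasDerivAt_flowC ε (-1, y₄))
    (fun z hz => filippov_of_mem_zoneC hz) hzC'
  rw [Params.flowR_zero, heR] at aR
  rw [Params.flowC_zero, heC] at aC
  rw [Params.flowL_zero, heL] at aL
  rw [Params.flowC_zero, heC'] at aC'
  have harc := ((aR.concat aC).concat aL).concat aC'
  have hloop := h.loop_eq
  have hpR : p.flowR ε (1, y₁) (p.timeR ε y₁ y₂ / 2) ∈ p.loop ε y₁ y₂ y₃ y₄ ∩ zoneR :=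
    ⟨Or.inl (Or.inl (Or.inl ⟨_, ⟨by linarith, by linarith⟩, rfl⟩)),
      hzR _ ⟨by linarith, by linarith⟩⟩
  have hpC : p.flowC ε (1, -y₂) (timeC y₂ y₃ / 2) ∈ p.loop ε y₁ y₂ y₃ y₄ ∩ zoneC :=
    ⟨Or.inl (Or.inl (Or.inr ⟨_, ⟨by linarith, by linarith⟩, rfl⟩)),
      hzC _ ⟨by linarith, by linarith⟩⟩
  have hpL : p.flowL ε (-1, -y₃) (timeL y₃ y₄ / 2) ∈ p.loop ε y₁ y₂ y₃ y₄ ∩ zoneL :=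
    ⟨Or.inl (Or.inr ⟨_, ⟨by linarith, by linarith⟩, rfl⟩), hzL _ ⟨by linarith, by linarith⟩⟩
  refine ⟨harc.isPeriodicOrbit hpR.1 hpL.1 ?_, ⟨_, hpL⟩, ⟨_, hpC⟩, ⟨_, hpR⟩, ?_⟩
  · intro heq
    have h1 := hpR.2
    have h2 := hpL.2
    rw [heq] at h1
    have h1' : 1 < (p.flowL ε (-1, -y₃) (timeL y₃ y₄ / 2)).1 := h1
    have h2' : (p.flowL ε (-1, -y₃) (timeL y₃ y₄ / 2)).1 < -1 := h2
    linarith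
  · intro z hz hl
    have hmem : z ∈ p.loop ε y₁ y₂ y₃ y₄ ∩ {z | z.1 = -1 ∨ z.1 = 1} := ⟨hz, hl⟩
    rw [h.loop_inter_lines] at hmem
    rcases hmem with rfl | rfl | rfl | rfl
    · refine Or.inr ⟨rfl, ?_⟩
      rw [p.X_R, p.X_C]
      have := h.adm₁
      exact mul_pos (by linarith [this.right_up]) (by linarith [this.kC_nonneg, this.pos])
    · refine Or.inr ⟨rfl, ?_⟩
      rw [p.X_R, p.X_C]
      have := h.adm₂
      exact mul_pos_of_neg_of_neg (by linarith [this.right_down]) (by linarith [this.kC_lt])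
    · refine Or.inl ⟨rfl, ?_⟩
      rw [p.X_L, p.X_C]
      have := h.adm₃
      exact mul_pos_of_neg_of_neg (by linarith [this.lt_kL])
        (by linarith [this.kC_nonneg, this.pos])
    · refine Or.inl ⟨rfl, ?_⟩
      rw [p.X_L, p.X_C]
      have := h.adm₄
      exact mul_pos (by linarith [this.kL_lt]) (by linarith [this.kC_lt])

end Params.IsCycle

/-! ### Periodic orbits near a closed orbit -/

/-- The points that, if they lie on a switching line, have height between `lo` and `hi` in
absolute value. -/
def window (lo hi : ℝ) : Set (ℝ × ℝ) := {z | z.1 = -1 ∨ z.1 = 1 → |z.2| ∈ Ioo lo hi}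

theorem isOpen_window (lo hi : ℝ) : IsOpen (window lo hi) := by
  have hc : IsClosed {z : ℝ × ℝ | (z.1 = -1 ∨ z.1 = 1) ∧ |z.2| ∈ (Ioo lo hi)ᶜ} := by
    have h1 : IsClosed {z : ℝ × ℝ | z.1 = -1 ∨ z.1 = 1} :=
      (isClosed_eq continuous_fst continuous_const).union
        (isClosed_eq continuous_fst continuous_const)
    exact h1.inter (isOpen_Ioo.isClosed_compl.preimage (f := fun z : ℝ × ℝ => |z.2|)
      (by fun_prop))
  convert hc.isOpen_compl using 1
  ext z
  simp only [window, mem_ofPred_eq, mem_compl_iff]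
  tauto

/-- A periodic solution that meets the switching lines only in a window of admissible heights. -/
structure Params.IsTrapped (p : Params) (ε lo hi : ℝ) (γ : ℝ → ℝ × ℝ) : Prop where
  adm : ∀ y ∈ Ioo lo hi, p.Admissible ε y
  sol : IsSolution (p.X ε) γ
  periodic : ∃ T > 0, Function.Periodic γ T
  mem_window : ∀ t, γ t ∈ window lo hi

namespace Params.IsTrapped

variable {p : Params} {ε lo hi : ℝ} {γ : ℝ → ℝ × ℝ}

theorem mem_Ioo (h : p.IsTrapped ε lo hi γ) {t e σ y : ℝ} (he : e = -1 ∨ e = 1)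
    (hσ : σ = 1 ∨ σ = -1) (hy : 0 < y) (hz : γ t = (e, σ * y)) : y ∈ Ioo lo hi := by
  have := h.mem_window t (by rw [hz]; exact he)
  rw [hz] at this
  rcases hσ with rfl | rfl <;> simpa [abs_of_pos hy] using this

theorem exists_height (h : p.IsTrapped ε lo hi γ) {t : ℝ}
    (hl : (γ t).1 = -1 ∨ (γ t).1 = 1) : ∃ e σ y : ℝ, (e = -1 ∨ e = 1) ∧ (σ = 1 ∨ σ = -1) ∧
      0 < y ∧ y ∈ Ioo lo hi ∧ γ t = (e, σ * y) := by
  have hw := h.mem_window t hl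
  have hpos := (h.adm _ hw).pos
  rcases le_total 0 (γ t).2 with h0 | h0
  · refine ⟨(γ t).1, 1, |(γ t).2|, hl, Or.inl rfl, hpos, hw, ?_⟩
    rw [abs_of_nonneg h0, one_mul]
  · refine ⟨(γ t).1, -1, |(γ t).2|, hl, Or.inr rfl, hpos, hw, ?_⟩
    rw [abs_of_nonpos h0]; ext <;> simp

/-- Each visit of a switching line is a crossing, to the right at positive heights (`σ = 1`) and to
the left at negative heights (`σ = -1`). -/
theorem sides (h : p.IsTrapped ε lo hi γ) {t₀ e σ y : ℝ} (he : e = -1 ∨ e = 1)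
    (hσ : σ = 1 ∨ σ = -1) (hy : 0 < y) (hz : γ t₀ = (e, σ * y)) :
    ∃ δ > 0, (∀ t ∈ Ioo t₀ (t₀ + δ), 0 < σ * ((γ t).1 - e) ∧ |(γ t).1 - e| < 1) ∧
      ∀ t ∈ Ioo (t₀ - δ) t₀, σ * ((γ t).1 - e) < 0 ∧ |(γ t).1 - e| < 1 := by
  have ha := h.adm y (h.mem_Ioo he hσ hy hz)
  obtain ⟨δ, hδ, h₁, h₂⟩ := h.sol.crossing (p.continuous_L ε) (p.continuous_C ε)
    (p.continuous_R ε) (t₀ := t₀) (σ := σ) (e := e) (by rw [hz]) he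
    (by
      rw [hz, p.X_C]
      have := ha.kC_lt
      have := ha.kC_nonneg
      rcases he with rfl | rfl <;> rcases hσ with rfl | rfl <;> simp only <;> linarith)
    (by
      rintro rfl
      rw [hz, p.X_L]
      have := ha.kL_lt
      have := ha.lt_kL
      rcases hσ with rfl | rfl <;> simp only <;> linarith)
    (by
      rintro rfl
      rw [hz, p.X_R]
      have := ha.right_up
      have := ha.right_down
      rcases hσ with rfl | rfl <;> simp only <;> linarith)
  have hnear : ∀ᶠ t in 𝓝 t₀, |(γ t).1 - e| < 1 := by
    have hγ := h.sol.continuous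
    have hcont : Continuous fun t => |(γ t).1 - e| := by fun_prop
    refine hcont.continuousAt.eventually (gt_mem_nhds ?_)
    simp [hz]
  obtain ⟨δ', hδ', hball⟩ := Metric.eventually_nhds_iff.1 hnear
  refine ⟨min δ δ', lt_min hδ hδ', fun t ht => ⟨h₁ t ⟨ht.1, ?_⟩, hball ?_⟩,
    fun t ht => ⟨h₂ t ⟨?_, ht.2⟩, hball ?_⟩⟩
  · linarith [ht.2, min_le_left δ δ']
  · rw [Real.dist_eq, abs_lt]; constructor <;> linarith [ht.1, ht.2, min_le_right δ δ']
  · linarith [ht.1, min_le_left δ δ']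
  · rw [Real.dist_eq, abs_lt]; constructor <;> linarith [ht.1, ht.2, min_le_right δ δ']

/-- From a crossing point the solution traverses one zone, determined by the line and by the
direction of crossing, up to its next crossing point. -/
theorem exists_passage (h : p.IsTrapped ε lo hi γ) {t₀ e σ y : ℝ} (he : e = -1 ∨ e = 1)
    (hσ : σ = 1 ∨ σ = -1) (hy : 0 < y) (hz : γ t₀ = (e, σ * y)) :
    ∃ T > 0, ∃ e' σ' y' : ℝ, (e' = -1 ∨ e' = 1) ∧ (σ' = 1 ∨ σ' = -1) ∧ 0 < y' ∧
      y' ∈ Ioo lo hi ∧ γ (t₀ + T) = (e', σ' * y') ∧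
      ((e = 1 ∧ σ = 1 ∧ e' = 1 ∧ σ' = -1 ∧ ∀ t ∈ Ioo t₀ (t₀ + T), γ t ∈ zoneR) ∨
        (e = -1 ∧ σ = -1 ∧ e' = -1 ∧ σ' = 1 ∧ ∀ t ∈ Ioo t₀ (t₀ + T), γ t ∈ zoneL) ∨
        (e = -σ ∧ e' = σ' ∧ ∀ t ∈ Ioo t₀ (t₀ + T), γ t ∈ zoneC)) := by
  obtain ⟨δ, hδ, hafter, -⟩ := h.sides he hσ hy hz
  obtain ⟨T₀, hT₀, hper⟩ := h.periodic
  have hB : IsClosed {z : ℝ × ℝ | z.1 = -1 ∨ z.1 = 1} :=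
    (isClosed_eq continuous_fst continuous_const).union
      (isClosed_eq continuous_fst continuous_const)
  obtain ⟨t₁, ht₁, hin, hav⟩ := exists_next_mem h.sol.continuous hB hδ (t₀ := t₀) (t' := t₀ + T₀)
    (fun t ht hmem => by
      obtain ⟨ha, hb⟩ := hafter t ht
      rw [abs_lt] at hb
      have hne : (γ t).1 ≠ e := fun heq => by rw [heq] at ha; simp at ha
      rcases hmem with hm | hm <;> rcases he with rfl | rfl
      · exact hne hm
      · linarith
      · linarith
      · exact hne hm)
    (by linarith) (by rw [hper t₀, hz]; exact he)
  obtain ⟨e', σ', y', he', hσ', hy', hw', hz'⟩ := h.exists_height hin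
  obtain ⟨δ', hδ', -, hbefore⟩ := h.sides he' hσ' hy' hz'
  refine ⟨t₁ - t₀, by linarith, e', σ', y', he', hσ', hy', hw', ?_, ?_⟩
  · rw [add_sub_cancel, hz']
  rw [add_sub_cancel]
  obtain ⟨s, hs, hs'⟩ : ∃ s, t₀ < s ∧ s < min (t₀ + δ) t₁ :=
    exists_between (lt_min (by linarith) ht₁)
  obtain ⟨r, hr, hr'⟩ : ∃ r, max (t₁ - δ') t₀ < r ∧ r < t₁ :=
    exists_between (max_lt (by linarith) ht₁)
  rw [lt_min_iff] at hs'
  rw [max_lt_iff] at hr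
  obtain ⟨a₁, a₂⟩ := hafter s ⟨hs, hs'.1⟩
  obtain ⟨b₁, b₂⟩ := hbefore r ⟨hr.1, hr'⟩
  rw [abs_lt] at a₂ b₂
  rcases forall_mem_zone_of_avoids h.sol.continuous (isPreconnected_Ioo (a := t₀) (b := t₁))
    (fun t ht => ⟨fun hm => hav t ht (Or.inl hm), fun hm => hav t ht (Or.inr hm)⟩)
    with hZ | hZ | hZ
  · have z₁ : (γ s).1 < -1 := hZ s ⟨hs, hs'.2⟩
    have z₂ : (γ r).1 < -1 := hZ r ⟨hr.2, hr'⟩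
    refine Or.inr (Or.inl ?_)
    rcases he with rfl | rfl
    · rcases hσ with rfl | rfl
      · linarith
      rcases he' with rfl | rfl
      · rcases hσ' with rfl | rfl
        · exact ⟨rfl, rfl, rfl, rfl, hZ⟩
        · linarith
      · linarith
    · linarith
  · have z₁ : -1 < (γ s).1 ∧ (γ s).1 < 1 := hZ s ⟨hs, hs'.2⟩
    have z₂ : -1 < (γ r).1 ∧ (γ r).1 < 1 := hZ r ⟨hr.2, hr'⟩
    refine Or.inr (Or.inr ⟨?_, ?_, hZ⟩)
    · rcases he with rfl | rfl <;> rcases hσ with rfl | rfl <;> first | rfl | linarith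
    · rcases he' with rfl | rfl <;> rcases hσ' with rfl | rfl <;> first | rfl | linarith
  · have z₁ : 1 < (γ s).1 := hZ s ⟨hs, hs'.2⟩
    have z₂ : 1 < (γ r).1 := hZ r ⟨hr.2, hr'⟩
    refine Or.inl ?_
    rcases he with rfl | rfl
    · linarith
    · rcases hσ with rfl | rfl
      · rcases he' with rfl | rfl
        · linarith
        · rcases hσ' with rfl | rfl
          · linarith
          · exact ⟨rfl, rfl, rfl, rfl, hZ⟩
      · linarith

theorem stepR (h : p.IsTrapped ε lo hi γ) {t₀ y : ℝ} (hy : 0 < y) (hz : γ t₀ = (1, y)) :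
    ∃ y' ∈ Ioo lo hi, p.RelR ε y y' ∧ 0 < p.timeR ε y y' ∧
      γ (t₀ + p.timeR ε y y') = (1, -y') ∧
      (∀ t ∈ Icc 0 (p.timeR ε y y'), γ (t₀ + t) = p.flowR ε (1, y) t) ∧
      ∀ t ∈ Ioo t₀ (t₀ + p.timeR ε y y'), γ t ∈ zoneR := by
  have hz1 : γ t₀ = (1, 1 * y) := by rw [hz, one_mul]
  have ha := h.adm y (h.mem_Ioo (Or.inr rfl) (Or.inl rfl) hy hz1)
  obtain ⟨T, hT, e', σ', y', -, -, -, hw, hend, hZ⟩ :=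
    h.exists_passage (Or.inr rfl) (Or.inl rfl) hy hz1
  obtain ⟨-, -, rfl, rfl, hZ'⟩ : (1 : ℝ) = 1 ∧ (1 : ℝ) = 1 ∧ e' = 1 ∧ σ' = -1 ∧
      ∀ t ∈ Ioo t₀ (t₀ + T), γ t ∈ zoneR := by
    rcases hZ with hZ | hZ | hZ
    · exact hZ
    · exact absurd hZ.1 (by norm_num)
    · exact absurd hZ.1 (by norm_num)
  obtain ⟨K, -, -, hK⟩ := p.exists_lipschitzWith ε
  have hflow := h.sol.eqOn_flow hK (fun z hz => filippov_of_mem_zoneR hz) hZ'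
    (p.hasDerivAt_flowR ε (1, y)) (by rw [hz, Params.flowR_zero])
  rw [add_sub_cancel_left] at hflow
  rw [neg_one_mul] at hend
  obtain ⟨rfl, hrel⟩ := p.relR_of_flowR (by linarith [ha.sub_pos, ha.pos])
    ((hflow T ⟨hT.le, le_rfl⟩).symm.trans hend)
  exact ⟨y', hw, hrel, hT, hend, hflow, hZ'⟩

theorem stepL (h : p.IsTrapped ε lo hi γ) {t₀ y : ℝ} (hy : 0 < y) (hz : γ t₀ = (-1, -y)) :
    ∃ y' ∈ Ioo lo hi, p.RelL ε y y' ∧ 0 < timeL y y' ∧ γ (t₀ + timeL y y') = (-1, y') ∧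
      (∀ t ∈ Icc 0 (timeL y y'), γ (t₀ + t) = p.flowL ε (-1, -y) t) ∧
      ∀ t ∈ Ioo t₀ (t₀ + timeL y y'), γ t ∈ zoneL := by
  have hz1 : γ t₀ = (-1, -1 * y) := by rw [hz, neg_one_mul]
  obtain ⟨T, hT, e', σ', y', -, -, hy', hw, hend, hZ⟩ :=
    h.exists_passage (Or.inl rfl) (Or.inr rfl) hy hz1
  obtain ⟨-, -, rfl, rfl, hZ'⟩ : (-1 : ℝ) = -1 ∧ (-1 : ℝ) = -1 ∧ e' = -1 ∧ σ' = 1 ∧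
      ∀ t ∈ Ioo t₀ (t₀ + T), γ t ∈ zoneL := by
    rcases hZ with hZ | hZ | hZ
    · exact absurd hZ.1 (by norm_num)
    · exact hZ
    · exact absurd hZ.1 (by norm_num)
  obtain ⟨K, hK, -, -⟩ := p.exists_lipschitzWith ε
  have hflow := h.sol.eqOn_flow hK (fun z hz => filippov_of_mem_zoneL hz) hZ'
    (p.hasDerivAt_flowL ε (-1, -y)) (by rw [hz, Params.flowL_zero])
  rw [add_sub_cancel_left] at hflow
  rw [one_mul] at hend
  obtain ⟨rfl, hrel⟩ := p.relL_of_flowL hy hy' hT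
    (fun t ht => hflow t (Ioo_subset_Icc_self ht) ▸
      hZ' (t₀ + t) ⟨by linarith [ht.1], by linarith [ht.2]⟩)
    ((hflow T ⟨hT.le, le_rfl⟩).symm.trans hend)
  exact ⟨y', hw, hrel, hT, hend, hflow, hZ'⟩

theorem stepC (h : p.IsTrapped ε lo hi γ) {t₀ y σ : ℝ} (hσ : σ = 1 ∨ σ = -1) (hy : 0 < y)
    (hz : γ t₀ = (σ, -σ * y)) :
    ∃ y' ∈ Ioo lo hi, p.RelC ε y y' ∧ 0 < timeC y y' ∧
      γ (t₀ + timeC y y') = (-σ, -σ * y') ∧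
      (∀ t ∈ Icc 0 (timeC y y'), γ (t₀ + t) = p.flowC ε (σ, -σ * y) t) ∧
      ∀ t ∈ Ioo t₀ (t₀ + timeC y y'), γ t ∈ zoneC := by
  have he : σ = -1 ∨ σ = 1 := hσ.symm
  have hσ' : -σ = 1 ∨ -σ = -1 := by rcases hσ with rfl | rfl <;> simp
  have ha := h.adm y (h.mem_Ioo he hσ' hy hz)
  obtain ⟨T, hT, e', τ, y', he', -, hy', hw, hend, hZ⟩ := h.exists_passage he hσ' hy hz
  obtain ⟨-, rfl, hZ'⟩ : σ = - -σ ∧ e' = τ ∧ ∀ t ∈ Ioo t₀ (t₀ + T), γ t ∈ zoneC := by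
    rcases hZ with hZ | hZ | hZ
    · linarith [hZ.1, hZ.2.1]
    · linarith [hZ.1, hZ.2.1]
    · exact hZ
  obtain ⟨K, -, hK, -⟩ := p.exists_lipschitzWith ε
  have hflow := h.sol.eqOn_flow hK (fun z hz => filippov_of_mem_zoneC hz) hZ'
    (p.hasDerivAt_flowC ε (σ, -σ * y)) (by rw [hz, Params.flowC_zero])
  rw [add_sub_cancel_left] at hflow
  have hzone : ∀ t ∈ Ioo 0 T, p.flowC ε (σ, -σ * y) t ∈ zoneC := fun t ht =>
    hflow t (Ioo_subset_Icc_self ht) ▸ hZ' (t₀ + t) ⟨by linarith [ht.1], by linarith [ht.2]⟩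
  have hendf := (hflow T ⟨hT.le, le_rfl⟩).symm.trans hend
  obtain rfl : e' = -σ := by
    by_contra hne
    obtain rfl : e' = σ := by
      rcases hσ with rfl | rfl <;> rcases he' with rfl | rfl <;> simp_all
    exact p.flowC_ne_same_side hσ hy hy' ha.kC_nonneg hT hzone hendf
  obtain ⟨rfl, hrel⟩ := p.relC_of_flowC hσ hy hy' ha.kC_nonneg hT hzone hendf
  exact ⟨y', hw, hrel, hT, hend, hflow, hZ'⟩

end Params.IsTrapped

theorem image_add_Icc_add {γ : ℝ → ℝ × ℝ} {t₀ a b : ℝ} (ha : 0 ≤ a) (hb : 0 ≤ b) :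
    (fun t => γ (t₀ + t)) '' Icc 0 (a + b) =
      (fun t => γ (t₀ + t)) '' Icc 0 a ∪ (fun t => γ (t₀ + a + t)) '' Icc 0 b := by
  ext z
  constructor
  · rintro ⟨t, ht, rfl⟩
    rcases le_total t a with h | h
    · exact Or.inl ⟨t, ⟨ht.1, h⟩, rfl⟩
    · exact Or.inr ⟨t - a, ⟨by linarith, by linarith [ht.2]⟩, by simp only; congr 1; ring⟩
  · rintro (⟨t, ht, rfl⟩ | ⟨t, ht, rfl⟩)
    · exact ⟨t, ⟨ht.1, by linarith [ht.2]⟩, rfl⟩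
    · exact ⟨a + t, ⟨by linarith [ht.1], by linarith [ht.2]⟩, by simp only; congr 1; ring⟩

namespace Params.IsTrapped

variable {p : Params} {ε lo hi : ℝ} {γ : ℝ → ℝ × ℝ}

/-- One turn of a trapped solution, from the upper half of the line `x = 1` to the next visit of
it. -/
theorem exists_turn (h : p.IsTrapped ε lo hi γ) {t₀ y : ℝ} (hy : 0 < y) (hz : γ t₀ = (1, y)) :
    ∃ y₂ ∈ Ioo lo hi, ∃ y₃ ∈ Ioo lo hi, ∃ y₄ ∈ Ioo lo hi, ∃ y₅ ∈ Ioo lo hi,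
      p.RelR ε y y₂ ∧ p.RelC ε y₂ y₃ ∧ p.RelL ε y₃ y₄ ∧ p.RelC ε y₄ y₅ ∧
      ∃ T > 0, T = p.timeR ε y y₂ + timeC y₂ y₃ + timeL y₃ y₄ + timeC y₄ y₅ ∧
        γ (t₀ + T) = (1, y₅) ∧
        (∀ t ∈ Ioo t₀ (t₀ + T), ¬ ((γ t).1 = 1 ∧ 0 ≤ (γ t).2)) ∧
        (y₅ = y → (fun t => γ (t₀ + t)) '' Icc 0 T = p.loop ε y y₂ y₃ y₄) := by
  obtain ⟨y₂, hw₂, r₁, T₁, z₁, f₁, Z₁⟩ := h.stepR hy hz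
  have hy₂ := (h.adm y₂ hw₂).pos
  obtain ⟨y₃, hw₃, r₂, T₂, z₂, f₂, Z₂⟩ := h.stepC (Or.inl rfl) hy₂ (z₁.trans (by simp))
  have hy₃ := (h.adm y₃ hw₃).pos
  obtain ⟨y₄, hw₄, r₃, T₃, z₃, f₃, Z₃⟩ := h.stepL hy₃ (z₂.trans (by simp))
  have hy₄ := (h.adm y₄ hw₄).pos
  obtain ⟨y₅, hw₅, r₄, T₄, z₄, f₄, Z₄⟩ := h.stepC (Or.inr rfl) hy₄ (z₃.trans (by simp))
  refine ⟨y₂, hw₂, y₃, hw₃, y₄, hw₄, y₅, hw₅, r₁, r₂, r₃, r₄, _, ?_, rfl, ?_, ?_, ?_⟩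
  · linarith
  · rw [← add_assoc, ← add_assoc, ← add_assoc, z₄]; simp
  · rintro t ht ⟨hx, hpos⟩
    rcases lt_trichotomy t (t₀ + p.timeR ε y y₂) with hlt | rfl | hgt
    · have : 1 < (γ t).1 := Z₁ t ⟨ht.1, hlt⟩
      linarith
    · rw [z₁] at hpos; simp only at hpos; linarith
    rcases lt_trichotomy t (t₀ + p.timeR ε y y₂ + timeC y₂ y₃) with hlt | rfl | hgt
    · linarith [(Z₂ t ⟨hgt, hlt⟩).2]
    · rw [z₂] at hx; simp only at hx; linarith
    rcases lt_trichotomy t (t₀ + p.timeR ε y y₂ + timeC y₂ y₃ + timeL y₃ y₄) with hlt | rfl | hgt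
    · have : (γ t).1 < -1 := Z₃ t ⟨hgt, hlt⟩
      linarith
    · rw [z₃] at hx; simp only at hx; linarith
    · linarith [(Z₄ t ⟨hgt, by linarith [ht.2]⟩).2]
  · rintro rfl
    rw [image_add_Icc_add (by linarith) T₄.le, image_add_Icc_add (by linarith) T₃.le,
      image_add_Icc_add T₁.le T₂.le]
    simp only [← add_assoc]
    unfold Params.loop
    rw [image_congr f₁, image_congr f₂, image_congr f₃, image_congr f₄]
    simp

/-- A nonconstant trapped solution leaves every zone, hence visits the upper half of the line
`x = 1`. -/
theorem exists_mem_upper (h : p.IsTrapped ε lo hi γ) (hne : (Ioo lo hi).Nonempty)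
    (hkC : ε * p.kC ≠ 0) (hconst : ∃ s t, γ s ≠ γ t) : ∃ t y, 0 < y ∧ γ t = (1, y) := by
  have hhit : ∃ t, (γ t).1 = -1 ∨ (γ t).1 = 1 := by
    by_contra hno
    simp only [not_exists, not_or] at hno
    obtain ⟨K, hKL, hKC, hKR⟩ := p.exists_lipschitzWith ε
    obtain ⟨T, hT, hper⟩ := h.periodic
    have hfin : ¬ ∀ t, 0 ≤ t → γ t = γ 0 := by
      intro hall
      obtain ⟨s, t, hst⟩ := hconst
      have : ∀ s, γ s = γ 0 := fun s => by
        obtain ⟨s', hs', hs''⟩ := hper.exists_mem_Ico₀ hT s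
        rw [hs'', hall s' hs'.1]
      exact hst ((this s).trans (this t).symm)
    rcases forall_mem_zone_of_avoids h.sol.continuous isPreconnected_univ
      (fun t _ => hno t) with hZ | hZ | hZ
    · have hflow := h.sol.eqOn_flow (a := 0) (b := Real.pi) hKL
        (fun z hz => filippov_of_mem_zoneL hz) (fun t _ => hZ t (mem_univ t))
        (p.hasDerivAt_flowL ε (γ 0)) (by simp)
      have h1 : (γ Real.pi).1 < -1 := hZ Real.pi (mem_univ _)
      have h0 : (γ 0).1 < -1 := hZ 0 (mem_univ _)
      have := hflow Real.pi ⟨Real.pi_pos.le, by simp⟩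
      rw [zero_add] at this
      rw [this] at h1
      simp only [Params.flowL, Real.cos_pi, Real.sin_pi] at h1
      nlinarith [Real.exp_pos (ε * p.kL * Real.pi)]
    · have hflow : ∀ t, 0 ≤ t → γ t = p.flowC ε (γ 0) t := fun t ht => by
        simpa using h.sol.eqOn_flow (a := 0) (b := t) hKC
          (fun z hz => filippov_of_mem_zoneC hz) (fun t _ => hZ t (mem_univ t))
          (p.hasDerivAt_flowC ε (γ 0)) (by simp) t ⟨ht, (sub_zero t).ge⟩
      have h1 : γ 0 = p.flowC ε (γ 0) T := (hper 0).symm.trans (by rw [zero_add]; exact hflow T hT.le)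
      have hx := congrArg Prod.fst h1
      have hy := congrArg Prod.snd h1
      simp only [Params.flowC] at hx hy
      have hE : Real.exp (ε * p.kC * T) ^ 2 ≠ 1 := by
        intro hE
        have := (pow_eq_one_iff_of_nonneg (Real.exp_pos _).le two_ne_zero).1 hE
        rw [Real.exp_eq_one_iff] at this
        exact (mul_ne_zero hkC hT.ne') this
      have hcs := Real.sin_sq_add_cos_sq T
      set E := Real.exp (ε * p.kC * T)
      have hsq : ((γ 0).1 ^ 2 + (γ 0).2 ^ 2) * (E ^ 2 - 1) = 0 := by
        have e₁ : (γ 0).1 ^ 2 + (γ 0).2 ^ 2 =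
            (E * ((γ 0).1 * Real.cos T + (γ 0).2 * Real.sin T)) ^ 2 +
            (E * ((γ 0).2 * Real.cos T - (γ 0).1 * Real.sin T)) ^ 2 := by rw [← hx, ← hy]
        linear_combination -e₁ - E ^ 2 * ((γ 0).1 ^ 2 + (γ 0).2 ^ 2) * hcs
      have h00 : (γ 0).1 ^ 2 + (γ 0).2 ^ 2 = 0 :=
        (mul_eq_zero.1 hsq).resolve_right (sub_ne_zero.2 hE)
      have hx0 : (γ 0).1 = 0 := by nlinarith [sq_nonneg (γ 0).1, sq_nonneg (γ 0).2]
      have hy0 : (γ 0).2 = 0 := by nlinarith [sq_nonneg (γ 0).1, sq_nonneg (γ 0).2]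
      refine hfin fun t ht => ?_
      rw [hflow t ht]
      ext <;> simp [Params.flowC, hx0, hy0]
    · have hflow : ∀ t, 0 ≤ t → γ t = p.flowR ε (γ 0) t := fun t ht => by
        simpa using h.sol.eqOn_flow (a := 0) (b := t) hKR
          (fun z hz => filippov_of_mem_zoneR hz) (fun t _ => hZ t (mem_univ t))
          (p.hasDerivAt_flowR ε (γ 0)) (by simp) t ⟨ht, (sub_zero t).ge⟩
      have h1 : γ 0 = p.flowR ε (γ 0) T := (hper 0).symm.trans (by rw [zero_add]; exact hflow T hT.le)
      have hx := congrArg Prod.fst h1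
      have hy := congrArg Prod.snd h1
      simp only [Params.flowR] at hx hy
      obtain ⟨y, hyw⟩ := hne
      have ha := h.adm y hyw
      have hlam : 0 < 1 + 2 * ε * p.kR := by
        have h3 := ha.sub_pos.trans ha.right_down
        have h4 := pos_of_mul_pos_left h3 (by linarith [ha.pos])
        linarith
      have hE₁ : Real.exp ((1 + 2 * ε * p.kR) * T) ≠ 1 := by
        rw [Ne, Real.exp_eq_one_iff]; positivity
      have hE₂ : Real.exp (-T) ≠ 1 := by
        rw [Ne, Real.exp_eq_one_iff, neg_eq_zero]; exact hT.ne'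
      have hP : (2 - (γ 0).1 - (γ 0).2) * (Real.exp ((1 + 2 * ε * p.kR) * T) - 1) = 0 := by
        linear_combination hx + hy
      have hQ : (2 - (γ 0).1 + (γ 0).2 - ε * p.b) * (Real.exp (-T) - 1) = 0 := by
        linear_combination hx - hy
      have hP0 := (mul_eq_zero.1 hP).resolve_right (sub_ne_zero.2 hE₁)
      have hQ0 := (mul_eq_zero.1 hQ).resolve_right (sub_ne_zero.2 hE₂)
      refine hfin fun t ht => ?_
      rw [hflow t ht]
      ext
      · simp only [Params.flowR]; rw [hP0, hQ0]; linarith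
      · simp only [Params.flowR]; rw [hP0, hQ0]; linarith
  obtain ⟨t, ht⟩ := hhit
  obtain ⟨e, σ, y, he, hσ, hy, hw, hz⟩ := h.exists_height ht
  have goC' : ∀ t y, 0 < y → γ t = (-1, y) → ∃ t y, 0 < y ∧ γ t = (1, y) := by
    intro t y hy hz
    obtain ⟨y', hw', -, -, hz', -⟩ := h.stepC (Or.inr rfl) hy (hz.trans (by simp))
    exact ⟨_, y', (h.adm y' hw').pos, hz'.trans (by simp)⟩
  have goL : ∀ t y, 0 < y → γ t = (-1, -y) → ∃ t y, 0 < y ∧ γ t = (1, y) := by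
    intro t y hy hz
    obtain ⟨y', hw', -, -, hz', -⟩ := h.stepL hy hz
    exact goC' _ y' (h.adm y' hw').pos hz'
  rcases he with rfl | rfl <;> rcases hσ with rfl | rfl
  · exact goC' t y hy (hz.trans (by simp))
  · exact goL t y hy (hz.trans (by simp))
  · exact ⟨t, y, hy, hz.trans (by simp)⟩
  · obtain ⟨y', hw', -, -, hz', -⟩ := h.stepC (Or.inl rfl) hy (hz.trans (by simp))
    exact goL _ y' (h.adm y' hw').pos (hz'.trans (by simp))

/-- Every visit of the upper half of `x = 1` is the end of a turn. -/
theorem exists_previous (h : p.IsTrapped ε lo hi γ) {t₀ y : ℝ} (hy : 0 < y)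
    (hz : γ t₀ = (1, y)) : ∃ y₁ ∈ Ioo lo hi, ∃ y₂ ∈ Ioo lo hi, ∃ y₃ ∈ Ioo lo hi,
      ∃ y₄ ∈ Ioo lo hi, p.RelR ε y₁ y₂ ∧ p.RelC ε y₂ y₃ ∧ p.RelL ε y₃ y₄ ∧ p.RelC ε y₄ y ∧
        ∃ t, γ t = (1, y₁) := by
  obtain ⟨δ, hδ, -, hbefore⟩ := h.sides (Or.inr rfl) (Or.inl rfl) hy (hz.trans (by simp))
  obtain ⟨T, hT, hper⟩ := h.periodic
  have hγ := h.sol.continuous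
  have hnot : ∀ t ∈ Ioo (t₀ - δ) t₀, ¬ ((γ t).1 = 1 ∧ 0 ≤ (γ t).2) := fun t ht hm => by
    have := (hbefore t ht).1
    rw [hm.1] at this
    simp at this
  set S := Iic (t₀ - δ) ∩ {t | (γ t).1 = 1 ∧ 0 ≤ (γ t).2}
  have hSc : IsClosed S := by
    have h₁ : IsClosed {t | (γ t).1 = 1} := isClosed_eq (by fun_prop) continuous_const
    have h₂ : IsClosed {t | 0 ≤ (γ t).2} := isClosed_le continuous_const (by fun_prop)
    exact isClosed_Iic.inter (h₁.inter h₂)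
  have hSne : S.Nonempty := by
    refine ⟨t₀ - T, ?_, ?_⟩
    · by_contra hlt
      refine hnot (t₀ - T) ⟨not_le.1 hlt, by linarith⟩ ?_
      rw [hper.sub_eq, hz]; exact ⟨rfl, hy.le⟩
    · show (γ (t₀ - T)).1 = 1 ∧ 0 ≤ (γ (t₀ - T)).2
      rw [hper.sub_eq, hz]; exact ⟨rfl, hy.le⟩
  have hbdd : BddAbove S := ⟨t₀ - δ, fun _ hs => hs.1⟩
  have hmem := hSc.csSup_mem hSne hbdd
  have hub : ∀ t ∈ S, t ≤ sSup S := fun t ht => le_csSup hbdd ht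
  set s := sSup S
  have hs₀ : s ≤ t₀ - δ := hmem.1
  have hw := h.mem_window s (Or.inr hmem.2.1)
  rw [abs_of_nonneg hmem.2.2] at hw
  have hzs : γ s = (1, (γ s).2) := by ext <;> simp [hmem.2.1]
  have hpos := (h.adm _ hw).pos
  obtain ⟨y₂, hw₂, y₃, hw₃, y₄, hw₄, y₅, hw₅, r₁, r₂, r₃, r₄, T', hT', -, hend, hno, -⟩ :=
    h.exists_turn hpos hzs
  have hyend : (γ (s + T')).1 = 1 ∧ 0 ≤ (γ (s + T')).2 := by
    rw [hend]; exact ⟨rfl, (h.adm _ hw₅).pos.le⟩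
  have heq : s + T' = t₀ := by
    rcases lt_trichotomy (s + T') t₀ with hlt | heq | hgt
    · exfalso
      by_cases hle : s + T' ≤ t₀ - δ
      · linarith [hub _ ⟨hle, hyend⟩]
      · exact hnot _ ⟨not_le.1 hle, hlt⟩ hyend
    · exact heq
    · exfalso
      refine hno t₀ ⟨by linarith, hgt⟩ ?_
      rw [hz]; exact ⟨rfl, hy.le⟩
  rw [heq, hz] at hend
  obtain rfl : y = y₅ := congrArg Prod.snd hend
  exact ⟨_, hw, y₂, hw₂, y₃, hw₃, y₄, hw₄, r₁, r₂, r₃, r₄, s, hzs⟩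

end Params.IsTrapped

/-! ### Monotonicity of the half-return maps -/

/-- The relation has the separated form `A y' = B y` with `A` and `B` both decreasing. -/
theorem Params.RelR.mono {p : Params} {ε lo hi y y' z z' : ℝ}
    (adm : ∀ y ∈ Ioo lo hi, p.Admissible ε y) (hy : y ∈ Ioo lo hi) (hy' : y' ∈ Ioo lo hi)
    (hz : z ∈ Ioo lo hi) (hz' : z' ∈ Ioo lo hi) (h₁ : p.RelR ε y y') (h₂ : p.RelR ε z z')
    (hyz : y ≤ z) : y' ≤ z' := by
  set m := 1 + 2 * (ε * p.kR)
  set A : ℝ → ℝ := fun x => Real.log (1 + x) + m * Real.log (1 - x - ε * p.b)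
  set B : ℝ → ℝ := fun x => Real.log (1 - x) + m * Real.log (1 + x - ε * p.b)
  have key : ∀ x ∈ Ioo lo hi, ∀ x' ∈ Ioo lo hi, p.RelR ε x x' → A x' = B x := by
    intro x hx x' hx' hrel
    have a := adm x hx
    have a' := adm x' hx'
    have p₁ : 0 < 1 + x - ε * p.b := by linarith [a.sub_pos, a.pos]
    have p₂ : 0 < 1 - x := by linarith [a.lt_one]
    have p₃ : 0 < 1 + x' := by linarith [a'.pos]
    have := congrArg Real.log hrel
    rw [Real.log_mul p₃.ne' a'.sub_pos.ne', Real.log_mul (mul_pos p₂ p₁).ne' (Real.exp_pos _).ne',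
      Real.log_mul p₂.ne' p₁.ne', Real.log_exp, Params.timeR] at this
    simp only [A, B, m]
    linear_combination this
  have dA : ∀ x ∈ Ioo lo hi, HasDerivAt A (1 / (1 + x) + m * (-1 / (1 - x - ε * p.b))) x := by
    intro x hx
    have a := adm x hx
    exact (((hasDerivAt_id x).const_add 1).log (by simp only [id]; linarith [a.pos])).add
      (((((hasDerivAt_id x).const_sub 1).sub_const (ε * p.b)).log a.sub_pos.ne').const_mul m)
  have dB : ∀ x ∈ Ioo lo hi, HasDerivAt B (-1 / (1 - x) + m * (1 / (1 + x - ε * p.b))) x := by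
    intro x hx
    have a := adm x hx
    exact (((hasDerivAt_id x).const_sub 1).log (by simp only [id]; linarith [a.lt_one])).add
      (((((hasDerivAt_id x).const_add 1).sub_const (ε * p.b)).log
        (by simp only [id]; linarith [a.sub_pos, a.pos])).const_mul m)
  have hA : StrictAntiOn A (Ioo lo hi) := by
    refine strictAntiOn_of_deriv_neg (convex_Ioo _ _)
      (fun x hx => (dA x hx).continuousAt.continuousWithinAt) fun x hx => ?_
    rw [interior_Ioo] at hx
    rw [(dA x hx).deriv]
    have a := adm x hx
    have p₁ : 0 < 1 + x := by linarith [a.pos]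
    have p₂ := a.sub_pos
    have : 1 / (1 + x) + m * (-1 / (1 - x - ε * p.b)) =
        (1 - x - ε * p.b - m * (1 + x)) / ((1 + x) * (1 - x - ε * p.b)) := by
      field_simp
      ring
    rw [this]
    exact div_neg_of_neg_of_pos (by linarith [a.right_down]) (by positivity)
  have hB : StrictAntiOn B (Ioo lo hi) := by
    refine strictAntiOn_of_deriv_neg (convex_Ioo _ _)
      (fun x hx => (dB x hx).continuousAt.continuousWithinAt) fun x hx => ?_
    rw [interior_Ioo] at hx
    rw [(dB x hx).deriv]
    have a := adm x hx
    have p₁ : 0 < 1 + x - ε * p.b := by linarith [a.sub_pos, a.pos]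
    have p₂ : 0 < 1 - x := by linarith [a.lt_one]
    have : -1 / (1 - x) + m * (1 / (1 + x - ε * p.b)) =
        (m * (1 - x) - (1 + x - ε * p.b)) / ((1 - x) * (1 + x - ε * p.b)) := by
      field_simp
      ring
    rw [this]
    exact div_neg_of_neg_of_pos (by linarith [a.right_up]) (by positivity)
  rw [← hA.le_iff_ge hz' hy', key y hy y' hy' h₁, key z hz z' hz' h₂]
  exact hB.antitoneOn hy hz hyz

/-- The relation has the separated form `A y' = B y` with `A` and `B` both increasing. -/
theorem Params.RelC.mono {p : Params} {ε lo hi y y' z z' : ℝ}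
    (adm : ∀ y ∈ Ioo lo hi, p.Admissible ε y) (hy : y ∈ Ioo lo hi) (hy' : y' ∈ Ioo lo hi)
    (hz : z ∈ Ioo lo hi) (hz' : z' ∈ Ioo lo hi) (h₁ : p.RelC ε y y') (h₂ : p.RelC ε z z')
    (hyz : y ≤ z) : y' ≤ z' := by
  set m := 2 * (ε * p.kC)
  set A : ℝ → ℝ := fun x => Real.log (1 + x ^ 2) + m * Real.arctan x
  set B : ℝ → ℝ := fun x => Real.log (1 + x ^ 2) + m * (Real.pi - Real.arctan x)
  have key : ∀ x x', p.RelC ε x x' → A x' = B x := by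
    intro x x' hrel
    have := congrArg Real.log hrel
    rw [Real.log_mul (by positivity) (Real.exp_pos _).ne', Real.log_exp, timeC] at this
    simp only [A, B, m]
    linear_combination this
  have dlog : ∀ x : ℝ, HasDerivAt (fun x => Real.log (1 + x ^ 2)) (2 * x / (1 + x ^ 2)) x := by
    intro x
    have := (((hasDerivAt_id x).pow 2).const_add 1).log
      (by simp only [Pi.pow_apply, id]; positivity)
    simpa using this
  have dA : ∀ x, HasDerivAt A (2 * x / (1 + x ^ 2) + m * (1 / (1 + x ^ 2))) x := fun x =>
    (dlog x).add ((Real.hasDerivAt_arctan x).const_mul m)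
  have dB : ∀ x, HasDerivAt B (2 * x / (1 + x ^ 2) + m * (-(1 / (1 + x ^ 2)))) x := fun x =>
    (dlog x).add (((Real.hasDerivAt_arctan x).const_sub Real.pi).const_mul m)
  have hA : StrictMonoOn A (Ioo lo hi) := by
    refine strictMonoOn_of_deriv_pos (convex_Ioo _ _)
      (fun x _ => (dA x).continuousAt.continuousWithinAt) fun x hx => ?_
    rw [interior_Ioo] at hx
    have a := adm x hx
    rw [(dA x).deriv, show 2 * x / (1 + x ^ 2) + m * (1 / (1 + x ^ 2)) =
      (2 * x + m) / (1 + x ^ 2) by ring]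
    exact div_pos (by linarith [a.pos, a.kC_nonneg]) (by positivity)
  have hB : StrictMonoOn B (Ioo lo hi) := by
    refine strictMonoOn_of_deriv_pos (convex_Ioo _ _)
      (fun x _ => (dB x).continuousAt.continuousWithinAt) fun x hx => ?_
    rw [interior_Ioo] at hx
    have a := adm x hx
    rw [(dB x).deriv, show 2 * x / (1 + x ^ 2) + m * (-(1 / (1 + x ^ 2))) =
      (2 * x - m) / (1 + x ^ 2) by ring]
    exact div_pos (by linarith [a.kC_lt]) (by positivity)
  rw [← hA.le_iff_le hy' hz', key y y' h₁, key z z' h₂]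
  exact hB.monotoneOn hy hz hyz

/-- The relation has the separated form `A y' = B y` with `A` and `B` both increasing. -/
theorem Params.RelL.mono {p : Params} {ε lo hi y y' z z' : ℝ}
    (adm : ∀ y ∈ Ioo lo hi, p.Admissible ε y) (hy : y ∈ Ioo lo hi) (hy' : y' ∈ Ioo lo hi)
    (hz : z ∈ Ioo lo hi) (hz' : z' ∈ Ioo lo hi) (h₁ : p.RelL ε y y') (h₂ : p.RelL ε z z')
    (hyz : y ≤ z) : y' ≤ z' := by
  set m := 2 * (ε * p.kL)
  set A : ℝ → ℝ := fun x => Real.log (4 + x ^ 2) - m * Real.arctan (x / 2)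
  set B : ℝ → ℝ := fun x => Real.log (4 + x ^ 2) + m * Real.arctan (x / 2)
  have key : ∀ x x', p.RelL ε x x' → A x' = B x := by
    intro x x' hrel
    have := congrArg Real.log hrel
    rw [Real.log_mul (by positivity) (Real.exp_pos _).ne', Real.log_exp, timeL] at this
    simp only [A, B, m]
    linear_combination this
  have dlog : ∀ x : ℝ, HasDerivAt (fun x => Real.log (4 + x ^ 2)) (2 * x / (4 + x ^ 2)) x := by
    intro x
    have := (((hasDerivAt_id x).pow 2).const_add 4).log
      (by simp only [Pi.pow_apply, id]; positivity)
    simpa using this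
  have datan : ∀ x : ℝ, HasDerivAt (fun x => Real.arctan (x / 2)) (2 / (4 + x ^ 2)) x := by
    intro x
    refine ((hasDerivAt_id x).div_const 2).arctan.congr_deriv ?_
    simp only [id]
    field_simp
    ring
  have dA : ∀ x, HasDerivAt A (2 * x / (4 + x ^ 2) - m * (2 / (4 + x ^ 2))) x := fun x =>
    (dlog x).sub ((datan x).const_mul m)
  have dB : ∀ x, HasDerivAt B (2 * x / (4 + x ^ 2) + m * (2 / (4 + x ^ 2))) x := fun x =>
    (dlog x).add ((datan x).const_mul m)
  have hA : StrictMonoOn A (Ioo lo hi) := by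
    refine strictMonoOn_of_deriv_pos (convex_Ioo _ _)
      (fun x _ => (dA x).continuousAt.continuousWithinAt) fun x hx => ?_
    rw [interior_Ioo] at hx
    have a := adm x hx
    rw [(dA x).deriv, show 2 * x / (4 + x ^ 2) - m * (2 / (4 + x ^ 2)) =
      2 * (x - m) / (4 + x ^ 2) by ring]
    exact div_pos (by linarith [a.kL_lt]) (by positivity)
  have hB : StrictMonoOn B (Ioo lo hi) := by
    refine strictMonoOn_of_deriv_pos (convex_Ioo _ _)
      (fun x _ => (dB x).continuousAt.continuousWithinAt) fun x hx => ?_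
    rw [interior_Ioo] at hx
    have a := adm x hx
    rw [(dB x).deriv, show 2 * x / (4 + x ^ 2) + m * (2 / (4 + x ^ 2)) =
      2 * (x + m) / (4 + x ^ 2) by ring]
    exact div_pos (by linarith [a.lt_kL]) (by positivity)
  rw [← hA.le_iff_le hy' hz', key y y' h₁, key z z' h₂]
  exact hB.monotoneOn hy hz hyz

/-! ### Isolated closed orbits -/

namespace Params.IsTrapped

variable {p : Params} {ε lo hi : ℝ} {γ : ℝ → ℝ × ℝ}

/-- Among the visits of the upper half of `x = 1` the highest one repeats: the next visit is not
higher, and by monotonicity it is not lower than the visit that follows the predecessor of the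
highest one. -/
theorem exists_cycle (h : p.IsTrapped ε lo hi γ) (hne : (Ioo lo hi).Nonempty)
    (hkC : ε * p.kC ≠ 0) (hconst : ∃ s t, γ s ≠ γ t) :
    ∃ t₀, ∃ y₁ ∈ Ioo lo hi, ∃ y₂ ∈ Ioo lo hi, ∃ y₃ ∈ Ioo lo hi, ∃ y₄ ∈ Ioo lo hi,
      p.IsCycle ε y₁ y₂ y₃ y₄ ∧ γ t₀ = (1, y₁) := by
  obtain ⟨T, hT, hper⟩ := h.periodic
  have hγ := h.sol.continuous
  obtain ⟨s, y, hy, hs⟩ := h.exists_mem_upper hne hkC hconst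
  have hcpt : IsCompact (range γ ∩ {z | z.1 = 1 ∧ 0 ≤ z.2}) := by
    refine (hper.compact_of_continuous hT.ne' hγ).inter_right ?_
    exact (isClosed_eq continuous_fst continuous_const).inter
      (isClosed_le continuous_const continuous_snd)
  obtain ⟨z, ⟨⟨t₀, rfl⟩, hz₁, hz₂⟩, hmax⟩ := hcpt.exists_isMaxOn (f := Prod.snd)
    ⟨γ s, ⟨s, rfl⟩, by rw [hs]; exact ⟨rfl, hy.le⟩⟩ continuous_snd.continuousOn
  have hle : ∀ t x, 0 < x → γ t = (1, x) → x ≤ (γ t₀).2 := by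
    intro t x hx ht
    have : γ t ∈ range γ ∩ {z | z.1 = 1 ∧ 0 ≤ z.2} :=
      ⟨⟨t, rfl⟩, by rw [ht]; exact ⟨rfl, hx.le⟩⟩
    have := hmax this
    rwa [mem_ofPred_eq, ht] at this
  have hw := h.mem_window t₀ (Or.inr hz₁)
  rw [abs_of_nonneg hz₂] at hw
  have hz : γ t₀ = (1, (γ t₀).2) := by ext <;> simp [hz₁]
  generalize (γ t₀).2 = m at *
  have hm := (h.adm m hw).pos
  obtain ⟨y₂, hw₂, y₃, hw₃, y₄, hw₄, y₅, hw₅, r₁, r₂, r₃, r₄, T', -, -, hend, -, -⟩ :=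
    h.exists_turn hm hz
  obtain ⟨x₁, hx₁, x₂, hx₂, x₃, hx₃, x₄, hx₄, q₁, q₂, q₃, q₄, t, ht⟩ := h.exists_previous hm hz
  have l₁ : x₁ ≤ m := hle t x₁ (h.adm _ hx₁).pos ht
  have l₂ := Params.RelR.mono h.adm hx₁ hx₂ hw hw₂ q₁ r₁ l₁
  have l₃ := Params.RelC.mono h.adm hx₂ hx₃ hw₂ hw₃ q₂ r₂ l₂
  have l₄ := Params.RelL.mono h.adm hx₃ hx₄ hw₃ hw₄ q₃ r₃ l₃
  have l₅ : m ≤ y₅ := Params.RelC.mono h.adm hx₄ hw hw₄ hw₅ q₄ r₄ l₄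
  obtain rfl : y₅ = m := le_antisymm (hle _ _ (h.adm _ hw₅).pos hend) l₅
  exact ⟨t₀, y₅, hw, y₂, hw₂, y₃, hw₃, y₄, hw₄,
    ⟨h.adm _ hw, h.adm _ hw₂, h.adm _ hw₃, h.adm _ hw₄, r₁, r₂, r₃, r₄⟩, hz⟩

/-- If the turn starting at height `y₁` is a closed one, the solution repeats it for ever. -/
theorem range_eq_loop (h : p.IsTrapped ε lo hi γ) {t₀ y₁ y₂ y₃ y₄ : ℝ}
    (hy₁ : y₁ ∈ Ioo lo hi) (hz : γ t₀ = (1, y₁))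
    (hnext : ∀ x₂ ∈ Ioo lo hi, ∀ x₃ ∈ Ioo lo hi, ∀ x₄ ∈ Ioo lo hi, ∀ x₅ ∈ Ioo lo hi,
      p.RelR ε y₁ x₂ → p.RelC ε x₂ x₃ → p.RelL ε x₃ x₄ → p.RelC ε x₄ x₅ →
        x₂ = y₂ ∧ x₃ = y₃ ∧ x₄ = y₄ ∧ x₅ = y₁) :
    range γ = p.loop ε y₁ y₂ y₃ y₄ := by
  obtain ⟨T₀, hT₀, hper⟩ := h.periodic
  set T := p.timeR ε y₁ y₂ + timeC y₂ y₃ + timeL y₃ y₄ + timeC y₄ y₁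
  have turn : ∀ t, γ t = (1, y₁) → 0 < T ∧ γ (t + T) = (1, y₁) ∧
      (fun s => γ (t + s)) '' Icc 0 T = p.loop ε y₁ y₂ y₃ y₄ := by
    intro t ht
    obtain ⟨x₂, h₂, x₃, h₃, x₄, h₄, x₅, h₅, r₁, r₂, r₃, r₄, T', hT', rfl, hend, -, himg⟩ :=
      h.exists_turn (h.adm _ hy₁).pos ht
    obtain ⟨rfl, rfl, rfl, rfl⟩ := hnext x₂ h₂ x₃ h₃ x₄ h₄ x₅ h₅ r₁ r₂ r₃ r₄
    exact ⟨hT', hend, himg rfl⟩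
  have hT := (turn t₀ hz).1
  have hn : ∀ n : ℕ, γ (t₀ + n * T) = (1, y₁) := by
    intro n
    induction n with
    | zero => simpa using hz
    | succ n ih =>
      have := (turn _ ih).2.1
      rw [← this]; congr 1; push_cast; ring
  refine Subset.antisymm ?_ ?_
  · rintro _ ⟨t, rfl⟩
    obtain ⟨s, hs, hs'⟩ := hper.exists_mem_Ico hT₀ t t₀
    rw [hs']
    set n := ⌊(s - t₀) / T⌋₊
    have h₁ : n * T ≤ s - t₀ :=
      (le_div_iff₀ hT).1 (Nat.floor_le (div_nonneg (by linarith [hs.1]) hT.le))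
    have h₂ : s - t₀ < (n + 1) * T := (div_lt_iff₀ hT).1 (Nat.lt_floor_add_one _)
    rw [← (turn _ (hn n)).2.2]
    exact ⟨s - t₀ - n * T, ⟨by linarith, by linarith⟩, by simp only; congr 1; ring⟩
  · rw [← (turn t₀ hz).2.2]
    rintro _ ⟨t, -, rfl⟩
    exact ⟨_, rfl⟩

end Params.IsTrapped

/-- A closed orbit whose heights are the only solution of the closing equations in a window is a
limit cycle. -/
theorem Params.IsCycle.isCrossingLimitCycle {p : Params} {ε lo hi y₁ y₂ y₃ y₄ : ℝ}
    (adm : ∀ y ∈ Ioo lo hi, p.Admissible ε y) (hkC : ε * p.kC ≠ 0)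
    (h : p.IsCycle ε y₁ y₂ y₃ y₄) (h₁ : y₁ ∈ Ioo lo hi) (h₂ : y₂ ∈ Ioo lo hi)
    (h₃ : y₃ ∈ Ioo lo hi) (h₄ : y₄ ∈ Ioo lo hi)
    (huniq : ∀ x₁ ∈ Ioo lo hi, ∀ x₂ ∈ Ioo lo hi, ∀ x₃ ∈ Ioo lo hi, ∀ x₄ ∈ Ioo lo hi,
      p.IsCycle ε x₁ x₂ x₃ x₄ → x₁ = y₁ ∧ x₂ = y₂ ∧ x₃ = y₃ ∧ x₄ = y₄) :
    IsCrossingLimitCycle (p.X ε) (p.loop ε y₁ y₂ y₃ y₄) := by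
  refine ⟨h.isCrossingPeriodicOrbit, window lo hi, isOpen_window lo hi, ?_, ?_⟩
  · intro z hz hl
    have hmem : z ∈ p.loop ε y₁ y₂ y₃ y₄ ∩ {z | z.1 = -1 ∨ z.1 = 1} := ⟨hz, hl⟩
    rw [h.loop_inter_lines] at hmem
    rcases hmem with rfl | rfl | rfl | rfl
    · simpa [abs_of_pos h.adm₁.pos] using h₁
    · simpa [abs_of_pos h.adm₂.pos] using h₂
    · simpa [abs_of_pos h.adm₃.pos] using h₃
    · simpa [abs_of_pos h.adm₄.pos] using h₄
  · rintro Γ' ⟨γ, hsol, hper, hconst, rfl⟩ hsub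
    have ht : p.IsTrapped ε lo hi γ := ⟨adm, hsol, hper, fun t => hsub ⟨t, rfl⟩⟩
    obtain ⟨t₀, x₁, hx₁, x₂, hx₂, x₃, hx₃, x₄, hx₄, hcyc, hz⟩ := ht.exists_cycle ⟨_, h₁⟩ hkC hconst
    obtain ⟨rfl, rfl, rfl, rfl⟩ := huniq x₁ hx₁ x₂ hx₂ x₃ hx₃ x₄ hx₄ hcyc
    refine ht.range_eq_loop h₁ hz fun u₂ k₂ u₃ k₃ u₄ k₄ u₅ k₅ r₁ r₂ r₃ r₄ => ?_
    obtain rfl : u₂ = x₂ := le_antisymm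
      (r₁.mono adm h₁ k₂ h₁ h₂ hcyc.relR le_rfl) (hcyc.relR.mono adm h₁ h₂ h₁ k₂ r₁ le_rfl)
    obtain rfl : u₃ = x₃ := le_antisymm
      (r₂.mono adm h₂ k₃ h₂ h₃ hcyc.relC le_rfl) (hcyc.relC.mono adm h₂ h₃ h₂ k₃ r₂ le_rfl)
    obtain rfl : u₄ = x₄ := le_antisymm
      (r₃.mono adm h₃ k₄ h₃ h₄ hcyc.relL le_rfl) (hcyc.relL.mono adm h₃ h₄ h₃ k₄ r₃ le_rfl)
    obtain rfl : u₅ = x₁ := le_antisymm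
      (r₄.mono adm h₄ k₅ h₄ h₁ hcyc.relC' le_rfl) (hcyc.relC'.mono adm h₄ h₁ h₄ k₅ r₄ le_rfl)
    exact ⟨rfl, rfl, rfl, rfl⟩

/-! ### The closing equations -/

/-- The entire function `(exp u - 1) / u`, with value `1` at `u = 0`. -/
noncomputable def expSlope : ℝ → ℝ := dslope Real.exp 0

theorem exp_sub_one_eq (u : ℝ) : Real.exp u - 1 = u * expSlope u := by
  have := sub_smul_dslope Real.exp 0 u
  rw [sub_zero, Real.exp_zero, smul_eq_mul] at this
  exact this.symm

theorem expSlope_zero : expSlope 0 = 1 := by simp [expSlope]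

theorem contDiffAt_expSlope : ContDiffAt ℝ 1 expSlope 0 := by
  obtain ⟨q, hq⟩ := (analyticAt_rexp : AnalyticAt ℝ Real.exp 0)
  exact hq.has_fpower_series_dslope_fslope.analyticAt.contDiffAt

/-- The growth of the square of the height over the right passage, divided by `ε`; see
`Params.relR_iff`. Unlike the quotient itself it is regular at `ε = 0`. -/
noncomputable def Params.gainR (p : Params) (ε y y' : ℝ) : ℝ :=
  -p.b * (y + y') - (1 - y) * (1 + y - ε * p.b) * (2 * p.kR * p.timeR ε y y') *
    expSlope (ε * (2 * p.kR * p.timeR ε y y'))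

/-- The growth of the square of the height over a central passage, divided by `ε`; see
`Params.relC_iff`. -/
noncomputable def Params.gainC (p : Params) (ε y y' : ℝ) : ℝ :=
  (1 + y ^ 2) * (2 * p.kC * timeC y y') * expSlope (ε * (2 * p.kC * timeC y y'))

/-- The growth of the square of the height over the left passage, divided by `ε`; see
`Params.relL_iff`. -/
noncomputable def Params.gainL (p : Params) (ε y y' : ℝ) : ℝ :=
  (4 + y ^ 2) * (2 * p.kL * timeL y y') * expSlope (ε * (2 * p.kL * timeL y y'))

theorem Params.relR_iff (p : Params) (ε y y' : ℝ) :
    p.RelR ε y y' ↔ y' ^ 2 - y ^ 2 = ε * p.gainR ε y y' := by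
  have h := exp_sub_one_eq (ε * (2 * p.kR * p.timeR ε y y'))
  rw [Params.RelR, Params.gainR,
    show 2 * (ε * p.kR) * p.timeR ε y y' = ε * (2 * p.kR * p.timeR ε y y') by ring]
  constructor <;> intro hr
  · linear_combination -hr - (1 - y) * (1 + y - ε * p.b) * h
  · linear_combination -hr - (1 - y) * (1 + y - ε * p.b) * h

theorem Params.relC_iff (p : Params) (ε y y' : ℝ) :
    p.RelC ε y y' ↔ y' ^ 2 - y ^ 2 = ε * p.gainC ε y y' := by
  have h := exp_sub_one_eq (ε * (2 * p.kC * timeC y y'))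
  rw [Params.RelC, Params.gainC,
    show 2 * (ε * p.kC) * timeC y y' = ε * (2 * p.kC * timeC y y') by ring]
  constructor <;> intro hr
  · linear_combination hr + (1 + y ^ 2) * h
  · linear_combination hr - (1 + y ^ 2) * h

theorem Params.relL_iff (p : Params) (ε y y' : ℝ) :
    p.RelL ε y y' ↔ y' ^ 2 - y ^ 2 = ε * p.gainL ε y y' := by
  have h := exp_sub_one_eq (ε * (2 * p.kL * timeL y y'))
  rw [Params.RelL, Params.gainL,
    show 2 * (ε * p.kL) * timeL y y' = ε * (2 * p.kL * timeL y y') by ring]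
  constructor <;> intro hr
  · linear_combination hr + (4 + y ^ 2) * h
  · linear_combination hr - (4 + y ^ 2) * h

/-- The first order displacement function: the total growth of the square of the height over one
turn along the unperturbed orbit of height `y`, divided by `ε`. -/
noncomputable def Params.melnikov (p : Params) (y : ℝ) : ℝ :=
  p.gainR 0 y y + p.gainC 0 y y + p.gainL 0 y y + p.gainC 0 y y

/-- The closing equations for `(ε, y₁, y₂, y₃, y₄)`. The last component is the sum of the four
passage relations, in which the squares of the heights cancel, divided by `ε`. -/
noncomputable def Params.closing (p : Params) (q : ℝ × ℝ × ℝ × ℝ × ℝ) : ℝ × ℝ × ℝ × ℝ × ℝ :=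
  (q.1,
    q.2.2.1 ^ 2 - q.2.1 ^ 2 - q.1 * p.gainR q.1 q.2.1 q.2.2.1,
    q.2.2.2.1 ^ 2 - q.2.2.1 ^ 2 - q.1 * p.gainC q.1 q.2.2.1 q.2.2.2.1,
    q.2.2.2.2 ^ 2 - q.2.2.2.1 ^ 2 - q.1 * p.gainL q.1 q.2.2.2.1 q.2.2.2.2,
    p.gainR q.1 q.2.1 q.2.2.1 + p.gainC q.1 q.2.2.1 q.2.2.2.1 +
      p.gainL q.1 q.2.2.2.1 q.2.2.2.2 + p.gainC q.1 q.2.2.2.2 q.2.1)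

theorem Params.closing_eq_iff (p : Params) {ε : ℝ} (hε : ε ≠ 0) (y₁ y₂ y₃ y₄ : ℝ) :
    p.closing (ε, y₁, y₂, y₃, y₄) = (ε, 0, 0, 0, 0) ↔
      p.RelR ε y₁ y₂ ∧ p.RelC ε y₂ y₃ ∧ p.RelL ε y₃ y₄ ∧ p.RelC ε y₄ y₁ := by
  simp only [p.relR_iff, p.relC_iff, p.relL_iff, Params.closing, Prod.mk.injEq, true_and,
    sub_eq_zero]
  refine and_congr_right fun h₁ => and_congr_right fun h₂ => and_congr_right fun h₃ => ?_
  constructor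
  · intro h₄
    linear_combination -ε * h₄ - h₁ - h₂ - h₃
  · intro h₄
    exact mul_left_cancel₀ hε (by linear_combination -h₁ - h₂ - h₃ - h₄)

section Smooth

variable {E : Type*} [NormedAddCommGroup E] [NormedSpace ℝ E] {f g k : E → ℝ} {a : E}

theorem Params.contDiffAt_gainR (p : Params) (hf : ContDiffAt ℝ 1 f a) (hg : ContDiffAt ℝ 1 g a)
    (hk : ContDiffAt ℝ 1 k a) (h0 : f a = 0) (h₁ : 0 < g a) (h₂ : k a < 1) :
    ContDiffAt ℝ 1 (fun x => p.gainR (f x) (g x) (k x)) a := by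
  have hT : ContDiffAt ℝ 1 (fun x => p.timeR (f x) (g x) (k x)) a := by
    unfold Params.timeR
    refine ContDiffAt.sub (ContDiffAt.log (by fun_prop) ?_) (ContDiffAt.log (by fun_prop) ?_)
    · rw [h0]; linarith
    · rw [h0]; linarith
  have hS : ContDiffAt ℝ 1
      (fun x => expSlope (f x * (2 * p.kR * p.timeR (f x) (g x) (k x)))) a :=
    ContDiffAt.comp a (by rw [h0, zero_mul]; exact contDiffAt_expSlope) (by fun_prop)
  unfold Params.gainR
  fun_prop

theorem Params.contDiffAt_gainC (p : Params) (hf : ContDiffAt ℝ 1 f a) (hg : ContDiffAt ℝ 1 g a)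
    (hk : ContDiffAt ℝ 1 k a) (h0 : f a = 0) :
    ContDiffAt ℝ 1 (fun x => p.gainC (f x) (g x) (k x)) a := by
  have hT : ContDiffAt ℝ 1 (fun x => timeC (g x) (k x)) a := by
    unfold timeC
    exact (contDiffAt_const.sub hg.arctan).sub hk.arctan
  have hS : ContDiffAt ℝ 1 (fun x => expSlope (f x * (2 * p.kC * timeC (g x) (k x)))) a :=
    ContDiffAt.comp a (by rw [h0, zero_mul]; exact contDiffAt_expSlope) (by fun_prop)
  unfold Params.gainC
  fun_prop

theorem Params.contDiffAt_gainL (p : Params) (hf : ContDiffAt ℝ 1 f a) (hg : ContDiffAt ℝ 1 g a)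
    (hk : ContDiffAt ℝ 1 k a) (h0 : f a = 0) :
    ContDiffAt ℝ 1 (fun x => p.gainL (f x) (g x) (k x)) a := by
  have hT : ContDiffAt ℝ 1 (fun x => timeL (g x) (k x)) a := by
    unfold timeL
    exact (hg.div_const 2).arctan.add (hk.div_const 2).arctan
  have hS : ContDiffAt ℝ 1 (fun x => expSlope (f x * (2 * p.kL * timeL (g x) (k x)))) a :=
    ContDiffAt.comp a (by rw [h0, zero_mul]; exact contDiffAt_expSlope) (by fun_prop)
  unfold Params.gainL
  fun_prop

end Smooth

theorem Params.contDiffAt_closing (p : Params) {h : ℝ} (h₀ : 0 < h) (h₁ : h < 1) :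
    ContDiffAt ℝ 1 p.closing (0, h, h, h, h) := by
  have c₀ : ContDiffAt ℝ 1 (fun q : ℝ × ℝ × ℝ × ℝ × ℝ => q.1) (0, h, h, h, h) := by fun_prop
  have c₁ : ContDiffAt ℝ 1 (fun q : ℝ × ℝ × ℝ × ℝ × ℝ => q.2.1) (0, h, h, h, h) := by fun_prop
  have c₂ : ContDiffAt ℝ 1 (fun q : ℝ × ℝ × ℝ × ℝ × ℝ => q.2.2.1) (0, h, h, h, h) := by fun_prop
  have c₃ : ContDiffAt ℝ 1 (fun q : ℝ × ℝ × ℝ × ℝ × ℝ => q.2.2.2.1) (0, h, h, h, h) := by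
    fun_prop
  have c₄ : ContDiffAt ℝ 1 (fun q : ℝ × ℝ × ℝ × ℝ × ℝ => q.2.2.2.2) (0, h, h, h, h) := by
    fun_prop
  have gR := p.contDiffAt_gainR c₀ c₁ c₂ rfl h₀ h₁
  have gC := p.contDiffAt_gainC c₀ c₂ c₃ rfl
  have gL := p.contDiffAt_gainL c₀ c₃ c₄ rfl
  have gC' := p.contDiffAt_gainC c₀ c₄ c₁ rfl
  unfold Params.closing
  exact c₀.prodMk ((((c₂.pow 2).sub (c₁.pow 2)).sub (c₀.mul gR)).prodMk
    ((((c₃.pow 2).sub (c₂.pow 2)).sub (c₀.mul gC)).prodMk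
      ((((c₄.pow 2).sub (c₃.pow 2)).sub (c₀.mul gL)).prodMk (((gR.add gC).add gL).add gC'))))

theorem _root_.HasDerivAt.prod_fst {E F : Type*} [NormedAddCommGroup E] [NormedSpace ℝ E]
    [NormedAddCommGroup F] [NormedSpace ℝ F] {f : ℝ → E × F} {f' : E × F} {x : ℝ}
    (h : HasDerivAt f f' x) : HasDerivAt (fun t => (f t).1) f'.1 x := by
  simpa using h.hasFDerivAt.fst.hasDerivAt

theorem _root_.HasDerivAt.prod_snd {E F : Type*} [NormedAddCommGroup E] [NormedSpace ℝ E]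
    [NormedAddCommGroup F] [NormedSpace ℝ F] {f : ℝ → E × F} {f' : E × F} {x : ℝ}
    (h : HasDerivAt f f' x) : HasDerivAt (fun t => (f t).2) f'.2 x := by
  simpa using h.hasFDerivAt.snd.hasDerivAt

/-- At a simple zero of the displacement function the derivative of the closing equations is
injective: the first four components force a vector of the kernel to be diagonal, and along the
diagonal the last component is the displacement function. -/
theorem Params.closing_deriv_injective (p : Params) {h m : ℝ} (h₀ : 0 < h)
    (hm : HasDerivAt p.melnikov m h) (hm0 : m ≠ 0)
    {A : (ℝ × ℝ × ℝ × ℝ × ℝ) →L[ℝ] ℝ × ℝ × ℝ × ℝ × ℝ}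
    (hA : HasFDerivAt p.closing A (0, h, h, h, h)) : Function.Injective A := by
  rw [injective_iff_map_eq_zero]
  rintro ⟨v₀, v₁, v₂, v₃, v₄⟩ hv
  have hline : HasDerivAt (fun s : ℝ => ((0 : ℝ), h, h, h, h) + s • (v₀, v₁, v₂, v₃, v₄))
      (v₀, v₁, v₂, v₃, v₄) 0 := by
    simpa using ((hasDerivAt_id (0 : ℝ)).smul_const (v₀, v₁, v₂, v₃, v₄)).const_add
      ((0 : ℝ), h, h, h, h)
  have hcomp := HasFDerivAt.comp_hasDerivAt
    (f := fun s : ℝ => ((0 : ℝ), h, h, h, h) + s • (v₀, v₁, v₂, v₃, v₄)) (0 : ℝ)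
    (by rw [zero_smul, add_zero]; exact hA) hline
  rw [hv] at hcomp
  obtain rfl : v₀ = 0 := by
    have h1 := hcomp.prod_fst
    have h2 : HasDerivAt (fun s : ℝ => 0 + s * v₀) v₀ 0 := by
      simpa using (hasDerivAt_id (0 : ℝ)).mul_const v₀
    simpa using h2.unique h1
  have hsq : ∀ u v : ℝ, HasDerivAt (fun s : ℝ => (h + s * u) ^ 2 - (h + s * v) ^ 2)
      (2 * h * (u - v)) 0 := fun u v => by
    have hu := (((hasDerivAt_id (0 : ℝ)).mul_const u).const_add h).pow 2
    have hv := (((hasDerivAt_id (0 : ℝ)).mul_const v).const_add h).pow 2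
    refine (hu.sub hv).congr_deriv ?_
    simp only [id]; ring
  have key : ∀ u v : ℝ, HasDerivAt (fun s : ℝ => (h + s * u) ^ 2 - (h + s * v) ^ 2) 0 0 → u = v :=
    fun u v huv => by
      have := mul_eq_zero.1 ((hsq u v).unique huv)
      linarith [this.resolve_left (by positivity)]
  obtain rfl : v₂ = v₁ := key _ _ <| by
    simpa [Function.comp_def, Params.closing] using hcomp.prod_snd.prod_fst
  obtain rfl : v₃ = v₂ := key _ _ <| by
    simpa [Function.comp_def, Params.closing] using hcomp.prod_snd.prod_snd.prod_fst
  obtain rfl : v₄ = v₃ := key _ _ <| by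
    simpa [Function.comp_def, Params.closing] using hcomp.prod_snd.prod_snd.prod_snd.prod_fst
  have hdiag : HasDerivAt (fun s : ℝ => p.melnikov (h + s * v₄)) 0 0 := by
    simpa [Function.comp_def, Params.closing, Params.melnikov] using hcomp.prod_snd.prod_snd.prod_snd.prod_snd
  have hdiag' : HasDerivAt (fun s : ℝ => p.melnikov (h + s * v₄)) (m * v₄) 0 := by
    have h1 : HasDerivAt (fun s : ℝ => h + s * v₄) v₄ 0 := by
      simpa using ((hasDerivAt_id (0 : ℝ)).mul_const v₄).const_add h
    exact HasDerivAt.comp (0 : ℝ) (by simpa using hm) h1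
  obtain rfl : v₄ = 0 := (mul_eq_zero.1 (hdiag'.unique hdiag)).resolve_left hm0
  rfl

/-- A simple zero of the displacement function continues to a locally unique branch of solutions
of the closing equations. -/
theorem Params.exists_branch (p : Params) {h m : ℝ} (h₀ : 0 < h) (h₁ : h < 1)
    (hzero : p.melnikov h = 0) (hm : HasDerivAt p.melnikov m h) (hm0 : m ≠ 0) :
    ∃ V ∈ 𝓝 ((0 : ℝ), h, h, h, h), InjOn p.closing V ∧ ∃ z : ℝ → ℝ × ℝ × ℝ × ℝ × ℝ,
      Tendsto z (𝓝 0) (𝓝 (0, h, h, h, h)) ∧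
        ∀ᶠ ε in 𝓝 0, p.closing (z ε) = (ε, 0, 0, 0, 0) := by
  have hc := p.contDiffAt_closing h₀ h₁
  have hs := hc.hasStrictFDerivAt one_ne_zero
  have hinj := p.closing_deriv_injective h₀ hm hm0 hs.hasFDerivAt
  set A := fderiv ℝ p.closing (0, h, h, h, h)
  let B := (LinearEquiv.ofInjectiveEndo (A : (ℝ × ℝ × ℝ × ℝ × ℝ) →ₗ[ℝ] ℝ × ℝ × ℝ × ℝ × ℝ)
    hinj).toContinuousLinearEquiv
  have hB : (B : (ℝ × ℝ × ℝ × ℝ × ℝ) →L[ℝ] ℝ × ℝ × ℝ × ℝ × ℝ) = A := by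
    rfl
  rw [← hB] at hs
  set e := hs.toOpenPartialHomeomorph p.closing
  have hbase : p.closing (0, h, h, h, h) = (0, 0, 0, 0, 0) := by
    simp only [Params.closing, Prod.mk.injEq]
    refine ⟨trivial, by ring, by ring, by ring, hzero⟩
  have hmem : ((0 : ℝ), h, h, h, h) ∈ e.source := hs.mem_toOpenPartialHomeomorph_source
  have hcoe : ⇑e = p.closing := hs.toOpenPartialHomeomorph_coe
  have hmem' : ((0 : ℝ), (0 : ℝ), (0 : ℝ), (0 : ℝ), (0 : ℝ)) ∈ e.target := by
    rw [← hbase, ← hcoe]; exact e.map_source hmem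
  have hcurve : Tendsto (fun ε : ℝ => (ε, (0 : ℝ), (0 : ℝ), (0 : ℝ), (0 : ℝ))) (𝓝 0)
      (𝓝 (0, 0, 0, 0, 0)) :=
    (show Continuous fun ε : ℝ => (ε, (0 : ℝ), (0 : ℝ), (0 : ℝ), (0 : ℝ)) by fun_prop).tendsto' _ _
      rfl
  refine ⟨e.source, e.open_source.mem_nhds hmem, hcoe ▸ e.injOn,
    fun ε => e.symm (ε, 0, 0, 0, 0), ?_, ?_⟩
  · have := (e.continuousAt_symm hmem').tendsto.comp hcurve
    rwa [show e.symm (0, 0, 0, 0, 0) = (0, h, h, h, h) by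
      rw [← hbase, ← hcoe]; exact e.left_inv hmem] at this
  · filter_upwards [hcurve.eventually (e.open_target.mem_nhds hmem')] with ε hε
    rw [← hcoe]
    exact e.right_inv hε

/-! ### Convergence of the orbits -/

/-- Trajectory pieces depend continuously, in the Hausdorff distance, on the parameter and on the
duration. -/
theorem tendsto_hausdorffEDist_image {X : Type*} [UniformSpace X] [LocallyCompactSpace X]
    {φ : X → ℝ → ℝ × ℝ} (hφ : Continuous fun q : X × ℝ => φ q.1 q.2) {l : Filter ℝ}
    {x : ℝ → X} {x₀ : X} (hx : Tendsto x l (𝓝 x₀)) {T : ℝ → ℝ} {T₀ : ℝ}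
    (hT : Tendsto T l (𝓝 T₀)) (hT₀ : 0 ≤ T₀) (hpos : ∀ᶠ ε in l, 0 ≤ T ε) :
    Tendsto (fun ε => Metric.hausdorffEDist (φ (x ε) '' Icc 0 (T ε)) (φ x₀ '' Icc 0 T₀)) l
      (𝓝 0) := by
  have hresc : ∀ y S, 0 ≤ S → φ y '' Icc 0 S = range fun s : Icc (0 : ℝ) 1 => φ y (s * S) := by
    intro y S hS
    ext z
    constructor
    · rintro ⟨t, ht, rfl⟩
      rcases hS.eq_or_lt with rfl | hS
      · exact ⟨⟨0, by simp⟩, by simp [le_antisymm ht.2 ht.1]⟩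
      · exact ⟨⟨t / S, div_nonneg ht.1 hS.le, (div_le_one hS).2 ht.2⟩, by
          simp only; rw [div_mul_cancel₀ _ hS.ne']⟩
    · rintro ⟨s, rfl⟩
      exact ⟨s * S, ⟨mul_nonneg s.2.1 hS, mul_le_of_le_one_left hS s.2.2⟩, rfl⟩
  have hunif := Continuous.tendstoUniformly (fun (q : X × ℝ) (s : Icc (0 : ℝ) 1) => φ q.1 (s * q.2))
    (by
      have h2 : Continuous fun r : (X × ℝ) × Icc (0 : ℝ) 1 => (r.1.1, (r.2 : ℝ) * r.1.2) := by
        fun_prop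
      exact hφ.comp h2) (x₀, T₀)
  rw [EMetric.tendstoUniformly_iff] at hunif
  have hxT : Tendsto (fun ε => (x ε, T ε)) l (𝓝 (x₀, T₀)) := hx.prodMk_nhds hT
  rw [ENNReal.tendsto_nhds_zero]
  intro r hr
  filter_upwards [hxT.eventually (hunif r hr), hpos] with ε hε hp
  rw [hresc _ _ hp, hresc _ _ hT₀]
  refine Metric.hausdorffEDist_le_of_mem_edist ?_ ?_
  · rintro _ ⟨s, rfl⟩
    exact ⟨_, ⟨s, rfl⟩, by rw [edist_comm]; exact (hε s).le⟩
  · rintro _ ⟨s, rfl⟩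
    exact ⟨_, ⟨s, rfl⟩, (hε s).le⟩

theorem tendsto_hausdorffEDist_union {l : Filter ℝ} {A B : ℝ → Set (ℝ × ℝ)} {A₀ B₀ : Set (ℝ × ℝ)}
    (hA : Tendsto (fun ε => Metric.hausdorffEDist (A ε) A₀) l (𝓝 0))
    (hB : Tendsto (fun ε => Metric.hausdorffEDist (B ε) B₀) l (𝓝 0)) :
    Tendsto (fun ε => Metric.hausdorffEDist (A ε ∪ B ε) (A₀ ∪ B₀)) l (𝓝 0) := by
  have := hA.max hB
  rw [max_self] at this
  exact tendsto_of_tendsto_of_tendsto_of_le_of_le tendsto_const_nhds this (fun _ => zero_le)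
    fun _ => Metric.hausdorffEDist_union_le

theorem Params.tendsto_loop (p : Params) {h : ℝ} (h₀ : 0 < h) (h₁ : h < 1) {l : Filter ℝ}
    {e y₁ y₂ y₃ y₄ : ℝ → ℝ} (he : Tendsto e l (𝓝 0)) (t₁ : Tendsto y₁ l (𝓝 h))
    (t₂ : Tendsto y₂ l (𝓝 h)) (t₃ : Tendsto y₃ l (𝓝 h)) (t₄ : Tendsto y₄ l (𝓝 h)) :
    Tendsto (fun ε => Metric.hausdorffEDist (p.loop (e ε) (y₁ ε) (y₂ ε) (y₃ ε) (y₄ ε))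
      (p.loop 0 h h h h)) l (𝓝 0) := by
  have tR : Tendsto (fun ε => p.timeR (e ε) (y₁ ε) (y₂ ε)) l (𝓝 (p.timeR 0 h h)) := by
    unfold Params.timeR
    exact (((t₁.const_add 1).sub (he.mul_const p.b)).log (by linarith)).sub
      (((t₂.const_sub 1).sub (he.mul_const p.b)).log (by linarith))
  have tC : ∀ {f g : ℝ → ℝ}, Tendsto f l (𝓝 h) → Tendsto g l (𝓝 h) →
      Tendsto (fun ε => timeC (f ε) (g ε)) l (𝓝 (timeC h h)) := fun hf hg => by
    unfold timeC
    exact (((Real.continuous_arctan.tendsto h).comp hf).const_sub _).sub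
      ((Real.continuous_arctan.tendsto h).comp hg)
  have tL : Tendsto (fun ε => timeL (y₃ ε) (y₄ ε)) l (𝓝 (timeL h h)) := by
    unfold timeL
    exact ((Real.continuous_arctan.tendsto _).comp (t₃.div_const 2)).add
      ((Real.continuous_arctan.tendsto _).comp (t₄.div_const 2))
  have pR : 0 < p.timeR 0 h h := by
    unfold Params.timeR
    rw [sub_pos]
    exact Real.log_lt_log (by linarith) (by linarith)
  have pC : 0 < timeC h h := (timeC_mem h₀ h₀).1
  have pL : 0 < timeL h h := timeL_pos h₀ h₀
  have arc : ∀ {φ : ℝ → ℝ × ℝ → ℝ → ℝ × ℝ},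
      (Continuous fun q : (ℝ × ℝ × ℝ) × ℝ => φ q.1.1 q.1.2 q.2) →
      ∀ {z : ℝ → ℝ × ℝ} {z₀ : ℝ × ℝ}, Tendsto z l (𝓝 z₀) → ∀ {T : ℝ → ℝ} {T₀ : ℝ},
      Tendsto T l (𝓝 T₀) → 0 < T₀ →
      Tendsto (fun ε => Metric.hausdorffEDist (φ (e ε) (z ε) '' Icc 0 (T ε))
        (φ 0 z₀ '' Icc 0 T₀)) l (𝓝 0) := fun {φ} hφ {z z₀} hz {T T₀} hT hT₀ =>
    tendsto_hausdorffEDist_image (X := ℝ × ℝ × ℝ) (φ := fun x => φ x.1 x.2) hφ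
      (x := fun ε => (e ε, z ε)) (he.prodMk_nhds hz) hT hT₀.le
      ((hT.eventually (lt_mem_nhds hT₀)).mono fun _ h => h.le)
  have fR : Continuous fun q : (ℝ × ℝ × ℝ) × ℝ => p.flowR q.1.1 q.1.2 q.2 := by
    unfold Params.flowR; fun_prop
  have fC : Continuous fun q : (ℝ × ℝ × ℝ) × ℝ => p.flowC q.1.1 q.1.2 q.2 := by
    unfold Params.flowC; fun_prop
  have fL : Continuous fun q : (ℝ × ℝ × ℝ) × ℝ => p.flowL q.1.1 q.1.2 q.2 := by
    unfold Params.flowL; fun_prop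
  unfold Params.loop
  exact tendsto_hausdorffEDist_union (tendsto_hausdorffEDist_union (tendsto_hausdorffEDist_union
    (arc fR (tendsto_const_nhds.prodMk_nhds t₁) tR pR)
    (arc fC (tendsto_const_nhds.prodMk_nhds t₂.neg) (tC t₂ t₃) pC))
    (arc fL (tendsto_const_nhds.prodMk_nhds t₃.neg) tL pL))
    (arc fC (tendsto_const_nhds.prodMk_nhds t₄) (tC t₄ t₁) pC)

/-! ### Limit cycles from simple zeros of the displacement function -/

theorem Params.eventually_admissible (p : Params) (hkC : 0 ≤ p.kC) {lo hi : ℝ} (h₀ : 0 < lo)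
    (h₁ : hi < 1) : ∀ᶠ ε in 𝓝[>] (0 : ℝ), ∀ y ∈ Ioo lo hi, p.Admissible ε y := by
  have c₁ : ∀ᶠ ε in 𝓝[>] (0 : ℝ), ε * p.b < 1 - hi :=
    ((show Continuous fun ε : ℝ => ε * p.b by fun_prop).tendsto' 0 0 (by simp)).mono_left
      nhdsWithin_le_nhds |>.eventually (gt_mem_nhds (by linarith))
  have c₂ : ∀ᶠ ε in 𝓝[>] (0 : ℝ),
      |ε * p.kC| + 2 * |ε * p.kL| + (|ε * p.b| + 4 * |ε * p.kR|) < lo :=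
    ((show Continuous fun ε : ℝ =>
        |ε * p.kC| + 2 * |ε * p.kL| + (|ε * p.b| + 4 * |ε * p.kR|) by fun_prop).tendsto' 0 0
      (by simp)).mono_left nhdsWithin_le_nhds |>.eventually (gt_mem_nhds h₀)
  filter_upwards [c₁, c₂, self_mem_nhdsWithin] with ε e₁ e₂ hε y hy
  have hε : 0 < ε := hε
  have a₁ := le_abs_self (ε * p.kC)
  have a₂ := le_abs_self (ε * p.kL)
  have a₃ := neg_abs_le (ε * p.kL)
  have a₄ := le_abs_self (ε * p.b)
  have a₅ := neg_abs_le (ε * p.b)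
  have a₆ := le_abs_self (ε * p.kR)
  have a₇ := neg_abs_le (ε * p.kR)
  have n₁ := abs_nonneg (ε * p.kC)
  have n₂ := abs_nonneg (ε * p.kL)
  have n₃ := abs_nonneg (ε * p.b)
  have n₄ := abs_nonneg (ε * p.kR)
  have hy₀ : 0 < y := h₀.trans hy.1
  have hy₁ : y < 1 := hy.2.trans h₁
  refine ⟨hy₀, hy₁, by linarith [hy.2], mul_nonneg hε.le hkC, by linarith [hy.1],
    by linarith [hy.1], by linarith [hy.1], ?_, ?_⟩
  · have : ε * p.kR * (1 - y) ≤ |ε * p.kR| * 1 :=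
      mul_le_mul a₆ (by linarith) (by linarith) n₄
    linarith [hy.1]
  · have : -|ε * p.kR| * (1 + y) ≤ ε * p.kR * (1 + y) :=
      mul_le_mul_of_nonneg_right a₇ (by linarith)
    have : |ε * p.kR| * (1 + y) ≤ |ε * p.kR| * 2 :=
      mul_le_mul_of_nonneg_left (by linarith) n₄
    linarith [hy.1]

/-- At `ε = 0` all heights of a closed orbit agree. -/
theorem Params.isCycle_zero (p : Params) {h : ℝ} (h₀ : 0 < h) (h₁ : h < 1) :
    p.IsCycle 0 h h h h := by
  have ha : p.Admissible 0 h := by constructor <;> (try simp only [zero_mul, mul_zero]) <;> linarith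
  refine ⟨ha, ha, ha, ha, ?_, ?_, ?_, ?_⟩
  · rw [p.relR_iff]; ring
  · rw [p.relC_iff]; ring
  · rw [p.relL_iff]; ring
  · rw [p.relC_iff]; ring

/-- Limit cycles `Γ ε` continuing the annulus orbit at a simple zero of the displacement function.
The height `y ε` of the only point of `Γ ε` on the upper half of `x = 1` serves to distinguish the
limit cycles that belong to different zeros. -/
theorem Params.exists_limitCycles (p : Params) (hkC : 0 < p.kC) {h m : ℝ} (h₀ : 0 < h)
    (h₁ : h < 1) (hzero : p.melnikov h = 0) (hm : HasDerivAt p.melnikov m h) (hm0 : m ≠ 0) :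
    ∃ Γ : ℝ → Set (ℝ × ℝ), ∃ y : ℝ → ℝ, Tendsto y (𝓝[>] 0) (𝓝 h) ∧
      Tendsto (fun ε => Metric.hausdorffEDist (Γ ε) (p.loop 0 h h h h)) (𝓝[>] 0) (𝓝 0) ∧
      ∀ᶠ ε in 𝓝[>] 0, IsCrossingLimitCycle (p.X ε) (Γ ε) ∧
        ∀ x, 0 < x → ((1, x) ∈ Γ ε ↔ x = y ε) := by
  obtain ⟨V, hV, hinj, z, hz, hclose⟩ := p.exists_branch h₀ h₁ hzero hm hm0
  obtain ⟨r, hr, hball⟩ := Metric.mem_nhds_iff.1 hV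
  set s := min (r / 2) (min (h / 2) ((1 - h) / 2))
  have hs : 0 < s := lt_min (half_pos hr) (lt_min (half_pos h₀) (by linarith))
  have hs₁ : s ≤ r / 2 := min_le_left _ _
  have hs₂ : s ≤ h / 2 := (min_le_right _ _).trans (min_le_left _ _)
  have hs₃ : s ≤ (1 - h) / 2 := (min_le_right _ _).trans (min_le_right _ _)
  set W := Ioo (h - s) (h + s)
  have hWr : ∀ x ∈ W, dist x h < r := fun x hx => by
    rw [Real.dist_eq, abs_lt]; constructor <;> linarith [hx.1, hx.2]
  have hinV : ∀ ε, |ε| < r → ∀ x₁ ∈ W, ∀ x₂ ∈ W, ∀ x₃ ∈ W, ∀ x₄ ∈ W,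
      (ε, x₁, x₂, x₃, x₄) ∈ V := fun ε hε x₁ k₁ x₂ k₂ x₃ k₃ x₄ k₄ => by
    refine hball ?_
    rw [Metric.mem_ball]
    simp only [Prod.dist_eq, max_lt_iff]
    exact ⟨by simpa using hε, hWr _ k₁, hWr _ k₂, hWr _ k₃, hWr _ k₄⟩
  have hz' := hz.mono_left (nhdsWithin_le_nhds (s := Ioi 0))
  have z₁ : Tendsto (fun ε => (z ε).2.1) (𝓝[>] 0) (𝓝 h) :=
    ((continuous_fst.comp continuous_snd).tendsto _).comp hz'
  have z₂ : Tendsto (fun ε => (z ε).2.2.1) (𝓝[>] 0) (𝓝 h) :=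
    ((continuous_fst.comp (continuous_snd.comp continuous_snd)).tendsto _).comp hz'
  have z₃ : Tendsto (fun ε => (z ε).2.2.2.1) (𝓝[>] 0) (𝓝 h) :=
    ((continuous_fst.comp (continuous_snd.comp (continuous_snd.comp continuous_snd))).tendsto
      _).comp hz'
  have z₄ : Tendsto (fun ε => (z ε).2.2.2.2) (𝓝[>] 0) (𝓝 h) :=
    ((continuous_snd.comp (continuous_snd.comp (continuous_snd.comp continuous_snd))).tendsto
      _).comp hz'
  have hW : W ∈ 𝓝 h := Ioo_mem_nhds (by linarith) (by linarith)
  have hid : Tendsto (fun ε : ℝ => ε) (𝓝[>] 0) (𝓝 0) := tendsto_id.mono_left nhdsWithin_le_nhds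
  have hεr : ∀ᶠ ε in 𝓝[>] (0 : ℝ), |ε| < r :=
    (hid.abs.eventually (gt_mem_nhds (by simpa using hr)))
  refine ⟨fun ε => p.loop ε (z ε).2.1 (z ε).2.2.1 (z ε).2.2.2.1 (z ε).2.2.2.2, fun ε => (z ε).2.1,
    z₁, p.tendsto_loop h₀ h₁ hid z₁ z₂ z₃ z₄, ?_⟩
  filter_upwards [p.eventually_admissible hkC.le (lo := h - s) (hi := h + s) (by linarith)
    (by linarith), hclose.filter_mono nhdsWithin_le_nhds, self_mem_nhdsWithin, hεr,
    z₁.eventually hW, z₂.eventually hW, z₃.eventually hW, z₄.eventually hW]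
    with ε adm hcl hε hεr w₁ w₂ w₃ w₄
  have hε : 0 < ε := hε
  have hzε : z ε = (ε, (z ε).2.1, (z ε).2.2.1, (z ε).2.2.2.1, (z ε).2.2.2.2) := by
    have : (z ε).1 = ε := congrArg Prod.fst hcl
    ext <;> simp [this]
  generalize (z ε).2.1 = y₁ at *
  generalize (z ε).2.2.1 = y₂ at *
  generalize (z ε).2.2.2.1 = y₃ at *
  generalize (z ε).2.2.2.2 = y₄ at *
  rw [hzε] at hcl
  have hrel := (p.closing_eq_iff hε.ne' y₁ y₂ y₃ y₄).1 hcl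
  have hcyc : p.IsCycle ε y₁ y₂ y₃ y₄ := ⟨adm _ w₁, adm _ w₂, adm _ w₃, adm _ w₄, hrel.1,
    hrel.2.1, hrel.2.2.1, hrel.2.2.2⟩
  refine ⟨hcyc.isCrossingLimitCycle adm (mul_pos hε hkC).ne' w₁ w₂ w₃ w₄ ?_, ?_⟩
  · intro x₁ k₁ x₂ k₂ x₃ k₃ x₄ k₄ hx
    have hx' := (p.closing_eq_iff hε.ne' x₁ x₂ x₃ x₄).2 ⟨hx.relR, hx.relC, hx.relL, hx.relC'⟩
    have := hinj (hinV ε hεr x₁ k₁ x₂ k₂ x₃ k₃ x₄ k₄) (hinV ε hεr y₁ w₁ y₂ w₂ y₃ w₃ y₄ w₄)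
      (hx'.trans hcl.symm)
    simpa using this
  · intro x hx
    have hiff : (1, x) ∈ p.loop ε y₁ y₂ y₃ y₄ ↔
        ((1, x) : ℝ × ℝ) ∈ p.loop ε y₁ y₂ y₃ y₄ ∩ {z | z.1 = -1 ∨ z.1 = 1} :=
      ⟨fun hm => ⟨hm, Or.inr rfl⟩, fun hm => hm.1⟩
    rw [hiff, hcyc.loop_inter_lines]
    have := hcyc.adm₂.pos
    have h11 : (1 : ℝ) ≠ -1 := by norm_num
    simp only [mem_insert_iff, mem_singleton_iff, Prod.mk.injEq, true_and, h11, false_and,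
      or_false]
    constructor
    · rintro (h | h)
      · exact h
      · linarith
    · exact Or.inl

/-! ### A displacement function with three simple zeros -/

theorem sub_le_arctan {x : ℝ} (hx : 0 ≤ x) : x - x ^ 3 / 3 ≤ Real.arctan x := by
  have hd : ∀ y : ℝ, HasDerivAt (fun y => Real.arctan y - (y - y ^ 3 / 3))
      (y ^ 4 / (1 + y ^ 2)) y := fun y => by
    refine ((Real.hasDerivAt_arctan y).sub
      ((hasDerivAt_id y).sub (((hasDerivAt_id y).pow 3).div_const 3))).congr_deriv ?_
    have : 1 + y ^ 2 ≠ 0 := by positivity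
    simp only [id]
    field_simp
    push_cast
    ring
  have hmono := monotone_of_hasDerivAt_nonneg hd fun y => by positivity
  have := hmono hx
  simp at this
  linarith

theorem arctan_le_sub_add {x : ℝ} (hx : 0 ≤ x) :
    Real.arctan x ≤ x - x ^ 3 / 3 + x ^ 5 / 5 := by
  have hd : ∀ y : ℝ, HasDerivAt (fun y => (y - y ^ 3 / 3 + y ^ 5 / 5) - Real.arctan y)
      (y ^ 6 / (1 + y ^ 2)) y := fun y => by
    refine ((((hasDerivAt_id y).sub (((hasDerivAt_id y).pow 3).div_const 3)).add
      (((hasDerivAt_id y).pow 5).div_const 5)).sub (Real.hasDerivAt_arctan y)).congr_deriv ?_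
    have : 1 + y ^ 2 ≠ 0 := by positivity
    simp only [id]
    field_simp
    push_cast
    ring
  have hmono := monotone_of_hasDerivAt_nonneg hd fun y => by positivity
  have := hmono hx
  simp at this
  linarith

/-- A quarter of the displacement function of the parameters `kL = 3`, `kC = 1/400`, `kR = -1`,
`b = 0`. -/
noncomputable def profile (y : ℝ) : ℝ :=
  (1 + y ^ 2) * (Real.pi - 2 * Real.arctan y) / 400 + 3 * (4 + y ^ 2) * Real.arctan (y / 2) +
    (1 - y ^ 2) * (Real.log (1 + y) - Real.log (1 - y)) / 2

theorem melnikov_eq_profile (v y : ℝ) :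
    (Params.mk 3 (1 / 400) (-1) (2 * v)).melnikov y = 4 * (profile y - v * y) := by
  simp only [Params.melnikov, Params.gainR, Params.gainC, Params.gainL, Params.timeR, timeC,
    timeL, profile, zero_mul, sub_zero, expSlope_zero]
  ring

theorem continuousOn_profile : ContinuousOn profile (Icc 0 1) := by
  have hform : ∀ y, profile y = (1 + y ^ 2) * (Real.pi - 2 * Real.arctan y) / 400 +
      3 * (4 + y ^ 2) * Real.arctan (y / 2) + ((1 - y ^ 2) * Real.log (1 + y) -
        (1 + y) * ((1 - y) * Real.log (1 - y))) / 2 := fun y => by unfold profile; ring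
  rw [funext hform]
  have h₁ : ContinuousOn (fun y : ℝ => Real.log (1 + y)) (Icc 0 1) :=
    ContinuousOn.log (by fun_prop) fun y hy => by linarith [hy.1]
  -- `u * log u` is continuous at `u = 0`, which covers the endpoint `y = 1`
  have h₂ : Continuous fun y : ℝ => (1 - y) * Real.log (1 - y) :=
    Real.continuous_mul_log.comp (continuous_const.sub continuous_id)
  fun_prop

theorem differentiableAt_profile {y : ℝ} (hy : y ∈ Ioo (0 : ℝ) 1) :
    DifferentiableAt ℝ profile y := by
  have h₁ : 1 + y ≠ 0 := by linarith [hy.1]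
  have h₂ : 1 - y ≠ 0 := by linarith [hy.2]
  have h₃ := Real.differentiableAt_arctan y
  have h₄ : DifferentiableAt ℝ (fun y : ℝ => Real.arctan (y / 2)) y :=
    DifferentiableAt.arctan (by fun_prop)
  unfold profile
  fun_prop (disch := assumption)

theorem profile_zero_pos : 0 < profile 0 := by
  simp [profile]
  positivity

theorem profile_one_third_lt : profile (1 / 3) < 7.065 * (1 / 3) := by
  have hlog : Real.log (1 + 1 / 3) - Real.log (1 - 1 / 3) = Real.log 2 := by
    rw [← Real.log_div (by norm_num) (by norm_num)]; norm_num
  have h₁ := arctan_le_sub_add (x := 1 / 3 / 2) (by norm_num)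
  have h₂ : 0 ≤ Real.arctan (1 / 3) := Real.arctan_nonneg.2 (by norm_num)
  unfold profile
  rw [hlog]
  linarith [Real.log_two_lt_d9, Real.pi_lt_d2]

theorem lt_profile_seven_ninths : 7.08 * (7 / 9) < profile (7 / 9) := by
  have hlog : Real.log (1 + 7 / 9) - Real.log (1 - 7 / 9) = 3 * Real.log 2 := by
    rw [← Real.log_div (by norm_num) (by norm_num), show (3 : ℝ) * Real.log 2 =
      ((3 : ℕ) : ℝ) * Real.log 2 by norm_num, ← Real.log_pow]
    norm_num
  have h₁ := sub_le_arctan (x := 7 / 9 / 2) (by norm_num)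
  have h₂ := Real.arctan_lt_pi_div_two (7 / 9)
  unfold profile
  rw [hlog]
  linarith [Real.log_two_gt_d9]

theorem profile_one_lt : profile 1 < 7.065 := by
  have h₁ := arctan_le_sub_add (x := 1 / 2) (by norm_num)
  have h₂ : 0 ≤ Real.arctan 1 := Real.arctan_nonneg.2 (by norm_num)
  unfold profile
  linarith [Real.pi_lt_d2]

/-- Almost every slope `v` is a regular value of `profile y / y`, by the one-dimensional Sard
lemma. -/
theorem exists_regular_slope {lo hi : ℝ} (h : lo < hi) : ∃ v ∈ Ioo lo hi,
    ∀ y ∈ Ioo (0 : ℝ) 1, profile y = v * y → deriv profile y ≠ v := by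
  set S := {y | y ∈ Ioo (0 : ℝ) 1 ∧ deriv profile y * y = profile y}
  have hnull : volume ((fun y => profile y / y) '' S) = 0 := by
    refine addHaar_image_eq_zero_of_det_fderivWithin_eq_zero volume (f' := fun _ => 0) ?_ ?_
    · rintro y ⟨hy, hd⟩
      have hne : y ≠ 0 := hy.1.ne'
      have := (differentiableAt_profile hy).hasDerivAt.div (hasDerivAt_id y) hne
      have h0 : HasDerivAt (fun y => profile y / y) 0 y := by
        refine this.congr_deriv ?_
        simp [hd]
      exact (h0.hasFDerivAt.congr_fderiv (by ext; simp)).hasFDerivWithinAt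
    · intro y _
      simp [ContinuousLinearMap.det]
  obtain ⟨v, hv, hvS⟩ : ∃ v ∈ Ioo lo hi, v ∉ (fun y => profile y / y) '' S := by
    by_contra! hall
    have := (measure_mono hall).trans hnull.le
    rw [Real.volume_Ioo] at this
    simp at this
    linarith
  refine ⟨v, hv, fun y hy hp hd => hvS ⟨y, ⟨hy, by rw [hd, hp]⟩, ?_⟩⟩
  simp only
  rw [hp, mul_div_cancel_right₀ _ hy.1.ne']

/-- The displacement function of the parameters `kL = 3`, `kC = 1/400`, `kR = -1`, `b = 2 v` is
positive at `0`, negative at `1/3`, positive at `7/9` and negative at `1`. -/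
theorem exists_simple_zeros : ∃ p : Params, 0 < p.kC ∧ ∃ h : Fin 3 → ℝ, StrictMono h ∧
    ∀ i, h i ∈ Ioo (0 : ℝ) 1 ∧ p.melnikov (h i) = 0 ∧
      ∃ m, m ≠ 0 ∧ HasDerivAt p.melnikov m (h i) := by
  obtain ⟨v, hv, hreg⟩ := exists_regular_slope (lo := 7.065) (hi := 7.08) (by norm_num)
  have hc : ContinuousOn (fun y => profile y - v * y) (Icc 0 1) :=
    continuousOn_profile.sub (by fun_prop)
  have v₀ : 0 < profile 0 - v * 0 := by simpa using profile_zero_pos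
  have v₁ : profile (1 / 3) - v * (1 / 3) < 0 := by linarith [hv.1, profile_one_third_lt]
  have v₂ : 0 < profile (7 / 9) - v * (7 / 9) := by linarith [hv.2, lt_profile_seven_ninths]
  have v₃ : profile 1 - v * 1 < 0 := by linarith [hv.1, profile_one_lt]
  obtain ⟨a, ha, ha'⟩ := intermediate_value_Ioo' (by norm_num : (0 : ℝ) ≤ 1 / 3)
    (hc.mono (Icc_subset_Icc le_rfl (by norm_num))) ⟨v₁, v₀⟩
  obtain ⟨b, hb, hb'⟩ := intermediate_value_Ioo (by norm_num : (1 / 3 : ℝ) ≤ 7 / 9)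
    (hc.mono (Icc_subset_Icc (by norm_num) (by norm_num))) ⟨v₁, v₂⟩
  obtain ⟨c, hc, hc'⟩ := intermediate_value_Ioo' (by norm_num : (7 / 9 : ℝ) ≤ 1)
    (hc.mono (Icc_subset_Icc (by norm_num) le_rfl)) ⟨v₃, v₂⟩
  have key : ∀ y ∈ Ioo (0 : ℝ) 1, profile y - v * y = 0 → y ∈ Ioo (0 : ℝ) 1 ∧
      (Params.mk 3 (1 / 400) (-1) (2 * v)).melnikov y = 0 ∧
        ∃ m, m ≠ 0 ∧ HasDerivAt (Params.mk 3 (1 / 400) (-1) (2 * v)).melnikov m y := by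
    intro y hy h0
    refine ⟨hy, by rw [melnikov_eq_profile, h0, mul_zero], 4 * (deriv profile y - v), ?_, ?_⟩
    · exact mul_ne_zero four_ne_zero (sub_ne_zero.2 (hreg y hy (sub_eq_zero.1 h0)))
    · rw [funext (melnikov_eq_profile v)]
      have := ((differentiableAt_profile hy).hasDerivAt.sub
        ((hasDerivAt_id y).const_mul v)).const_mul 4
      simpa using this
  refine ⟨⟨3, 1 / 400, -1, 2 * v⟩, by norm_num, ![a, b, c], ?_, ?_⟩
  · refine Fin.strictMono_iff_lt_succ.2 fun i => ?_
    fin_cases i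
    · exact ha.2.trans hb.1
    · exact hb.2.trans hc.1
  · intro i
    fin_cases i
    · exact key a ⟨ha.1, by linarith [ha.2]⟩ ha'
    · exact key b ⟨by linarith [hb.1], by linarith [hb.2]⟩ hb'
    · exact key c ⟨by linarith [hc.1], hc.2⟩ hc'

/-! ### Three limit cycles -/

theorem exists_three_limitCycles : ∃ (p : Params) (h : Fin 3 → ℝ) (Γ : Fin 3 → ℝ → Set (ℝ × ℝ))
    (ε₀ : ℝ), StrictMono h ∧ (∀ i, h i ∈ Ioo (0 : ℝ) 1) ∧ 0 < ε₀ ∧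
      (∀ ε ∈ Ioo 0 ε₀, (∀ i j, i ≠ j → Γ i ε ≠ Γ j ε) ∧
        ∀ i, IsCrossingLimitCycle (p.X ε) (Γ i ε)) ∧
      ∀ i, Tendsto (fun ε => Metric.hausdorffEDist (Γ i ε) (p.loop 0 (h i) (h i) (h i) (h i)))
        (𝓝[>] 0) (𝓝 0) := by
  obtain ⟨p, hkC, h, hmono, hh⟩ := exists_simple_zeros
  choose hmem hzero m hm0 hm using hh
  choose Γ y hy hΓ hev using fun i =>
    p.exists_limitCycles hkC (hmem i).1 (hmem i).2 (hzero i) (hm i) (hm0 i)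
  have hpos : ∀ᶠ ε in 𝓝[>] (0 : ℝ), ∀ i, 0 < y i ε :=
    eventually_all.2 fun i => (hy i).eventually (lt_mem_nhds (hmem i).1)
  have hne : ∀ᶠ ε in 𝓝[>] (0 : ℝ), ∀ i j, i ≠ j → y i ε ≠ y j ε :=
    eventually_all.2 fun i => eventually_all.2 fun j => by
      by_cases hij : i = j
      · exact Eventually.of_forall fun _ h => absurd hij h
      · exact (((hy i).sub (hy j)).eventually_ne (sub_ne_zero.2 (hmono.injective.ne hij))).mono
          fun _ h _ => sub_ne_zero.1 h
  obtain ⟨ε₀, hε₀, hsub⟩ :=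
    mem_nhdsGT_iff_exists_Ioo_subset.1 ((eventually_all.2 hev).and (hpos.and hne))
  refine ⟨p, h, Γ, ε₀, hmono, hmem, hε₀, fun ε hε => ?_, hΓ⟩
  obtain ⟨hcyc, hp, hn⟩ := hsub hε
  refine ⟨fun i j hij heq => hn i j hij ?_, fun i => (hcyc i).1⟩
  -- each cycle meets the upper half of the line `x = 1` in exactly one point
  exact ((hcyc j).2 _ (hp i)).1 (heq ▸ ((hcyc i).2 _ (hp i)).2 rfl)

end ThreeZone

theorem mainTheorem8 :
    -- the left subsystem has a virtual center, the central one a real center,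
    -- the right one a real saddle
    (∃ p, ThreeZone.ccsSystem.L.IsCenter p ∧ p ∉ ThreeZone.zoneL) ∧
    (∃ p, ThreeZone.ccsSystem.C.IsCenter p ∧ p ∈ ThreeZone.zoneC) ∧
    (∃ p, ThreeZone.ccsSystem.R.IsSaddle p ∧ p ∈ ThreeZone.zoneR) ∧
    -- the periodic annulus of the unperturbed system
    ∃ annulus : ℝ → Set (ℝ × ℝ),
      (∀ h ∈ Set.Ioo (0 : ℝ) 1,
        ThreeZone.IsCrossingPeriodicOrbit
          (ThreeZone.unperturbedFields ThreeZone.ccsSystem) (annulus h) ∧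
        annulus h ∩ {z | z.1 = -1 ∨ z.1 = 1} = {(1, h), (1, -h), (-1, -h), (-1, h)}) ∧
      -- three limit cycles bifurcating from it
      ∃ (P : ThreeZone.Zones ThreeZone.PertCoeff) (h : Fin 3 → ℝ)
        (Γ : Fin 3 → ℝ → Set (ℝ × ℝ)) (ε₀ : ℝ),
        StrictMono h ∧ (∀ i, h i ∈ Set.Ioo (0 : ℝ) 1) ∧ 0 < ε₀ ∧
        (∀ ε ∈ Set.Ioo 0 ε₀,
          (∀ i j, i ≠ j → Γ i ε ≠ Γ j ε) ∧
          ∀ i, ThreeZone.IsCrossingLimitCycle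
            (ThreeZone.perturbedFields ThreeZone.ccsSystem P ε) (Γ i ε)) ∧
        ∀ i, Filter.Tendsto (fun ε => Metric.hausdorffEDist (Γ i ε) (annulus (h i)))
          (nhdsWithin 0 (Set.Ioi 0)) (nhds 0) := by
  obtain ⟨p, h, Γ, ε₀, hmono, hmem, hε₀, hcyc, hlim⟩ := ThreeZone.exists_three_limitCycles
  refine ⟨⟨(3, -2), ⟨?_, ?_⟩, ?_⟩, ⟨(0, 0), ⟨?_, ?_⟩, ?_⟩, ⟨(2, 0), ⟨?_, ?_⟩, ?_⟩,
    fun h => p.loop 0 h h h h, fun y hy => ⟨?_, (p.isCycle_zero hy.1 hy.2).loop_inter_lines⟩,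
    p.pert, h, Γ, ε₀, hmono, hmem, hε₀, hcyc, hlim⟩
  · simp only [ThreeZone.HamCoeff.field, ThreeZone.ccsSystem, ThreeZone.normalForm]
    norm_num
  · simp only [ThreeZone.HamCoeff.linearPart, ThreeZone.ccsSystem, ThreeZone.normalForm,
      Matrix.det_fin_two_of]
    norm_num
  · show ¬ ((3 : ℝ) < -1)
    norm_num
  · simp [ThreeZone.HamCoeff.field, ThreeZone.ccsSystem, ThreeZone.normalForm]
  · simp only [ThreeZone.HamCoeff.linearPart, ThreeZone.ccsSystem, ThreeZone.normalForm,
      Matrix.det_fin_two_of]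
    norm_num
  · show (-1 : ℝ) < 0 ∧ (0 : ℝ) < 1
    norm_num
  · simp only [ThreeZone.HamCoeff.field, ThreeZone.ccsSystem, ThreeZone.normalForm]
    norm_num
  · simp only [ThreeZone.HamCoeff.linearPart, ThreeZone.ccsSystem, ThreeZone.normalForm,
      Matrix.det_fin_two_of]
    norm_num
  · show (1 : ℝ) < 2
    norm_num
  · rw [← p.X_zero]
    exact (p.isCycle_zero hy.1 hy.2).isCrossingPeriodicOrbit
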